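/- Let $dS_3$ be three-dimensional de Sitter space (the unit hyperboloid) with metric $h_{ab}\,dx^a dx^b=-d\tau^2+\cosh^2\tau\,(d\theta^2+\sin^2\theta\,d\phi^2)$, Levi-Civita connection $\mathcal D_a$ and volume form $\epsilon_{abc}$ with $\epsilon_{\tau\theta\phi}=\cosh^2\tau\sin\theta$. An SDT tensor is a smooth real symmetric tensor field $T_{ab}$ on $dS_3$ with $h^{ab}T_{ab}=0$ and $\mathcal D^bT_{ab}=0$; put $(\mathrm{curl}\,T)_{ab}=\epsilon_a{}^{cd}\mathcal D_cT_{db}$. Let $f_1=\cos\theta$, $f_2=\sin\theta\cos\phi$, $f_3=\sin\theta\sin\phi$, and $$\zeta_{(0)}=\sinh\tau,\quad \zeta_{(k)}=\cosh\tau\, f_k,\qquad \hat\zeta_{(0)}=\frac{\cosh2\tau}{\cosh\tau},\quad \hat\zeta_{(k)}=\Big(2\sinh\tau+\frac{\tanh\tau}{\cosh\tau}\Big)f_k,\qquad k=1,2,3.$$ (1) Every SDT tensor $T_{ab}$ can be decomposed as $$T_{ab}=(\mathrm{curl}\,\tilde T)_{ab}+\mathcal D_a\mathcal D_b\hat\zeta+h_{ab}\hat\zeta,$$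 where $\tilde T_{ab}$ is an SDT tensor and $\hat\zeta=\sum_{i=0}^3c_i\hat\zeta_{(i)}$ with real constants $c_i$. (2) Consequently the translation charges of $T_{ab}$ depend only on the coefficients $c_i$: for every such decomposition, every smooth spacelike cut $S=\{\tau=u(\theta,\phi)\}$ of $dS_3$ ($u$ a smooth function on the two-sphere), with future unit normal $n^a$ and induced area element $d^2S$, and every $i=0,1,2,3$, $$\int_S T_{ab}\,(\mathcal D^a\zeta_{(i)})\,n^b\,d^2S=\int_S\big(\mathcal D_a\mathcal D_b\hat\zeta+h_{ab}\hat\zeta\big)(\mathcal D^a\zeta_{(i)})\,n^b\,d^2S .$$ -/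

import Mathlib

open scoped ContDiff

namespace DeSitter

/-! Three-dimensional de Sitter space is the unit hyperboloid in Minkowski space `ℝ^{1,3}`.
Scalars and tensors on it are functions of the ambient point of which only the values on the
hyperboloid matter; a covariant tensor is given by its ambient components, annihilated by the
position vector. -/

/-- Minkowski space, with coordinates `x 0` (time) and `x 1, x 2, x 3`. -/
abbrev Mink := Fin 4 → ℝ

/-- Scalar fields. -/
abbrev Scalar := Mink → ℝ

/-- Covector fields, `w x A = w_A(x)`. -/
abbrev Covector := Mink → Fin 4 → ℝ

/-- Covariant two-tensor fields, `T x A B = T_{AB}(x)`. -/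
abbrev Tensor := Mink → Fin 4 → Fin 4 → ℝ

/-- The diagonal of the Minkowski metric `diag(-1, 1, 1, 1)`, used to raise and lower indices. -/
def eta (A : Fin 4) : ℝ := if A = 0 then -1 else 1

/-- The Minkowski inner product. -/
def mink (x y : Mink) : ℝ := ∑ A, eta A * x A * y A

/-- The unit hyperboloid `dS₃`. -/
def dS3 : Set Mink := {x | mink x x = 1}

/-- The open region of spacelike vectors, which the hyperboloid slices once along each ray. -/
def spacelikeRegion : Set Mink := {x | 0 < mink x x}

/-- The radial retraction of the spacelike region onto the hyperboloid. -/
noncomputable def radial (x : Mink) : Mink := (√(mink x x))⁻¹ • x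

/-- `f` restricts to a smooth function on the hyperboloid (equivalently, its radially constant
extension is smooth on the spacelike region). -/
def Smooth (f : Scalar) : Prop :=
  ContDiffOn ℝ ∞ (fun y => f (radial y)) spacelikeRegion

/-- The differential of `f` along the hyperboloid, as a covector field `D_C f`: at a point of `dS₃`
the differential of the radially constant extension agrees with `df` on tangent vectors and
annihilates the position vector. -/
noncomputable def grad (f : Scalar) : Covector := fun x C =>
  fderiv ℝ (fun y => f (radial y)) x (Pi.single C 1)

/-- The orthogonal projection `δ_A^B - x_A x^B` onto the tangent space of the hyperboloid. -/
def proj (x : Mink) (A B : Fin 4) : ℝ := (if A = B then 1 else 0) - eta A * x A * x B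

/-- The metric `h_{AB} = η_{AB} - x_A x_B` induced on the hyperboloid. -/
def metric : Tensor := fun x A B =>
  (if A = B then eta A else 0) - (eta A * x A) * (eta B * x B)

/-- The Levi-Civita connection of the hyperboloid on covectors, `D_C w_A`: the tangential part of
the ambient derivative along the hyperboloid. -/
noncomputable def covDerivCovector (w : Covector) (x : Mink) (C A : Fin 4) : ℝ :=
  ∑ A', proj x A A' * grad (fun y => w y A') x C

/-- The Levi-Civita connection of the hyperboloid on covariant two-tensors, `D_C T_{AB}`. -/
noncomputable def covDeriv (T : Tensor) (x : Mink) (C A B : Fin 4) : ℝ :=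
  ∑ A', ∑ B', proj x A A' * proj x B B' * grad (fun y => T y A' B') x C

/-- The divergence `D^B T_{AB}`. -/
noncomputable def divergence (T : Tensor) : Covector := fun x A =>
  ∑ B, eta B * covDeriv T x B A B

/-- The volume form of the hyperboloid, oriented so that `ε_{τθφ} = cosh²τ sin θ`. -/
def vol (x u v w : Mink) : ℝ := Matrix.det (Matrix.of ![u, x, v, w])

/-- The components `ε_{ABC}` of the volume form. -/
def eps (x : Mink) (A B C : Fin 4) : ℝ :=
  vol x (Pi.single A 1) (Pi.single B 1) (Pi.single C 1)

/-- The curl `(curl T)_{AB} = ε_A^{CD} D_C T_{DB}`. -/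
noncomputable def curl (T : Tensor) : Tensor := fun x A B =>
  ∑ C, ∑ D, eps x A C D * eta C * eta D * covDeriv T x C D B

/-- The tensor `D_A D_B f + h_{AB} f`. -/
noncomputable def potentialTensor (f : Scalar) : Tensor := fun x A B =>
  covDerivCovector (grad f) x A B + metric x A B * f x

/-- Smooth symmetric traceless divergence-free tensor fields on `dS₃`. -/
structure IsSDT (T : Tensor) : Prop where
  smooth : ∀ A B, Smooth (fun x => T x A B)
  tangent : ∀ x ∈ dS3, ∀ A, ∑ B, T x A B * x B = 0
  symm : ∀ x ∈ dS3, ∀ A B, T x A B = T x B A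
  traceless : ∀ x ∈ dS3, ∑ A, eta A * T x A A = 0
  divFree : ∀ x ∈ dS3, ∀ A, divergence T x A = 0

/-- The global time coordinate `τ`. -/
noncomputable def tau (x : Mink) : ℝ := Real.arsinh (x 0)

/-- The three `l = 1` harmonics `cos θ`, `sin θ cos φ`, `sin θ sin φ` of the two-sphere, as
functions on `dS₃`. -/
noncomputable def harm (k : Fin 3) : Scalar := fun x => x k.succ / Real.cosh (tau x)

/-- The odd lowest harmonics `sinh τ`, `cosh τ f_k`. -/
noncomputable def zeta : Fin 4 → Scalar :=
  Fin.cases (fun x => Real.sinh (tau x)) (fun k x => Real.cosh (tau x) * harm k x)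

/-- The even lowest harmonics `cosh 2τ / cosh τ`, `(2 sinh τ + tanh τ / cosh τ) f_k`. -/
noncomputable def zetaHat : Fin 4 → Scalar :=
  Fin.cases (fun x => Real.cosh (2 * tau x) / Real.cosh (tau x))
    (fun k x => (2 * Real.sinh (tau x) + Real.tanh (tau x) / Real.cosh (tau x)) * harm k x)

/-- The combination of the even lowest harmonics with coefficients `c`. -/
noncomputable def zetaHatComb (c : Fin 4 → ℝ) : Scalar := fun x => ∑ i, c i * zetaHat i x

/-- `T = curl T' + D D ζ̂ + h ζ̂` on `dS₃`, where `ζ̂` has the coefficients `c`. -/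
def Decomposes (T T' : Tensor) (c : Fin 4 → ℝ) : Prop :=
  ∀ x ∈ dS3, ∀ A B, T x A B = curl T' x A B + potentialTensor (zetaHatComb c) x A B

/-- The point of the unit two-sphere with polar angle `θ` and azimuth `φ` (polar axis first). -/
noncomputable def sph (θ φ : ℝ) : Fin 3 → ℝ :=
  ![Real.cos θ, Real.sin θ * Real.cos φ, Real.sin θ * Real.sin φ]

/-- The point of `dS₃` with coordinates `(τ, θ, φ)`. -/
noncomputable def point (τ θ φ : ℝ) : Mink :=
  Fin.cons (Real.sinh τ) (fun k => Real.cosh τ * sph θ φ k)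

/-- The point over `(θ, φ)` of the cut `τ = u` of the hyperboloid, `u` a function on the sphere. -/
noncomputable def cutPoint (u : (Fin 3 → ℝ) → ℝ) (θ φ : ℝ) : Mink := point (u (sph θ φ)) θ φ

/-- The coordinate vector `∂_θ` of the cut. -/
noncomputable def cutTheta (u : (Fin 3 → ℝ) → ℝ) (θ φ : ℝ) : Mink :=
  deriv (fun s => cutPoint u s φ) θ

/-- The coordinate vector `∂_φ` of the cut. -/
noncomputable def cutPhi (u : (Fin 3 → ℝ) → ℝ) (θ φ : ℝ) : Mink :=
  deriv (fun s => cutPoint u θ s) φ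

/-- The cut `τ = u` is smooth and spacelike. (Spacelikeness is only asked for away from the two
poles of the coordinates, a null set for the integrals below.) -/
structure IsCut (u : (Fin 3 → ℝ) → ℝ) : Prop where
  smooth : ContDiff ℝ ∞ u
  spacelike : ∀ θ ∈ Set.Ioo 0 Real.pi, ∀ φ a b : ℝ, (a ≠ 0 ∨ b ≠ 0) →
    0 < mink (a • cutTheta u θ φ + b • cutPhi u θ φ) (a • cutTheta u θ φ + b • cutPhi u θ φ)

/-- The density of the induced area element `d²S` of the cut with respect to `dθ dφ`. -/
noncomputable def areaDensity (u : (Fin 3 → ℝ) → ℝ) (θ φ : ℝ) : ℝ :=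
  √(mink (cutTheta u θ φ) (cutTheta u θ φ) * mink (cutPhi u θ φ) (cutPhi u θ φ)
    - mink (cutTheta u θ φ) (cutPhi u θ φ) ^ 2)

/-- The future-pointing normal `-ε^A_{BC} (∂_θ)^B (∂_φ)^C` of the cut within `dS₃`. -/
noncomputable def normal (u : (Fin 3 → ℝ) → ℝ) (θ φ : ℝ) : Mink := fun A =>
  -(eta A * vol (cutPoint u θ φ) (Pi.single A 1) (cutTheta u θ φ) (cutPhi u θ φ))

/-- The future-pointing unit normal `n` of the cut. -/
noncomputable def unitNormal (u : (Fin 3 → ℝ) → ℝ) (θ φ : ℝ) : Mink :=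
  (√(-mink (normal u θ φ) (normal u θ φ)))⁻¹ • normal u θ φ

/-- The charge `∫_S T_{AB} (D^A f) n^B d²S` over the cut `S` given by `τ = u`. -/
noncomputable def charge (u : (Fin 3 → ℝ) → ℝ) (T : Tensor) (f : Scalar) : ℝ :=
  ∫ φ in (0 : ℝ)..(2 * Real.pi), ∫ θ in (0 : ℝ)..Real.pi,
    (∑ A, ∑ B, T (cutPoint u θ φ) A B * (eta A * grad f (cutPoint u θ φ) A)
      * unitNormal u θ φ B) * areaDensity u θ φ

end DeSitter

open scoped ContDiff

namespace DeSitter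

open Set

/-! Fields on the hyperboloid are replaced by homogeneous extensions to the cone of spacelike
vectors, where covariant operators become flat ones. For a symmetric tangential extension of any
degree, the divergence on `dS3` is the flat divergence up to a multiple of the trace
(`IsExtension.divergence_eq`), the curl is the flat curl contracted with `eps`
(`IsExtension.curl_eq`), and `D D f + h f` is the flat Hessian of the degree-one extension of `f`
(`potentialTensor_eq`). The odd harmonics are the ambient coordinates (`zeta_eq`), so a translation
charge is, up to the sign `eta`, the flux of `S A B` with the constant index `B` held fixed.

Existence. Extend `T` with degree -3. For each fixed `B` the current `S · B` is divergence-free,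
hence dual to a closed two-form; since `dS3` is a line times a sphere, the only obstruction to
exactness is the flux through the sphere at time zero. The even harmonics extend to degree-one
solutions of the flat wave equation (`box_zetaExt`), so their Hessians are SDT, and their matrix of
fluxes is 8π times the identity (`sphereInt_hessian_zetaExt`). Subtracting a suitable combination
therefore kills all four fluxes, and each current acquires a potential (`exists_potential`). That
potential is explicit: on the sphere a function of mean zero is a sum of derivatives along two
rotations, found by averaging over Euler angles (`exists_angD_add_angD`), and integration in time
carries the result off the sphere.

The four potentials form a matrix without any symmetry (`IsHomSDT.exists_potential` repairs this).
Adding gradients makes the position vector annihilate both slots, and differentiating these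
contractions forces the matrix to be symmetric. Adding the Hessian of a solution of an inhomogeneous
wave equation, given by the retarded potential (`exists_box_eq`), removes the trace. The divergence
then vanishes by the curl equation. The curl of the outcome is `S` (`IsHomSDT.exists_curl_eq`).

Charges. The two sides differ by the charge of `curl T'`, which is symmetric, being a difference of
symmetric tensors. The free index can thus be moved to the second slot, where the integrand is the
pull-back to the cut of the exterior derivative of a one-form; Green's theorem gives zero
(`integral_curl_eq_zero`). -/

/-! ### Partial derivatives on the spacelike region -/

/-- The partial derivative of a function on Minkowski space. -/
noncomputable def pd (f : Scalar) (C : Fin 4) : Scalar := fun x => fderiv ℝ f x (Pi.single C 1)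

/-- Smoothness on the region of spacelike vectors. -/
abbrev SmoothOn (f : Scalar) : Prop := ContDiffOn ℝ ∞ f spacelikeRegion

theorem mink_eq (x y : Mink) :
    mink x y = -(x 0 * y 0) + x 1 * y 1 + x 2 * y 2 + x 3 * y 3 := by
  simp [mink, eta, Fin.sum_univ_four]

theorem mem_region_iff {x : Mink} :
    x ∈ spacelikeRegion ↔ x 0 ^ 2 < x 1 ^ 2 + x 2 ^ 2 + x 3 ^ 2 := by
  simp only [spacelikeRegion, mem_ofPred_eq, mink_eq]
  constructor <;> intro h <;> nlinarith

theorem contDiff_mink : ContDiff ℝ ∞ fun x : Mink => mink x x := by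
  unfold mink; fun_prop

theorem isOpen_region : IsOpen spacelikeRegion :=
  isOpen_lt continuous_const contDiff_mink.continuous

theorem dS3_subset_region : dS3 ⊆ spacelikeRegion := fun x hx => by
  have : mink x x = 1 := hx
  simp [spacelikeRegion, this]

theorem mink_smul_smul (c : ℝ) (x : Mink) : mink (c • x) (c • x) = c ^ 2 * mink x x := by
  simp only [mink_eq, Pi.smul_apply, smul_eq_mul]; ring

theorem smul_mem_region {x : Mink} (hx : x ∈ spacelikeRegion) {c : ℝ} (hc : 0 < c) :
    c • x ∈ spacelikeRegion := by
  simp only [spacelikeRegion, mem_ofPred_eq, mink_smul_smul] at *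
  positivity

theorem SmoothOn.differentiableAt {f : Scalar} (hf : SmoothOn f) {x : Mink}
    (hx : x ∈ spacelikeRegion) : DifferentiableAt ℝ f x :=
  (hf.contDiffAt (isOpen_region.mem_nhds hx)).differentiableAt (by simp)

theorem SmoothOn.pd {f : Scalar} (hf : SmoothOn f) (C : Fin 4) : SmoothOn (pd f C) :=
  (((contDiffOn_infty_iff_fderiv_of_isOpen isOpen_region).1 hf).2).clm_apply contDiffOn_const

theorem SmoothOn.sum {ι : Type*} {s : Finset ι} {f : ι → Scalar} (hf : ∀ i ∈ s, SmoothOn (f i)) :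
    SmoothOn fun x => ∑ i ∈ s, f i x := ContDiffOn.sum hf

theorem smoothOn_coord (A : Fin 4) : SmoothOn fun x => x A := by
  apply ContDiff.contDiffOn; fun_prop

theorem pd_congr {f g : Scalar} (h : ∀ x ∈ spacelikeRegion, f x = g x) {x : Mink}
    (hx : x ∈ spacelikeRegion) (C : Fin 4) : pd f C x = pd g C x := by
  have : f =ᶠ[nhds x] g := by
    filter_upwards [isOpen_region.mem_nhds hx] with y hy using h y hy
  simp only [pd, this.fderiv_eq]

theorem pd_add {f g : Scalar} {x : Mink} (hf : DifferentiableAt ℝ f x)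
    (hg : DifferentiableAt ℝ g x) (C : Fin 4) :
    pd (fun y => f y + g y) C x = pd f C x + pd g C x := by
  simp only [pd]; rw [fderiv_fun_add hf hg]; rfl

theorem pd_sub {f g : Scalar} {x : Mink} (hf : DifferentiableAt ℝ f x)
    (hg : DifferentiableAt ℝ g x) (C : Fin 4) :
    pd (fun y => f y - g y) C x = pd f C x - pd g C x := by
  simp only [pd]; rw [fderiv_fun_sub hf hg]; rfl

theorem pd_mul {f g : Scalar} {x : Mink} (hf : DifferentiableAt ℝ f x)
    (hg : DifferentiableAt ℝ g x) (C : Fin 4) :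
    pd (fun y => f y * g y) C x = pd f C x * g x + f x * pd g C x := by
  simp only [pd]; rw [fderiv_fun_mul hf hg]; simp; ring

theorem pd_const (c : ℝ) (x : Mink) (C : Fin 4) : pd (fun _ => c) C x = 0 := by
  simp [pd]

theorem pd_const_mul {f : Scalar} {x : Mink} (hf : DifferentiableAt ℝ f x) (c : ℝ) (C : Fin 4) :
    pd (fun y => c * f y) C x = c * pd f C x := by
  simp only [pd]; rw [fderiv_const_mul hf]; simp

theorem pd_sum {ι : Type*} {s : Finset ι} {f : ι → Scalar} {x : Mink}
    (hf : ∀ i ∈ s, DifferentiableAt ℝ (f i) x) (C : Fin 4) :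
    pd (fun y => ∑ i ∈ s, f i y) C x = ∑ i ∈ s, pd (f i) C x := by
  simp only [pd]; rw [fderiv_fun_sum hf]; simp

theorem pd_coord (A C : Fin 4) (x : Mink) : pd (fun y => y A) C x = if A = C then 1 else 0 := by
  have : HasFDerivAt (fun y : Mink => y A) (ContinuousLinearMap.proj (R := ℝ) A) x :=
    (ContinuousLinearMap.proj (R := ℝ) (φ := fun _ : Fin 4 => ℝ) A).hasFDerivAt
  simp only [pd, this.fderiv]
  simp [Pi.single_apply]

theorem fderiv_apply_eq_sum (f : Scalar) (x v : Mink) :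
    fderiv ℝ f x v = ∑ C, v C * pd f C x := by
  conv_lhs => rw [pi_eq_sum_univ' v]
  simp [pd]

theorem pd_comm {f : Scalar} (hf : SmoothOn f) {x : Mink} (hx : x ∈ spacelikeRegion)
    (C D : Fin 4) : pd (pd f C) D x = pd (pd f D) C x := by
  have hc := hf.contDiffAt (isOpen_region.mem_nhds hx)
  have hs : IsSymmSndFDerivAt ℝ f x := hc.isSymmSndFDerivAt (by
    simpa using (WithTop.coe_le_coe.2 le_top : ((2 : ℕ∞) : WithTop ℕ∞) ≤ ((⊤ : ℕ∞) : WithTop ℕ∞)))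
  have hd : DifferentiableAt ℝ (fderiv ℝ f) x :=
    (hc.fderiv_right (m := ∞) (by simp)).differentiableAt (by simp)
  have key : ∀ A B, pd (pd f A) B x = fderiv ℝ (fderiv ℝ f) x (Pi.single B 1) (Pi.single A 1) := by
    intro A B
    have h := (hd.hasFDerivAt.clm_apply (hasFDerivAt_const (Pi.single A (1 : ℝ)) x)).fderiv
    change fderiv ℝ (fun y => fderiv ℝ f y (Pi.single A 1)) x (Pi.single B 1) = _
    rw [h]; simp
  rw [key, key, hs]

/-! ### Homogeneous functions -/

/-- Smooth functions on the spacelike region which are homogeneous of degree `k`. -/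
structure IsHomog (k : ℤ) (f : Scalar) : Prop where
  smooth : SmoothOn f
  homog : ∀ x ∈ spacelikeRegion, ∀ c : ℝ, 0 < c → f (c • x) = c ^ k * f x

namespace IsHomog

variable {k l : ℤ} {f g : Scalar}

theorem diff (hf : IsHomog k f) {x : Mink} (hx : x ∈ spacelikeRegion) : DifferentiableAt ℝ f x :=
  hf.smooth.differentiableAt hx

/-- Differentiating `f (c • x) = c ^ k * f x` in `x` produces one factor `c` on the left, which
lowers the degree by one. -/
theorem pd (hf : IsHomog k f) (C : Fin 4) : IsHomog (k - 1) (pd f C) := by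
  refine ⟨hf.smooth.pd C, fun x hx c hc => ?_⟩
  have h1 : HasFDerivAt (fun y => f (c • y))
      ((fderiv ℝ f (c • x)).comp (c • ContinuousLinearMap.id ℝ Mink)) x :=
    (hf.diff (smul_mem_region hx hc)).hasFDerivAt.comp x
      ((hasFDerivAt_id x).const_smul c)
  have h2 : HasFDerivAt (fun y => c ^ k * f y) (c ^ k • fderiv ℝ f x) x :=
    (hf.diff hx).hasFDerivAt.const_mul _
  have h3 := h2.congr_of_eventuallyEq (f₁ := fun y => f (c • y)) (by
    filter_upwards [isOpen_region.mem_nhds hx] with y hy using hf.homog y hy c hc)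
  have h4 := congrArg (fun L => L (Pi.single C 1)) (h1.unique h3)
  simp only [ContinuousLinearMap.comp_apply, _root_.smul_apply,
    ContinuousLinearMap.id_apply, map_smul, smul_eq_mul] at h4
  simp only [DeSitter.pd]
  rw [zpow_sub₀ hc.ne', zpow_one]
  field_simp
  linarith

theorem euler (hf : IsHomog k f) {x : Mink} (hx : x ∈ spacelikeRegion) :
    ∑ C, x C * DeSitter.pd f C x = k * f x := by
  rw [← fderiv_apply_eq_sum]
  have h1 : HasDerivAt (fun c : ℝ => f (c • x)) (fderiv ℝ f ((1 : ℝ) • x) ((1 : ℝ) • x)) 1 := by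
    have hd : HasFDerivAt f (fderiv ℝ f ((1 : ℝ) • x)) ((1 : ℝ) • x) := by
      rw [one_smul]; exact (hf.diff hx).hasFDerivAt
    exact hd.comp_hasDerivAt (1 : ℝ) ((hasDerivAt_id (1 : ℝ)).smul_const x)
  have h2 : HasDerivAt (fun c : ℝ => c ^ k * f x) ((k * (1 : ℝ) ^ (k - 1)) * f x) 1 :=
    (hasDerivAt_zpow k 1 (Or.inl one_ne_zero)).mul_const _
  have h3 := h2.congr_of_eventuallyEq (f₁ := fun c : ℝ => f (c • x)) (by
    filter_upwards [isOpen_Ioi.mem_nhds (show (0 : ℝ) < 1 from one_pos)] with c hc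
      using hf.homog x hx c hc)
  simpa using h1.unique h3

theorem congr (hf : IsHomog k f) (h : ∀ x ∈ spacelikeRegion, g x = f x) : IsHomog k g :=
  ⟨hf.smooth.congr h, fun x hx c hc => by
    rw [h _ (smul_mem_region hx hc), h x hx, hf.homog x hx c hc]⟩

theorem add (hf : IsHomog k f) (hg : IsHomog k g) : IsHomog k fun x => f x + g x :=
  ⟨ContDiffOn.add hf.smooth hg.smooth, fun x hx c hc => by
    rw [hf.homog x hx c hc, hg.homog x hx c hc, mul_add]⟩

theorem neg (hf : IsHomog k f) : IsHomog k fun x => - f x :=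
  ⟨ContDiffOn.neg hf.smooth, fun x hx c hc => by rw [hf.homog x hx c hc, mul_neg]⟩

theorem sub (hf : IsHomog k f) (hg : IsHomog k g) : IsHomog k fun x => f x - g x := by
  simpa only [sub_eq_add_neg] using hf.add hg.neg

theorem mul (hf : IsHomog k f) (hg : IsHomog l g) : IsHomog (k + l) fun x => f x * g x :=
  ⟨ContDiffOn.mul hf.smooth hg.smooth, fun x hx c hc => by
    rw [hf.homog x hx c hc, hg.homog x hx c hc, zpow_add₀ hc.ne']; ring⟩

theorem const_mul (hf : IsHomog k f) (a : ℝ) : IsHomog k fun x => a * f x :=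
  ⟨ContDiffOn.mul contDiffOn_const hf.smooth, fun x hx c hc => by
    rw [hf.homog x hx c hc]; ring⟩

theorem sum {ι : Type*} {s : Finset ι} {f : ι → Scalar} (hf : ∀ i ∈ s, IsHomog k (f i)) :
    IsHomog k fun x => ∑ i ∈ s, f i x :=
  ⟨SmoothOn.sum fun i hi => (hf i hi).smooth, fun x hx c hc => by
    rw [Finset.mul_sum]; exact Finset.sum_congr rfl fun i hi => (hf i hi).homog x hx c hc⟩

theorem coord (A : Fin 4) : IsHomog 1 fun x => x A :=
  ⟨smoothOn_coord A, fun x _ c _ => by simp⟩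

theorem of_eq (hf : IsHomog k f) (h : k = l) : IsHomog l f := h ▸ hf

end IsHomog

/-! ### The radial function and extensions from the hyperboloid -/

/-- The norm of a spacelike vector. -/
noncomputable def rad (x : Mink) : ℝ := √(mink x x)

theorem rad_pos {x : Mink} (hx : x ∈ spacelikeRegion) : 0 < rad x := Real.sqrt_pos.2 hx

theorem rad_sq {x : Mink} (hx : x ∈ spacelikeRegion) : rad x ^ 2 = mink x x :=
  Real.sq_sqrt (le_of_lt hx)

theorem rad_eq_one {x : Mink} (hx : x ∈ dS3) : rad x = 1 := by
  have : mink x x = 1 := hx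
  simp [rad, this]

theorem isHomog_rad : IsHomog 1 rad :=
  ⟨contDiff_mink.contDiffOn.sqrt fun x hx => ne_of_gt hx, fun x _ c hc => by
    rw [rad, mink_smul_smul, Real.sqrt_mul (sq_nonneg c), Real.sqrt_sq hc.le, zpow_one, rad]⟩

theorem isHomog_inv_rad : IsHomog (-1) fun x => (rad x)⁻¹ :=
  ⟨isHomog_rad.smooth.inv fun x hx => (rad_pos hx).ne', fun x hx c hc => by
    rw [isHomog_rad.homog x hx c hc, zpow_one, mul_inv, zpow_neg_one]⟩

theorem isHomog_zpow_rad (n : ℤ) : IsHomog n fun x => rad x ^ n := by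
  refine ⟨?_, fun x hx c hc => by rw [isHomog_rad.homog x hx c hc, zpow_one, mul_zpow]⟩
  cases n with
  | ofNat n => simpa using ContDiffOn.pow isHomog_rad.smooth n
  | negSucc n =>
    simpa [zpow_negSucc, inv_pow] using ContDiffOn.pow isHomog_inv_rad.smooth (n + 1)

theorem pd_rad {x : Mink} (hx : x ∈ spacelikeRegion) (C : Fin 4) :
    pd rad C x = eta C * x C / rad x := by
  have h1 : pd (fun y => rad y * rad y) C x = pd (fun y => mink y y) C x :=
    pd_congr (fun y hy => by rw [← sq, rad_sq hy]) hx C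
  rw [pd_mul (isHomog_rad.diff hx) (isHomog_rad.diff hx)] at h1
  have h2 : pd (fun y => mink y y) C x = 2 * (eta C * x C) := by
    have hc : ∀ A : Fin 4, DifferentiableAt ℝ (fun y : Mink => y A) x := fun A => by fun_prop
    unfold mink
    rw [pd_sum (fun A _ => by fun_prop)]
    simp_rw [pd_mul (((hc _).const_mul _)) (hc _), pd_const_mul (hc _), pd_coord]
    simp [Finset.sum_add_distrib]; ring
  rw [h2] at h1
  rw [eq_div_iff (rad_pos hx).ne']; linarith

theorem pd_zpow_rad {x : Mink} (hx : x ∈ spacelikeRegion) (n : ℤ) (C : Fin 4) :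
    pd (fun y => rad y ^ n) C x = n * rad x ^ (n - 2) * (eta C * x C) := by
  have h := (hasDerivAt_zpow n (rad x) (Or.inl (rad_pos hx).ne')).comp_hasFDerivAt x
    (isHomog_rad.diff hx).hasFDerivAt
  have h' : pd (fun y => rad y ^ n) C x = n * rad x ^ (n - 1) * pd rad C x := by
    have := congrArg (fun L => L (Pi.single C 1)) h.fderiv
    simpa [pd, Function.comp_def] using this
  rw [h', pd_rad hx, show n - 1 = (n - 2) + 1 by ring, zpow_add_one₀ (rad_pos hx).ne']
  have := (rad_pos hx).ne'
  field_simp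

theorem radial_mem_dS3 {x : Mink} (hx : x ∈ spacelikeRegion) : radial x ∈ dS3 := by
  have h0 : 0 < mink x x := hx
  simp only [radial, dS3, mem_ofPred_eq, mink_smul_smul, inv_pow, Real.sq_sqrt h0.le]
  exact inv_mul_cancel₀ h0.ne'

theorem radial_of_mem {x : Mink} (hx : x ∈ dS3) : radial x = x := by
  have : mink x x = 1 := hx
  simp [radial, this]

theorem radial_smul {x : Mink} {c : ℝ} (hc : 0 < c) : radial (c • x) = radial x := by
  unfold radial
  rw [mink_smul_smul, Real.sqrt_mul (sq_nonneg c), Real.sqrt_sq hc.le, smul_smul]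
  congr 1
  field_simp

theorem rad_smul_radial {x : Mink} (hx : x ∈ spacelikeRegion) : rad x • radial x = x := by
  rw [radial, smul_smul, ← rad, mul_inv_cancel₀ (rad_pos hx).ne', one_smul]

theorem isHomog_comp_radial {f : Scalar} (hf : Smooth f) : IsHomog 0 fun x => f (radial x) :=
  ⟨hf, fun x _ c hc => by simp [radial_smul hc]⟩

theorem IsHomog.eq_rad_zpow_mul {k : ℤ} {f : Scalar} (hf : IsHomog k f) {x : Mink}
    (hx : x ∈ spacelikeRegion) : f x = rad x ^ k * f (radial x) := by
  conv_lhs => rw [← rad_smul_radial hx]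
  exact hf.homog _ (dS3_subset_region (radial_mem_dS3 hx)) _ (rad_pos hx)

theorem IsHomog.comp_radial {k : ℤ} {f : Scalar} (hf : IsHomog k f) {x : Mink}
    (hx : x ∈ spacelikeRegion) : f (radial x) = rad x ^ (-k) * f x := by
  rw [hf.eq_rad_zpow_mul hx, ← mul_assoc, ← zpow_add₀ (rad_pos hx).ne']; simp

theorem IsHomog.smooth_restrict {k : ℤ} {f : Scalar} (hf : IsHomog k f) {g : Scalar}
    (h : ∀ x ∈ dS3, g x = f x) : Smooth g :=
  (ContDiffOn.mul (isHomog_zpow_rad (-k)).smooth hf.smooth).congr fun x hx => by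
    rw [h _ (radial_mem_dS3 hx), hf.comp_radial hx]

/-- Two homogeneous functions of the same degree agree if they agree on the hyperboloid. -/
theorem IsHomog.ext {k : ℤ} {f g : Scalar} (hf : IsHomog k f) (hg : IsHomog k g)
    (h : ∀ x ∈ dS3, f x = g x) {x : Mink} (hx : x ∈ spacelikeRegion) : f x = g x := by
  rw [hf.eq_rad_zpow_mul hx, hg.eq_rad_zpow_mul hx, h _ (radial_mem_dS3 hx)]

/-- The gradient on the hyperboloid in terms of a homogeneous extension. -/
theorem grad_eq {k : ℤ} {f g : Scalar} (hf : IsHomog k f) (h : ∀ x ∈ dS3, g x = f x) {x : Mink}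
    (hx : x ∈ dS3) (C : Fin 4) : grad g x C = pd f C x - k * (eta C * x C) * f x := by
  have hxU := dS3_subset_region hx
  -- The radially constant extension of `g` is `f` divided by the `k`-th power of `rad`;
  -- differentiating that power where `rad = 1` gives the correction term.
  have h1 : grad g x C = pd (fun y => rad y ^ (-k) * f y) C x :=
    pd_congr (fun y hy => by rw [h _ (radial_mem_dS3 hy), hf.comp_radial hy]) hxU C
  rw [h1, pd_mul ((isHomog_zpow_rad _).diff hxU) (hf.diff hxU), pd_zpow_rad hxU,
    rad_eq_one hx]
  simp; ring

/-! ### Averages of pullbacks under families of linear maps -/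

open Set MeasureTheory

section LinearAverage

variable {P : Type*} [MetricSpace P] {K : Set P} {v : P → ℝ} {L : P → Mink →L[ℝ] Mink} {G : Scalar}

/-- The matrix entries of a linear map. -/
def entry (L : P → Mink →L[ℝ] Mink) (D C : Fin 4) (p : P) : ℝ := L p (Pi.single C 1) D

theorem _root_.ContinuousOn.mul_entry (hv : ContinuousOn v K) (hL : ContinuousOn L K)
    (D C : Fin 4) : ContinuousOn (fun p => v p * entry L D C p) K :=
  hv.mul ((continuous_apply D).comp_continuousOn (hL.clm_apply continuousOn_const))

theorem continuousOn_linAvg_integrand (hv : ContinuousOn v K)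
    (hL : ContinuousOn L K) (hLU : ∀ p ∈ K, ∀ x ∈ spacelikeRegion, L p x ∈ spacelikeRegion)
    (hG : SmoothOn G) {x : Mink} (hx : x ∈ spacelikeRegion) :
    ContinuousOn (fun p => v p * G (L p x)) K :=
  hv.mul (hG.continuousOn.comp (hL.clm_apply continuousOn_const) fun p hp => hLU p hp x hx)

variable [MeasurableSpace P] [BorelSpace P] {μ : Measure P} [IsFiniteMeasureOnCompacts μ]

/-- The weighted average of the pullbacks of `G` under a family of linear maps. -/
noncomputable def linAvg (μ : Measure P) (K : Set P) (v : P → ℝ) (L : P → Mink →L[ℝ] Mink)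
    (G : Scalar) : Scalar := fun x => ∫ p in K, v p * G (L p x) ∂μ

theorem integrableOn_linAvg_integrand (hK : IsCompact K) (hv : ContinuousOn v K)
    (hL : ContinuousOn L K) (hLU : ∀ p ∈ K, ∀ x ∈ spacelikeRegion, L p x ∈ spacelikeRegion)
    (hG : SmoothOn G) {x : Mink} (hx : x ∈ spacelikeRegion) :
    IntegrableOn (fun p => v p * G (L p x)) K μ :=
  (continuousOn_linAvg_integrand hv hL hLU hG hx).integrableOn_compact hK

/-- The derivative of the integrand is jointly continuous on the compact product of `K` with a
closed ball around `x`, hence bounded by a constant, which permits differentiation under the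
integral. Integrability of the derivative is recorded so that it can later be evaluated on vectors
inside the integral. -/
theorem hasFDerivAt_linAvg (hK : IsCompact K) (hv : ContinuousOn v K)
    (hL : ContinuousOn L K) (hLU : ∀ p ∈ K, ∀ x ∈ spacelikeRegion, L p x ∈ spacelikeRegion)
    (hG : SmoothOn G) {x : Mink} (hx : x ∈ spacelikeRegion) :
    HasFDerivAt (linAvg μ K v L G)
      (∫ p in K, v p • (fderiv ℝ G (L p x)).comp (L p) ∂μ) x ∧
    IntegrableOn (fun p => v p • (fderiv ℝ G (L p x)).comp (L p)) K μ := by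
  obtain ⟨ε, hε, hball⟩ := Metric.nhds_basis_closedBall.mem_iff.1 (isOpen_region.mem_nhds hx)
  have hG' : ContinuousOn (fderiv ℝ G) spacelikeRegion :=
    ((contDiffOn_infty_iff_fderiv_of_isOpen isOpen_region).1 hG).2.continuousOn
  have hcont : ContinuousOn (fun q : P × Mink => v q.1 • (fderiv ℝ G (L q.1 q.2)).comp (L q.1))
      (K ×ˢ Metric.closedBall x ε) := by
    have h1 : ContinuousOn (fun q : P × Mink => L q.1) (K ×ˢ Metric.closedBall x ε) :=
      hL.comp continuousOn_fst fun q hq => hq.1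
    refine (hv.comp continuousOn_fst fun q hq => hq.1).smul (ContinuousOn.clm_comp ?_ h1)
    exact hG'.comp (h1.clm_apply continuousOn_snd) fun q hq => hLU _ hq.1 _ (hball hq.2)
  obtain ⟨C, hC⟩ := (hK.prod (isCompact_closedBall x ε)).exists_bound_of_continuousOn hcont
  have hintx : ContinuousOn (fun p => v p • (fderiv ℝ G (L p x)).comp (L p)) K :=
    hcont.comp (f := fun p => (p, x)) (by fun_prop)
      fun p hp => ⟨hp, Metric.mem_closedBall_self hε.le⟩
  refine ⟨?_, hintx.integrableOn_compact hK⟩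
  refine hasFDerivAt_integral_of_dominated_of_fderiv_le (bound := fun _ => C)
    (F := fun y p => v p * G (L p y)) (F' := fun y p => v p • (fderiv ℝ G (L p y)).comp (L p))
    (Metric.closedBall_mem_nhds x hε) ?_ ?_ ?_ ?_ ?_ ?_
  · filter_upwards [Metric.closedBall_mem_nhds x hε] with y hy
    exact (integrableOn_linAvg_integrand hK hv hL hLU hG (hball hy)).aestronglyMeasurable
  · exact integrableOn_linAvg_integrand hK hv hL hLU hG hx
  · exact (hintx.integrableOn_compact hK).aestronglyMeasurable
  · filter_upwards [ae_restrict_mem hK.measurableSet] with p hp y hy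
    exact hC (p, y) ⟨hp, hy⟩
  · have : IsFiniteMeasure (μ.restrict K) := ⟨by simpa using hK.measure_lt_top⟩
    exact integrable_const C
  · filter_upwards [ae_restrict_mem hK.measurableSet] with p hp y hy
    have := ((hG.differentiableAt (hLU p hp y (hball hy))).hasFDerivAt.comp y
      (L p).hasFDerivAt).const_mul (v p)
    exact this

theorem pd_linAvg_eq_integral (hK : IsCompact K) (hv : ContinuousOn v K)
    (hL : ContinuousOn L K) (hLU : ∀ p ∈ K, ∀ x ∈ spacelikeRegion, L p x ∈ spacelikeRegion)
    (hG : SmoothOn G) {x : Mink} (hx : x ∈ spacelikeRegion) (C : Fin 4) :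
    pd (linAvg μ K v L G) C x =
      ∫ p in K, v p * ∑ D, entry L D C p * pd G D (L p x) ∂μ := by
  obtain ⟨h1, h2⟩ := hasFDerivAt_linAvg (μ := μ) hK hv hL hLU hG hx
  rw [pd, h1.fderiv, ContinuousLinearMap.integral_apply h2]
  refine integral_congr_ae (Filter.Eventually.of_forall fun p => ?_)
  simp only [_root_.smul_apply, ContinuousLinearMap.comp_apply, smul_eq_mul,
    fderiv_apply_eq_sum, entry]

theorem pd_linAvg (hK : IsCompact K) (hv : ContinuousOn v K)
    (hL : ContinuousOn L K) (hLU : ∀ p ∈ K, ∀ x ∈ spacelikeRegion, L p x ∈ spacelikeRegion)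
    (hG : SmoothOn G) {x : Mink} (hx : x ∈ spacelikeRegion) (C : Fin 4) :
    pd (linAvg μ K v L G) C x =
      ∑ D, linAvg μ K (fun p => v p * entry L D C p) L (pd G D) x := by
  rw [pd_linAvg_eq_integral hK hv hL hLU hG hx]
  simp only [linAvg]
  rw [← integral_finsetSum _ fun D _ => integrableOn_linAvg_integrand hK
    (hv.mul_entry hL D C) hL hLU (hG.pd D) hx]
  simp only [Finset.mul_sum, mul_assoc]

/-- By `pd_linAvg` a partial derivative of an average is a sum of averages of the same kind, with
other weights and with derivatives of `G`. Induction on the order of differentiability therefore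
closes once `v` and `G` are generalized. -/
theorem smoothOn_linAvg (hK : IsCompact K) (hv : ContinuousOn v K)
    (hL : ContinuousOn L K) (hLU : ∀ p ∈ K, ∀ x ∈ spacelikeRegion, L p x ∈ spacelikeRegion)
    (hG : SmoothOn G) : SmoothOn (linAvg μ K v L G) := by
  have hdiff : ∀ {v : P → ℝ} {G : Scalar}, ContinuousOn v K → SmoothOn G →
      DifferentiableOn ℝ (linAvg μ K v L G) spacelikeRegion := fun hv hG x hx =>
    (hasFDerivAt_linAvg hK hv hL hLU hG hx).1.differentiableAt.differentiableWithinAt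
  refine contDiffOn_infty.2 fun n => ?_
  induction n generalizing v G with
  | zero => exact contDiffOn_zero.2 (hdiff hv hG).continuousOn
  | succ n ih =>
    rw [Nat.cast_add, Nat.cast_one, contDiffOn_succ_iff_fderiv_of_isOpen isOpen_region]
    refine ⟨hdiff hv hG, by simp, ?_⟩
    refine contDiffOn_clm_apply.2 fun w => ?_
    simp only [fderiv_apply_eq_sum]
    refine ContDiffOn.sum fun C _ => contDiffOn_const.mul ?_
    refine ContDiffOn.congr (ContDiffOn.sum (s := Finset.univ) fun D _ =>
      ih (hv.mul_entry hL D C) (hG.pd D)) fun x hx => ?_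
    exact pd_linAvg hK hv hL hLU hG hx C

theorem isHomog_linAvg {k : ℤ} (hK : IsCompact K) (hv : ContinuousOn v K)
    (hL : ContinuousOn L K) (hLU : ∀ p ∈ K, ∀ x ∈ spacelikeRegion, L p x ∈ spacelikeRegion)
    (hG : IsHomog k G) : IsHomog k (linAvg μ K v L G) := by
  refine ⟨smoothOn_linAvg hK hv hL hLU hG.smooth, fun x hx c hc => ?_⟩
  simp only [linAvg]
  rw [← integral_const_mul]
  refine setIntegral_congr_fun hK.measurableSet fun p hp => ?_
  simp only [map_smul, hG.homog _ (hLU p hp x hx) c hc]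
  ring

/-- Two derivatives of a weighted average, as a single integral. -/
theorem pd_pd_linAvg (hK : IsCompact K) (hv : ContinuousOn v K)
    (hL : ContinuousOn L K) (hLU : ∀ p ∈ K, ∀ x ∈ spacelikeRegion, L p x ∈ spacelikeRegion)
    (hG : SmoothOn G) {x : Mink} (hx : x ∈ spacelikeRegion) (C C' : Fin 4) :
    pd (pd (linAvg μ K v L G) C) C' x =
      ∫ p in K, v p * ∑ D, ∑ E, entry L D C p * entry L E C' p * pd (pd G D) E (L p x) ∂μ := by
  have hvD := fun D => hv.mul_entry hL D C
  have h1 := pd_congr (fun y hy => pd_linAvg (μ := μ) hK hv hL hLU hG hy C) hx C'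
  rw [h1, pd_sum fun D _ => (smoothOn_linAvg hK (hvD D) hL hLU (hG.pd D)).differentiableAt hx]
  rw [Finset.sum_congr rfl fun D _ => pd_linAvg hK (hvD D) hL hLU (hG.pd D) hx C']
  simp only [linAvg]
  have hint := fun D E => integrableOn_linAvg_integrand (μ := μ) hK
    ((hvD D).mul_entry hL E C') hL hLU ((hG.pd D).pd E) hx
  rw [Finset.sum_congr rfl fun D _ => (integral_finsetSum _ fun E _ => hint D E).symm,
    ← integral_finsetSum _ fun D _ => integrable_finsetSum _ fun E _ => hint D E]
  simp only [Finset.mul_sum, mul_assoc]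

end LinearAverage

/-! ### Rotations and integration over the sphere -/

/-- Stokes' theorem on the sphere, in polar coordinates. -/
theorem integral_sphere_divergence {f g : ℝ × ℝ → ℝ} (hf : ContDiff ℝ 1 f) (hg : ContDiff ℝ 1 g)
    {f' g' : ℝ → ℝ → ℝ} (hf' : ∀ φ θ, HasDerivAt (fun t => f (t, θ)) (f' φ θ) φ)
    (hg' : ∀ φ θ, HasDerivAt (fun t => g (φ, t)) (g' φ θ) θ)
    (hper : ∀ θ, f (2 * Real.pi, θ) = f (0, θ)) (hz : ∀ φ, g (φ, 0) = 0)
    (hpi : ∀ φ, g (φ, Real.pi) = 0) :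
    ∫ φ in (0 : ℝ)..(2 * Real.pi), ∫ θ in (0 : ℝ)..Real.pi, (f' φ θ + g' φ θ) = 0 := by
  have hfd : ∀ z, HasFDerivAt f (fderiv ℝ f z) z := fun z =>
    (hf.differentiable one_ne_zero z).hasFDerivAt
  have hgd : ∀ z, HasFDerivAt g (fderiv ℝ g z) z := fun z =>
    (hg.differentiable one_ne_zero z).hasFDerivAt
  have h1 : ∀ φ θ, f' φ θ = fderiv ℝ f (φ, θ) (1, 0) := fun φ θ =>
    (hf' φ θ).unique ((hfd (φ, θ)).comp_hasDerivAt φ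
      ((hasDerivAt_id φ).prodMk (hasDerivAt_const φ θ)))
  have h2 : ∀ φ θ, g' φ θ = fderiv ℝ g (φ, θ) (0, 1) := fun φ θ =>
    (hg' φ θ).unique ((hgd (φ, θ)).comp_hasDerivAt θ
      ((hasDerivAt_const θ φ).prodMk (hasDerivAt_id θ)))
  have hcf := (hf.continuous_fderiv one_ne_zero).clm_apply
    (continuous_const (y := ((1 : ℝ), (0 : ℝ))))
  have hcg := (hg.continuous_fderiv one_ne_zero).clm_apply
    (continuous_const (y := ((0 : ℝ), (1 : ℝ))))
  have key := integral2_divergence_prod_of_hasFDerivAt_off_countable f g (fderiv ℝ f) (fderiv ℝ g)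
    0 0 (2 * Real.pi) Real.pi ∅ countable_empty hf.continuous.continuousOn
    hg.continuous.continuousOn (fun z _ => hfd z) (fun z _ => hgd z)
    ((hcf.add hcg).continuousOn.integrableOn_compact (isCompact_uIcc.prod isCompact_uIcc))
  simp only [h1, h2]
  rw [key]
  simp [hper, hz, hpi]

/-- The rotation of space by the angle `s` in the `(i, j)`-plane. -/
noncomputable def rot (i j : Fin 4) (s : ℝ) : Mink →L[ℝ] Mink :=
  ContinuousLinearMap.pi fun D =>
    if D = i then Real.cos s • ContinuousLinearMap.proj i - Real.sin s • ContinuousLinearMap.proj j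
    else if D = j then
      Real.sin s • ContinuousLinearMap.proj i + Real.cos s • ContinuousLinearMap.proj j
    else ContinuousLinearMap.proj D

/-- The generator of the rotations in the `(i, j)`-plane. -/
noncomputable def rotGen (i j : Fin 4) : Mink →L[ℝ] Mink :=
  ContinuousLinearMap.pi fun D =>
    if D = i then - ContinuousLinearMap.proj j
    else if D = j then ContinuousLinearMap.proj i
    else 0

theorem rot_apply (i j : Fin 4) (s : ℝ) (x : Mink) (D : Fin 4) :
    rot i j s x D = if D = i then Real.cos s * x i - Real.sin s * x j
      else if D = j then Real.sin s * x i + Real.cos s * x j else x D := by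
  simp only [rot, ContinuousLinearMap.coe_pi']
  split_ifs <;> simp

theorem rotGen_apply (i j : Fin 4) (x : Mink) (D : Fin 4) :
    rotGen i j x D = if D = i then - x j else if D = j then x i else 0 := by
  simp only [rotGen, ContinuousLinearMap.coe_pi']
  split_ifs <;> simp

theorem continuous_rot (i j : Fin 4) : Continuous (rot i j) := by
  refine continuous_clm_apply.2 fun x => continuous_pi fun D => ?_
  simp only [rot_apply]
  split_ifs <;> fun_prop

theorem hasDerivAt_rot {i j : Fin 4} (hij : i ≠ j) (x : Mink) (s : ℝ) :
    HasDerivAt (fun s => rot i j s x) (rot i j s (rotGen i j x)) s := by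
  refine hasDerivAt_pi.2 fun D => ?_
  simp only [rot_apply, rotGen_apply]
  split_ifs with h1 h2 <;> simp_all [hij.symm]
  · exact (((Real.hasDerivAt_cos s).mul_const (x i)).sub
      ((Real.hasDerivAt_sin s).mul_const (x j))).congr_deriv (by ring)
  · exact (((Real.hasDerivAt_sin s).mul_const (x i)).add
      ((Real.hasDerivAt_cos s).mul_const (x j))).congr_deriv (by ring)
  · exact hasDerivAt_const _ _

/-- The pairs of axes whose rotations are used to average over the sphere. -/
def SpatialPair (i j : Fin 4) : Prop := (i = 1 ∧ j = 2) ∨ (i = 2 ∧ j = 3)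

theorem SpatialPair.ne {i j : Fin 4} (h : SpatialPair i j) : i ≠ j := by
  rcases h with ⟨rfl, rfl⟩ | ⟨rfl, rfl⟩ <;> decide

theorem rot_mem_region {i j : Fin 4} (h : SpatialPair i j) {s : ℝ} {x : Mink}
    (hx : x ∈ spacelikeRegion) : rot i j s x ∈ spacelikeRegion := by
  rw [mem_region_iff] at *
  have := Real.sin_sq_add_cos_sq s
  rcases h with ⟨rfl, rfl⟩ | ⟨rfl, rfl⟩ <;> simp [rot_apply] <;> nlinarith

theorem rot_zero {i j : Fin 4} (x : Mink) : rot i j 0 x = x := by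
  ext D; rw [rot_apply]; split_ifs <;> simp_all

/-- The derivative along the rotations in the `(i, j)`-plane. -/
noncomputable def angD (i j : Fin 4) (f : Scalar) : Scalar := fun x =>
  x i * pd f j x - x j * pd f i x

theorem angD_eq_fderiv {i j : Fin 4} (hij : i ≠ j) (f : Scalar) (x : Mink) :
    angD i j f x = fderiv ℝ f x (rotGen i j x) := by
  rw [fderiv_apply_eq_sum, angD, ← Finset.sum_subset (Finset.subset_univ {i, j})]
  · rw [Finset.sum_pair hij]; simp [rotGen_apply, hij.symm]; ring
  · intro D _ hD
    simp only [Finset.mem_insert, Finset.mem_singleton, not_or] at hD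
    simp [rotGen_apply, hD.1, hD.2]

/-- The average of `f` over rotations. -/
noncomputable def rotAvg (i j : Fin 4) (b : ℝ) (v : ℝ → ℝ) (f : Scalar) : Scalar :=
  linAvg volume (Icc 0 b) v (rot i j) f

theorem rotAvg_eq {i j : Fin 4} {b : ℝ} (hb : 0 ≤ b) (v : ℝ → ℝ) (f : Scalar) (x : Mink) :
    rotAvg i j b v f x = ∫ s in (0 : ℝ)..b, v s * f (rot i j s x) := by
  rw [intervalIntegral.integral_of_le hb, ← integral_Icc_eq_integral_Ioc]; rfl

theorem isHomog_rotAvg {i j : Fin 4} (h : SpatialPair i j) {b : ℝ} {v : ℝ → ℝ} (hv : Continuous v)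
    {f : Scalar} {k : ℤ} (hf : IsHomog k f) : IsHomog k (rotAvg i j b v f) :=
  isHomog_linAvg isCompact_Icc hv.continuousOn (continuous_rot i j).continuousOn
    (fun _ _ _ hx => rot_mem_region h hx) hf

theorem hasDerivAt_comp_rot {i j : Fin 4} (h : SpatialPair i j) {f : Scalar} (hf : SmoothOn f)
    {x : Mink} (hx : x ∈ spacelikeRegion) (s : ℝ) :
    HasDerivAt (fun s => f (rot i j s x)) (fderiv ℝ f (rot i j s x) (rot i j s (rotGen i j x))) s :=
  (hf.differentiableAt (rot_mem_region h hx)).hasFDerivAt.comp_hasDerivAt s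
    (hasDerivAt_rot h.ne x s)

/-- A rotation commutes with its own generator, so the angular derivative of `f (rot i j s x)` in
`x` is its derivative in `s`. Integration by parts in `s` follows. The weight is the free parameter:
its end values and its derivative decide which difference equation the average solves. -/
theorem angD_rotAvg {i j : Fin 4} (h : SpatialPair i j) {b : ℝ} (hb : 0 ≤ b) {v v' : ℝ → ℝ}
    (hv : ∀ s, HasDerivAt v (v' s) s) (hv' : Continuous v') {f : Scalar} (hf : SmoothOn f)
    {x : Mink} (hx : x ∈ spacelikeRegion) :
    angD i j (rotAvg i j b v f) x =
      v b * f (rot i j b x) - v 0 * f x - rotAvg i j b v' f x := by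
  have hvc : Continuous v := continuous_iff_continuousAt.2 fun s => (hv s).continuousAt
  obtain ⟨h1, h2⟩ := hasFDerivAt_linAvg (μ := volume) (K := Icc 0 b) isCompact_Icc hvc.continuousOn
    (continuous_rot i j).continuousOn (fun _ _ _ hx => rot_mem_region h hx) hf hx
  rw [angD_eq_fderiv h.ne, rotAvg, h1.fderiv, ContinuousLinearMap.integral_apply h2, rotAvg_eq hb,
    integral_Icc_eq_integral_Ioc, ← intervalIntegral.integral_of_le hb]
  simp only [_root_.smul_apply, ContinuousLinearMap.comp_apply, smul_eq_mul]
  rw [intervalIntegral.integral_mul_deriv_eq_deriv_mul (fun s _ => hv s)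
    (fun s _ => hasDerivAt_comp_rot h hf hx s) (hv'.intervalIntegrable _ _), rot_zero]
  refine ContinuousOn.intervalIntegrable ?_
  have hG' : ContinuousOn (fderiv ℝ f) spacelikeRegion :=
    ((contDiffOn_infty_iff_fderiv_of_isOpen isOpen_region).1 hf).2.continuousOn
  have hc : ∀ y, Continuous fun s => rot i j s y := fun y =>
    (continuous_rot i j).clm_apply continuous_const
  exact ((hG'.comp_continuous (hc x) fun s => rot_mem_region h hx).clm_apply (hc _)).continuousOn

/-- The point of the unit sphere at time zero. -/
noncomputable def unitPt (θ φ : ℝ) : Mink :=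
  ![0, Real.cos θ, Real.sin θ * Real.cos φ, Real.sin θ * Real.sin φ]

theorem unitPt_mem_dS3 (θ φ : ℝ) : unitPt θ φ ∈ dS3 := by
  simp only [dS3, mem_ofPred_eq, mink_eq, unitPt]
  simp
  linear_combination Real.sin θ ^ 2 * Real.sin_sq_add_cos_sq φ + Real.sin_sq_add_cos_sq θ

theorem unitPt_mem (θ φ : ℝ) : unitPt θ φ ∈ spacelikeRegion :=
  dS3_subset_region (unitPt_mem_dS3 θ φ)

theorem contDiff_unitPt : ContDiff ℝ ∞ fun z : ℝ × ℝ => unitPt z.2 z.1 := by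
  refine contDiff_pi.2 fun D => ?_
  fin_cases D <;> simp [unitPt] <;> fun_prop

/-- The integral over the unit sphere at time zero. -/
noncomputable def sphereInt (f : Scalar) : ℝ :=
  ∫ φ in (0 : ℝ)..(2 * Real.pi), ∫ θ in (0 : ℝ)..Real.pi, Real.sin θ * f (unitPt θ φ)

theorem contDiff_comp_unitPt {f : Scalar} (hf : SmoothOn f) :
    ContDiff ℝ ∞ fun z : ℝ × ℝ => f (unitPt z.2 z.1) :=
  hf.comp_contDiff contDiff_unitPt fun _ => unitPt_mem _ _

theorem hasDerivAt_unitPt_theta (θ φ : ℝ) : HasDerivAt (fun t => unitPt t φ)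
    ![0, - Real.sin θ, Real.cos θ * Real.cos φ, Real.cos θ * Real.sin φ] θ := by
  refine hasDerivAt_pi.2 fun D => ?_
  fin_cases D <;> simp [unitPt]
  · exact hasDerivAt_const _ _
  · exact Real.hasDerivAt_cos θ
  · exact (Real.hasDerivAt_sin θ).mul_const _
  · exact (Real.hasDerivAt_sin θ).mul_const _

theorem hasDerivAt_unitPt_phi (θ φ : ℝ) : HasDerivAt (fun t => unitPt θ t)
    ![0, 0, - (Real.sin θ * Real.sin φ), Real.sin θ * Real.cos φ] φ := by
  refine hasDerivAt_pi.2 fun D => ?_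
  fin_cases D <;> simp [unitPt]
  · exact hasDerivAt_const _ _
  · exact hasDerivAt_const _ _
  · simpa using (Real.hasDerivAt_cos φ).const_mul (Real.sin θ)
  · exact (Real.hasDerivAt_sin φ).const_mul _

/-- Rotation fields are divergence-free on the sphere, so a derivative along one is a total
divergence. -/
theorem sphereInt_angD {i j : Fin 4} (h : SpatialPair i j) {f : Scalar} (hf : SmoothOn f) :
    sphereInt (angD i j f) = 0 := by
  have hc := contDiff_comp_unitPt hf
  have hθ : ∀ φ θ, HasDerivAt (fun t => f (unitPt t φ)) (fderiv ℝ f (unitPt θ φ)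
      ![0, - Real.sin θ, Real.cos θ * Real.cos φ, Real.cos θ * Real.sin φ]) θ := fun φ θ =>
    (hf.differentiableAt (unitPt_mem θ φ)).hasFDerivAt.comp_hasDerivAt θ
      (hasDerivAt_unitPt_theta θ φ)
  have hφ : ∀ φ θ, HasDerivAt (fun t => f (unitPt θ t)) (fderiv ℝ f (unitPt θ φ)
      ![0, 0, - (Real.sin θ * Real.sin φ), Real.sin θ * Real.cos φ]) φ := fun φ θ =>
    (hf.differentiableAt (unitPt_mem θ φ)).hasFDerivAt.comp_hasDerivAt φ
      (hasDerivAt_unitPt_phi θ φ)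
  have hper : ∀ θ, unitPt θ (2 * Real.pi) = unitPt θ 0 := fun θ => by simp [unitPt]
  rcases h with ⟨rfl, rfl⟩ | ⟨rfl, rfl⟩
  -- The coefficients are the `φ` and `θ` components of the rotation field multiplied by the area
  -- density `sin θ`, which cancels the singular `cot θ` at the poles.
  · have := integral_sphere_divergence
      (f := fun z => - (Real.cos z.2 * Real.sin z.1) * f (unitPt z.2 z.1))
      (g := fun z => Real.sin z.2 * Real.cos z.1 * f (unitPt z.2 z.1))
      (ContDiff.mul (by fun_prop) (hc.of_le (by simp)))
      (ContDiff.mul (by fun_prop) (hc.of_le (by simp)))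
      (fun φ θ => (((Real.hasDerivAt_sin φ).const_mul (Real.cos θ)).neg).mul (hφ φ θ))
      (fun φ θ => ((Real.hasDerivAt_sin θ).mul_const (Real.cos φ)).mul (hθ φ θ))
      (fun θ => by simp) (fun φ => by simp) (fun φ => by simp)
    rw [← this]
    unfold sphereInt
    refine intervalIntegral.integral_congr fun φ _ => intervalIntegral.integral_congr fun θ _ => ?_
    simp only [fderiv_apply_eq_sum, Fin.sum_univ_four, angD]
    generalize pd f 1 (unitPt θ φ) = f1
    generalize pd f 2 (unitPt θ φ) = f2
    generalize pd f 3 (unitPt θ φ) = f3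
    simp [unitPt, -mul_eq_mul_left_iff]
    linear_combination -(Real.sin θ * Real.cos θ * f2) * Real.sin_sq_add_cos_sq φ
  · have := integral_sphere_divergence
      (f := fun z => Real.sin z.2 * f (unitPt z.2 z.1)) (g := fun _ => 0)
      (ContDiff.mul (by fun_prop) (hc.of_le (by simp))) contDiff_const
      (fun φ θ => (hφ φ θ).const_mul (Real.sin θ)) (fun φ θ => hasDerivAt_const θ (0 : ℝ))
      (fun θ => by simp [hper]) (fun φ => rfl) (fun φ => rfl)
    rw [← this]
    unfold sphereInt
    refine intervalIntegral.integral_congr fun φ _ => intervalIntegral.integral_congr fun θ _ => ?_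
    simp only [fderiv_apply_eq_sum, Fin.sum_univ_four, angD]
    simp [unitPt, -mul_eq_mul_left_iff]
    ring

/-! ### Time-independent functions and the mean value over Euler angles -/

/-- The linear map rescaling the time coordinate. -/
noncomputable def timeScale (s : ℝ) : Mink →L[ℝ] Mink :=
  ContinuousLinearMap.pi fun D =>
    if D = 0 then s • ContinuousLinearMap.proj D else ContinuousLinearMap.proj D

theorem timeScale_apply (s : ℝ) (x : Mink) (D : Fin 4) :
    timeScale s x D = if D = 0 then s * x D else x D := by
  simp only [timeScale, ContinuousLinearMap.coe_pi']
  split_ifs <;> simp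

theorem timeScale_mem_region {s : ℝ} (hs : s ∈ Icc (0 : ℝ) 1) {x : Mink}
    (hx : x ∈ spacelikeRegion) : timeScale s x ∈ spacelikeRegion := by
  rw [mem_region_iff] at *
  simp only [timeScale_apply]
  simp
  nlinarith [hs.1, hs.2, sq_nonneg (x 0), mul_nonneg (sub_nonneg.2 hs.2) (sq_nonneg (x 0)),
    mul_nonneg hs.1 (mul_nonneg (sub_nonneg.2 hs.2) (sq_nonneg (x 0)))]

theorem timeScale_zero_mem {x : Mink} (hx : x ∈ spacelikeRegion) :
    timeScale 0 x ∈ spacelikeRegion := timeScale_mem_region ⟨le_rfl, zero_le_one⟩ hx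

/-- Functions on the spacelike region which do not depend on time. -/
def IsStatic (f : Scalar) : Prop := ∀ x ∈ spacelikeRegion, f (timeScale 0 x) = f x

/-- Near `x` the function factors through `timeScale 0`, whose kernel contains the time axis. -/
theorem IsStatic.pd_zero {f : Scalar} (hs : IsStatic f) (hf : SmoothOn f) {x : Mink}
    (hx : x ∈ spacelikeRegion) : pd f 0 x = 0 := by
  rw [← pd_congr hs hx 0, pd]
  have h := (hf.differentiableAt (timeScale_zero_mem hx)).hasFDerivAt.comp x
    (timeScale 0).hasFDerivAt
  have h' := h.fderiv
  simp only [Function.comp_def] at h'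
  rw [h', ContinuousLinearMap.comp_apply]
  have : timeScale 0 (Pi.single (0 : Fin 4) (1 : ℝ)) = 0 := by
    ext D; rw [timeScale_apply]; split_ifs with h <;> simp [h]
  rw [this, map_zero]

theorem rot_timeScale {i j : Fin 4} (h : SpatialPair i j) (s t : ℝ) (x : Mink) :
    rot i j s (timeScale t x) = timeScale t (rot i j s x) := by
  ext D
  rcases h with ⟨rfl, rfl⟩ | ⟨rfl, rfl⟩ <;> fin_cases D <;> simp [rot_apply, timeScale_apply]

theorem IsStatic.rotAvg {i j : Fin 4} (h : SpatialPair i j) {f : Scalar} (hf : IsStatic f) (b : ℝ)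
    (v : ℝ → ℝ) : IsStatic (rotAvg i j b v f) := fun x hx => by
  simp only [DeSitter.rotAvg, linAvg, rot_timeScale h]
  exact integral_congr_ae (Filter.Eventually.of_forall fun s => by
    simp only [hf _ (rot_mem_region h hx)])

theorem IsStatic.add {f g : Scalar} (hf : IsStatic f) (hg : IsStatic g) :
    IsStatic fun x => f x + g x := fun x hx => by simp only [hf x hx, hg x hx]

theorem exists_polar (a b : ℝ) : ∃ φ : ℝ, a = √(a ^ 2 + b ^ 2) * Real.cos φ ∧
    b = √(a ^ 2 + b ^ 2) * Real.sin φ := by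
  have hn : ‖(⟨a, b⟩ : ℂ)‖ = √(a ^ 2 + b ^ 2) := by
    rw [Complex.norm_def, Complex.normSq_apply]; simp [sq]
  refine ⟨Complex.arg ⟨a, b⟩, ?_, ?_⟩
  · rw [← hn, Complex.norm_mul_cos_arg]
  · rw [← hn, Complex.norm_mul_sin_arg]

/-- This reduces a static function of degree zero to its values on the unit sphere. -/
theorem exists_unitPt {x : Mink} (hx : x ∈ spacelikeRegion) :
    ∃ c > (0 : ℝ), ∃ θ ∈ Icc 0 Real.pi, ∃ φ, timeScale 0 x = c • unitPt θ φ := by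
  rw [mem_region_iff] at hx
  set c := √(x 1 ^ 2 + x 2 ^ 2 + x 3 ^ 2) with hc
  have hpos : 0 < x 1 ^ 2 + x 2 ^ 2 + x 3 ^ 2 := by nlinarith [sq_nonneg (x 0)]
  have hc0 : 0 < c := Real.sqrt_pos.2 hpos
  have hc2 : c ^ 2 = x 1 ^ 2 + x 2 ^ 2 + x 3 ^ 2 := Real.sq_sqrt hpos.le
  have hle : (x 1) ^ 2 ≤ c ^ 2 := by nlinarith [sq_nonneg (x 2), sq_nonneg (x 3)]
  have habs := abs_le_of_sq_le_sq' hle hc0.le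
  have hcos : Real.cos (Real.arccos (x 1 / c)) = x 1 / c :=
    Real.cos_arccos (by rw [le_div_iff₀ hc0]; linarith) (by rw [div_le_iff₀ hc0]; linarith)
  have hsin : c * Real.sin (Real.arccos (x 1 / c)) = √(x 2 ^ 2 + x 3 ^ 2) := by
    rw [Real.sin_arccos, ← Real.sqrt_sq hc0.le, ← Real.sqrt_mul (sq_nonneg _), Real.sqrt_sq hc0.le]
    congr 1
    field_simp
    linarith
  obtain ⟨φ, h2, h3⟩ := exists_polar (x 2) (x 3)
  refine ⟨c, hc0, Real.arccos (x 1 / c), ⟨Real.arccos_nonneg _, Real.arccos_le_pi _⟩, φ, ?_⟩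
  ext D
  rw [timeScale_apply]
  fin_cases D
  · simp [unitPt]
  · simp [unitPt, hcos]; field_simp
  · simp [unitPt, ← mul_assoc, hsin]; exact h2
  · simp [unitPt, ← mul_assoc, hsin]; exact h3

theorem rot_rot {i j : Fin 4} (h : SpatialPair i j) (s t : ℝ) (x : Mink) :
    rot i j s (rot i j t x) = rot i j (s + t) x := by
  ext D
  rcases h with ⟨rfl, rfl⟩ | ⟨rfl, rfl⟩ <;> fin_cases D <;>
    simp [rot_apply, Real.cos_add, Real.sin_add] <;> ring

theorem rot_add_two_pi (i j : Fin 4) (s : ℝ) (x : Mink) :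
    rot i j (s + 2 * Real.pi) x = rot i j s x := by
  ext D; simp [rot_apply]

theorem rot_unitPt (s θ φ : ℝ) : rot 2 3 s (unitPt θ φ) = unitPt θ (φ + s) := by
  ext D
  fin_cases D <;> simp [rot_apply, unitPt, Real.cos_add, Real.sin_add] <;> ring

theorem unitPt_add_two_pi (θ φ : ℝ) : unitPt θ (φ + 2 * Real.pi) = unitPt θ φ := by
  simp [unitPt]

theorem spatialPair_two_three : SpatialPair 2 3 := Or.inr ⟨rfl, rfl⟩

theorem spatialPair_one_two : SpatialPair 1 2 := Or.inl ⟨rfl, rfl⟩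

/-- The average of a function over the rotations about the polar axis. -/
noncomputable def polarAvg (f : Scalar) : Scalar :=
  rotAvg 2 3 (2 * Real.pi) (fun _ => (2 * Real.pi)⁻¹) f

/-- The average of a function over the rotations tilting the polar axis. -/
noncomputable def tiltAvg (f : Scalar) : Scalar :=
  rotAvg 1 2 Real.pi (fun s => Real.sin s / 2) f

theorem polarAvg_rot (f : Scalar) (t : ℝ) (x : Mink) : polarAvg f (rot 2 3 t x) = polarAvg f x := by
  have h2 : (0 : ℝ) ≤ 2 * Real.pi := by positivity
  simp only [polarAvg, rotAvg_eq h2, rot_rot spatialPair_two_three]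
  rw [intervalIntegral.integral_comp_add_right
    (fun s => (2 * Real.pi)⁻¹ * f (rot 2 3 s x)) t, zero_add, add_comm _ t]
  have hp : Function.Periodic (fun s => (2 * Real.pi)⁻¹ * f (rot 2 3 s x)) (2 * Real.pi) :=
    fun s => by simp only [rot_add_two_pi]
  simpa only [zero_add] using hp.intervalIntegral_add_eq t 0

/-- The two points lie on one circle about the polar axis, so a rotation about that axis carries one
to the other and the average does not see it. -/
theorem polarAvg_congr (f : Scalar) {x y : Mink} (h0 : x 0 = y 0) (h1 : x 1 = y 1)
    (h : x 2 ^ 2 + x 3 ^ 2 = y 2 ^ 2 + y 3 ^ 2) : polarAvg f x = polarAvg f y := by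
  obtain ⟨φ, hx2, hx3⟩ := exists_polar (x 2) (x 3)
  obtain ⟨ψ, hy2, hy3⟩ := exists_polar (y 2) (y 3)
  rw [h] at hx2 hx3
  generalize √(y 2 ^ 2 + y 3 ^ 2) = r at *
  rw [← polarAvg_rot f (ψ - φ) x]
  congr 1
  have := Real.sin_sq_add_cos_sq φ
  ext D
  fin_cases D <;> simp [rot_apply, h0, h1]
  · rw [hx2, hx3, hy2, Real.cos_sub, Real.sin_sub]
    linear_combination r * Real.cos ψ * this
  · rw [hx2, hx3, hy3, Real.cos_sub, Real.sin_sub]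
    linear_combination r * Real.sin ψ * this

theorem smoothOn_angD {i j : Fin 4} {f : Scalar} (hf : SmoothOn f) : SmoothOn (angD i j f) :=
  ContDiffOn.sub (ContDiffOn.mul (smoothOn_coord i) (hf.pd j))
    (ContDiffOn.mul (smoothOn_coord j) (hf.pd i))

theorem continuous_sphere_integrand {f : Scalar} (hf : SmoothOn f) :
    Continuous fun z : ℝ × ℝ => Real.sin z.2 * f (unitPt z.2 z.1) :=
  (by fun_prop : Continuous fun z : ℝ × ℝ => Real.sin z.2).mul (contDiff_comp_unitPt hf).continuous

theorem sphereInt_add {f g : Scalar} (hf : SmoothOn f) (hg : SmoothOn g) :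
    sphereInt (fun x => f x + g x) = sphereInt f + sphereInt g := by
  have hi : ∀ {f : Scalar}, SmoothOn f → ∀ φ, IntervalIntegrable
      (fun θ => Real.sin θ * f (unitPt θ φ)) volume 0 Real.pi := fun hf φ =>
    ((continuous_sphere_integrand hf).comp
      (continuous_const.prodMk continuous_id : Continuous fun θ : ℝ => (φ, θ))).intervalIntegrable _ _
  have ho : ∀ {f : Scalar}, SmoothOn f → IntervalIntegrable
      (fun φ => ∫ θ in (0 : ℝ)..Real.pi, Real.sin θ * f (unitPt θ φ)) volume 0 (2 * Real.pi) :=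
    fun hf => (intervalIntegral.continuous_parametric_intervalIntegral_of_continuous'
      (by exact continuous_sphere_integrand hf) _ _).intervalIntegrable _ _
  simp only [sphereInt]
  rw [← intervalIntegral.integral_add (ho hf) (ho hg)]
  refine intervalIntegral.integral_congr fun φ _ => ?_
  simp only [mul_add]
  exact intervalIntegral.integral_add (hi hf φ) (hi hg φ)

theorem sphereInt_congr {f g : Scalar} (h : ∀ x ∈ dS3, x 0 = 0 → f x = g x) :
    sphereInt f = sphereInt g := by
  refine intervalIntegral.integral_congr fun φ _ => intervalIntegral.integral_congr fun θ _ => ?_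
  simp only [h _ (unitPt_mem_dS3 θ φ) rfl]

/-- The difference between `g` rotated by `α` and `g` itself is the angular derivative of the
integral of `g` over the intermediate rotations, and such derivatives integrate to zero. -/
theorem sphereInt_comp_rot {g : Scalar} (hg : IsHomog 0 g) {α : ℝ} (hα : 0 ≤ α) :
    sphereInt (fun x => g (rot 1 2 α x)) = sphereInt g := by
  have hs := isHomog_rotAvg spatialPair_one_two (b := α) (continuous_const (y := (1 : ℝ))) hg
  have key : ∀ x ∈ dS3, x 0 = 0 →
      g (rot 1 2 α x) = g x + angD 1 2 (rotAvg 1 2 α (fun _ => 1) g) x := fun x hx _ => by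
    rw [angD_rotAvg spatialPair_one_two hα (fun s => hasDerivAt_const s 1) continuous_const
      hg.smooth (dS3_subset_region hx)]
    simp [rotAvg, linAvg]
  rw [sphereInt_congr key, sphereInt_add hg.smooth (smoothOn_angD hs.smooth),
    sphereInt_angD spatialPair_one_two hs.smooth, add_zero]

theorem isHomog_polarAvg {f : Scalar} {k : ℤ} (hf : IsHomog k f) : IsHomog k (polarAvg f) :=
  isHomog_rotAvg spatialPair_two_three continuous_const hf

theorem isHomog_tiltAvg {f : Scalar} {k : ℤ} (hf : IsHomog k f) : IsHomog k (tiltAvg f) :=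
  isHomog_rotAvg spatialPair_one_two (by fun_prop) hf

theorem exists_angD_eq_sub_polarAvg {f : Scalar} (hf : IsHomog 0 f) (hs : IsStatic f) :
    ∃ σ, IsHomog 0 σ ∧ IsStatic σ ∧
      ∀ x ∈ spacelikeRegion, angD 2 3 σ x = f x - polarAvg f x := by
  -- In `angD_rotAvg` this weight is 0 at the upper end and -1 at the lower end, leaving `f` as the
  -- boundary term, and its derivative is the weight of `polarAvg`.
  have hv : ∀ s, HasDerivAt (fun s : ℝ => s * (2 * Real.pi)⁻¹ - 1) ((2 * Real.pi)⁻¹) s := fun s => by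
    simpa using ((hasDerivAt_id s).mul_const (2 * Real.pi)⁻¹).sub_const 1
  refine ⟨rotAvg 2 3 (2 * Real.pi) (fun s => s * (2 * Real.pi)⁻¹ - 1) f,
    isHomog_rotAvg spatialPair_two_three (by fun_prop) hf,
    hs.rotAvg spatialPair_two_three _ _, fun x hx => ?_⟩
  rw [angD_rotAvg spatialPair_two_three (by positivity : (0 : ℝ) ≤ 2 * Real.pi) hv
    continuous_const hf.smooth hx]
  have : 2 * Real.pi * (2 * Real.pi)⁻¹ = 1 := mul_inv_cancel₀ (by positivity)
  rw [this]
  simp [polarAvg]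

theorem exists_angD_eq_sub_tiltAvg {f : Scalar} (hf : IsHomog 0 f) (hs : IsStatic f) :
    ∃ σ, IsHomog 0 σ ∧ IsStatic σ ∧
      ∀ x ∈ spacelikeRegion, angD 1 2 σ x = f x - tiltAvg f x := by
  -- The antiderivative of the weight of `tiltAvg` normalized to vanish at `π`; it is then -1 at 0,
  -- so the boundary terms again reduce to `f`. Vanishing at `π` is essential, since the half-turn
  -- does not return to `x`.
  have hv : ∀ s, HasDerivAt (fun s : ℝ => - (1 + Real.cos s) / 2) (Real.sin s / 2) s := fun s => by
    simpa using (((Real.hasDerivAt_cos s).const_add 1).neg).div_const 2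
  refine ⟨rotAvg 1 2 Real.pi (fun s => - (1 + Real.cos s) / 2) f,
    isHomog_rotAvg spatialPair_one_two (by fun_prop) hf,
    hs.rotAvg spatialPair_one_two _ _, fun x hx => ?_⟩
  rw [angD_rotAvg spatialPair_one_two Real.pi_nonneg hv (by fun_prop) hf.smooth hx]
  simp [tiltAvg]

theorem sphereInt_polarAvg {f : Scalar} (hf : IsHomog 0 f) (hs : IsStatic f) :
    sphereInt (polarAvg f) = sphereInt f := by
  obtain ⟨σ, hσ, -, h⟩ := exists_angD_eq_sub_polarAvg hf hs
  have key : ∀ x ∈ dS3, x 0 = 0 → f x = polarAvg f x + angD 2 3 σ x := fun x hx _ => by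
    rw [h x (dS3_subset_region hx)]; ring
  rw [sphereInt_congr key, sphereInt_add (isHomog_polarAvg hf).smooth (smoothOn_angD hσ.smooth),
    sphereInt_angD spatialPair_two_three hσ.smooth, add_zero]

/-- The average over the rotation group, in Euler angles, is the mean value. -/
theorem polarAvg_tiltAvg_polarAvg {f : Scalar} (hf : IsHomog 0 f) (hs : IsStatic f)
    {x : Mink} (hx : x ∈ spacelikeRegion) :
    polarAvg (tiltAvg (polarAvg f)) x = (4 * Real.pi)⁻¹ * sphereInt f := by
  have hg := isHomog_polarAvg hf
  have hh := isHomog_tiltAvg hg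
  have hhs : IsStatic (tiltAvg (polarAvg f)) :=
    (hs.rotAvg spatialPair_two_three _ _).rotAvg spatialPair_one_two _ _
  obtain ⟨c, hc, α, hα, φ₀, hxu⟩ := exists_unitPt hx
  have hs' : IsStatic (polarAvg (tiltAvg (polarAvg f))) := hhs.rotAvg spatialPair_two_three _ _
  rw [← hs' x hx, hxu]
  rw [(isHomog_polarAvg hh).homog _ (unitPt_mem α φ₀) c hc, zpow_zero, one_mul,
    ← sphereInt_polarAvg hf hs, ← sphereInt_comp_rot hg hα.1]
  have h2 : (0 : ℝ) ≤ 2 * Real.pi := by positivity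
  have key : ∀ φ, tiltAvg (polarAvg f) (unitPt α φ) = 2⁻¹ * ∫ θ in (0 : ℝ)..Real.pi,
      Real.sin θ * polarAvg f (rot 1 2 α (unitPt θ φ)) := fun φ => by
    rw [tiltAvg, rotAvg_eq Real.pi_nonneg, ← intervalIntegral.integral_const_mul]
    refine intervalIntegral.integral_congr fun β _ => ?_
    -- Both points lie on the unit sphere and have polar coordinate `cos α cos β - sin α sin β cos
    -- φ`, symmetric in the two angles. Exchanging the angles turns the tilt average of one point
    -- into an integral over the sphere of a rotated function.
    have : polarAvg f (rot 1 2 β (unitPt α φ)) = polarAvg f (rot 1 2 α (unitPt β φ)) := by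
      have e1 := Real.sin_sq_add_cos_sq φ
      have e2 := Real.sin_sq_add_cos_sq α
      have e3 := Real.sin_sq_add_cos_sq β
      apply polarAvg_congr
      · simp [rot_apply, unitPt]
      · simp [rot_apply, unitPt]; ring
      · simp [rot_apply, unitPt]
        linear_combination (Real.sin α ^ 2 * Real.cos β ^ 2 - Real.sin β ^ 2 * Real.cos α ^ 2) * e1
          + Real.sin φ ^ 2 * (Real.sin β ^ 2 * e2 - Real.sin α ^ 2 * e3)
    simp only [this]; ring
  rw [polarAvg, rotAvg_eq h2]
  simp only [rot_unitPt]
  rw [intervalIntegral.integral_comp_add_left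
    (fun φ => (2 * Real.pi)⁻¹ * tiltAvg (polarAvg f) (unitPt α φ)) φ₀]
  have hp : Function.Periodic (fun φ => (2 * Real.pi)⁻¹ * tiltAvg (polarAvg f) (unitPt α φ))
      (2 * Real.pi) := fun s => by simp only [unitPt_add_two_pi]
  have hp' := hp.intervalIntegral_add_eq φ₀ 0
  rw [zero_add] at hp'
  rw [add_zero, hp']
  simp only [key]
  rw [intervalIntegral.integral_const_mul, intervalIntegral.integral_const_mul, sphereInt]
  have := Real.pi_ne_zero
  field_simp
  ring

/-- A function of vanishing mean on the sphere is a sum of derivatives along rotations. -/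
theorem exists_angD_add_angD {f : Scalar} (hf : IsHomog 0 f) (hs : IsStatic f)
    (h0 : sphereInt f = 0) : ∃ σ τ : Scalar, (IsHomog 0 σ ∧ IsStatic σ) ∧ (IsHomog 0 τ ∧ IsStatic τ) ∧
      ∀ x ∈ spacelikeRegion, f x = angD 2 3 σ x + angD 1 2 τ x := by
  have hg := isHomog_polarAvg hf
  have hgs : IsStatic (polarAvg f) := hs.rotAvg spatialPair_two_three _ _
  have hh := isHomog_tiltAvg hg
  have hhs : IsStatic (tiltAvg (polarAvg f)) := hgs.rotAvg spatialPair_one_two _ _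
  -- The three differences produced by averaging about the polar axis, then over tilts, then about
  -- the polar axis again telescope to `f` minus its mean, which is zero.
  obtain ⟨σ₁, hσ₁, hσ₁s, e1⟩ := exists_angD_eq_sub_polarAvg hf hs
  obtain ⟨τ, hτ, hτs, e2⟩ := exists_angD_eq_sub_tiltAvg hg hgs
  obtain ⟨σ₂, hσ₂, hσ₂s, e3⟩ := exists_angD_eq_sub_polarAvg hh hhs
  refine ⟨fun x => σ₁ x + σ₂ x, τ, ⟨hσ₁.add hσ₂, hσ₁s.add hσ₂s⟩, ⟨hτ, hτs⟩, fun x hx => ?_⟩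
  have e4 : angD 2 3 (fun x => σ₁ x + σ₂ x) x = angD 2 3 σ₁ x + angD 2 3 σ₂ x := by
    simp only [angD, pd_add (hσ₁.diff hx) (hσ₂.diff hx)]; ring
  rw [e4, e1 x hx, e2 x hx, e3 x hx, polarAvg_tiltAvg_polarAvg hf hs hx, h0]
  ring

/-! ### The spatial norm and directions -/

/-- The Euclidean norm of the spatial part. -/
noncomputable def spaceNorm (x : Mink) : ℝ := √(x 1 ^ 2 + x 2 ^ 2 + x 3 ^ 2)

theorem spaceNorm_sq (x : Mink) : spaceNorm x ^ 2 = x 1 ^ 2 + x 2 ^ 2 + x 3 ^ 2 :=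
  Real.sq_sqrt (by positivity)

theorem spaceNorm_pos {x : Mink} (hx : x ∈ spacelikeRegion) : 0 < spaceNorm x := by
  rw [mem_region_iff] at hx
  exact Real.sqrt_pos.2 (by nlinarith [sq_nonneg (x 0)])

theorem isHomog_spaceNorm : IsHomog 1 spaceNorm := by
  refine ⟨ContDiffOn.sqrt (ContDiff.contDiffOn (by fun_prop)) fun x hx => ?_, fun x hx c hc => ?_⟩
  · have := spaceNorm_pos hx
    rw [← spaceNorm_sq]; positivity
  · simp only [spaceNorm, Pi.smul_apply, smul_eq_mul, zpow_one]
    rw [← Real.sqrt_sq hc.le, ← Real.sqrt_mul (sq_nonneg c), Real.sqrt_sq hc.le]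
    congr 1; ring

theorem isStatic_spaceNorm : IsStatic spaceNorm := fun x _ => by
  simp [spaceNorm, timeScale_apply]

theorem pd_spaceNorm {x : Mink} (hx : x ∈ spacelikeRegion) (C : Fin 4) :
    pd spaceNorm C x = if C = 0 then 0 else x C / spaceNorm x := by
  have hd := isHomog_spaceNorm.diff hx
  have h1 : pd (fun y => spaceNorm y * spaceNorm y) C x =
      pd (fun y => y 1 * y 1 + y 2 * y 2 + y 3 * y 3) C x := by
    congr 1; ext y; rw [← sq, spaceNorm_sq]; ring
  have hc : ∀ A : Fin 4, DifferentiableAt ℝ (fun y : Mink => y A) x := fun A => by fun_prop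
  rw [pd_mul hd hd, pd_add (f := fun y => y 1 * y 1 + y 2 * y 2) (by fun_prop) (by fun_prop),
    pd_add (by fun_prop) (by fun_prop), pd_mul (hc 1) (hc 1), pd_mul (hc 2) (hc 2),
    pd_mul (hc 3) (hc 3)] at h1
  simp only [pd_coord] at h1
  have := (spaceNorm_pos hx).ne'
  have h2 : pd spaceNorm C x * spaceNorm x = if C = 0 then 0 else x C := by
    have h3 : pd spaceNorm C x * spaceNorm x = 2⁻¹ * _ :=
      (by ring : _ = 2⁻¹ * (pd spaceNorm C x * spaceNorm x + spaceNorm x * pd spaceNorm C x)).trans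
        (congrArg _ h1)
    rw [h3]
    fin_cases C <;> simp <;> ring
  rw [← mul_left_inj' this, h2]
  split_ifs <;> field_simp
  simp

/-- The inverse of the Euclidean norm of the spatial part. -/
noncomputable def invNorm (x : Mink) : ℝ := (spaceNorm x)⁻¹

theorem isHomog_invNorm : IsHomog (-1) invNorm :=
  ⟨isHomog_spaceNorm.smooth.inv fun x hx => (spaceNorm_pos hx).ne', fun x hx c hc => by
    rw [invNorm, isHomog_spaceNorm.homog x hx c hc, zpow_one, mul_inv, zpow_neg_one, invNorm]⟩

theorem pd_invNorm {x : Mink} (hx : x ∈ spacelikeRegion) (C : Fin 4) :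
    pd invNorm C x = if C = 0 then 0 else - (x C * invNorm x ^ 3) := by
  have hn := isHomog_spaceNorm.diff hx
  have hi := isHomog_invNorm.diff hx
  have hp := (spaceNorm_pos hx).ne'
  have h1 : pd (fun y => spaceNorm y * invNorm y) C x = pd (fun _ => 1) C x :=
    pd_congr (fun y hy => mul_inv_cancel₀ (spaceNorm_pos hy).ne') hx C
  rw [pd_mul hn hi, pd_const, pd_spaceNorm hx] at h1
  rw [← mul_right_inj' hp]
  split_ifs at h1 ⊢
  · linarith
  · simp only [invNorm] at h1 ⊢
    field_simp at h1 ⊢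
    linarith

theorem invNorm_pow_mul {x : Mink} (hx : x ∈ spacelikeRegion) :
    invNorm x ^ 3 * (x 1 ^ 2 + x 2 ^ 2 + x 3 ^ 2) = invNorm x := by
  have hp := (spaceNorm_pos hx).ne'
  rw [← spaceNorm_sq, invNorm]; field_simp

/-- The linear harmonics on the sphere of directions. -/
noncomputable def direction (i : Fin 4) : Scalar := fun x => x i * invNorm x

theorem isHomog_direction (i : Fin 4) : IsHomog 0 (direction i) :=
  ((IsHomog.coord i).mul isHomog_invNorm).of_eq (by norm_num)

theorem pd_direction {x : Mink} (hx : x ∈ spacelikeRegion) (i C : Fin 4) :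
    pd (direction i) C x = (if i = C then invNorm x else 0) -
      (if C = 0 then 0 else x i * x C * invNorm x ^ 3) := by
  unfold direction
  rw [pd_mul ((IsHomog.coord i).diff hx) (isHomog_invNorm.diff hx), pd_coord, pd_invNorm hx]
  split_ifs <;> ring

/-! ### Integration in time -/

/-- The integral of a function over the time-rescalings of a point. -/
noncomputable def timeAvg (f : Scalar) : Scalar :=
  linAvg volume (Icc (0 : ℝ) 1) (fun _ => 1) timeScale f

theorem continuous_timeScale : Continuous timeScale := by
  refine continuous_clm_apply.2 fun x => continuous_pi fun D => ?_
  simp only [timeScale_apply]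
  split_ifs <;> fun_prop

theorem isHomog_timeAvg {k : ℤ} {f : Scalar} (hf : IsHomog k f) : IsHomog k (timeAvg f) :=
  isHomog_linAvg isCompact_Icc continuousOn_const continuous_timeScale.continuousOn
    (fun _ hs _ hx => timeScale_mem_region hs hx) hf

theorem entry_timeScale (D C : Fin 4) (s : ℝ) :
    entry timeScale D C s = if D = C then (if C = 0 then s else 1) else 0 := by
  simp only [entry, timeScale_apply, Pi.single_apply]
  split_ifs <;> simp_all

theorem pd_timeAvg_zero {f : Scalar} (hf : SmoothOn f) {x : Mink} (hx : x ∈ spacelikeRegion) :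
    pd (timeAvg f) 0 x = ∫ s in (0 : ℝ)..1, s * pd f 0 (timeScale s x) := by
  rw [timeAvg, pd_linAvg_eq_integral isCompact_Icc continuousOn_const
    continuous_timeScale.continuousOn (fun _ hs _ hx => timeScale_mem_region hs hx) hf hx,
    integral_Icc_eq_integral_Ioc, ← intervalIntegral.integral_of_le zero_le_one]
  simp [entry_timeScale]

theorem pd_timeAvg {f : Scalar} (hf : SmoothOn f) {x : Mink} (hx : x ∈ spacelikeRegion)
    {k : Fin 4} (hk : k ≠ 0) : pd (timeAvg f) k x = timeAvg (pd f k) x := by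
  rw [timeAvg, pd_linAvg_eq_integral isCompact_Icc continuousOn_const
    continuous_timeScale.continuousOn (fun _ hs _ hx => timeScale_mem_region hs hx) hf hx]
  simp [entry_timeScale, hk, timeAvg, linAvg]

theorem timeAvg_eq (f : Scalar) (x : Mink) :
    timeAvg f x = ∫ s in (0 : ℝ)..1, f (timeScale s x) := by
  rw [timeAvg, linAvg, integral_Icc_eq_integral_Ioc,
    ← intervalIntegral.integral_of_le zero_le_one]
  simp

theorem hasDerivAt_comp_timeScale {f : Scalar} (hf : SmoothOn f) {x : Mink}
    (hx : x ∈ spacelikeRegion) {s : ℝ} (hs : s ∈ Icc (0 : ℝ) 1) :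
    HasDerivAt (fun s => f (timeScale s x)) (x 0 * pd f 0 (timeScale s x)) s := by
  have h1 : HasDerivAt (fun s => timeScale s x) (x 0 • Pi.single 0 1) s := by
    refine hasDerivAt_pi.2 fun D => ?_
    simp only [timeScale_apply]
    split_ifs with h
    · subst h; simpa using (hasDerivAt_id s).mul_const (x 0)
    · simpa [h] using hasDerivAt_const s (x D)
  have h2 := (hf.differentiableAt (timeScale_mem_region hs hx)).hasFDerivAt.comp_hasDerivAt s h1
  exact h2.congr_deriv (by simp [pd])

theorem continuousOn_comp_timeScale {f : Scalar} (hf : SmoothOn f) {x : Mink}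
    (hx : x ∈ spacelikeRegion) : ContinuousOn (fun s => f (timeScale s x)) (uIcc (0 : ℝ) 1) := by
  rw [uIcc_of_le zero_le_one]
  exact fun s hs => (hasDerivAt_comp_timeScale hf hx hs).continuousAt.continuousWithinAt

/-- The fundamental theorem of calculus along the vertical segment from time zero to `x`. -/
theorem time_mul_timeAvg_pd {f : Scalar} (hf : SmoothOn f) {x : Mink} (hx : x ∈ spacelikeRegion) :
    x 0 * timeAvg (pd f 0) x = f x - f (timeScale 0 x) := by
  rw [timeAvg_eq, ← intervalIntegral.integral_const_mul,
    intervalIntegral.integral_eq_sub_of_hasDerivAt (f := fun s => f (timeScale s x))]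
  · congr 2; ext D; simp [timeScale_apply]
  · rw [uIcc_of_le zero_le_one]
    exact fun s hs => hasDerivAt_comp_timeScale hf hx hs
  · exact (continuousOn_const.mul (continuousOn_comp_timeScale (hf.pd 0) hx)).intervalIntegrable

/-- After differentiation under the integral, the integrand is the total derivative of `s * f
(timeScale s x)` in `s`. -/
theorem pd_time_mul_timeAvg {k : ℤ} {f : Scalar} (hf : IsHomog k f) {x : Mink}
    (hx : x ∈ spacelikeRegion) : pd (fun y => y 0 * timeAvg f y) 0 x = f x := by
  rw [pd_mul ((IsHomog.coord 0).diff hx) ((isHomog_timeAvg hf).diff hx), pd_coord,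
    pd_timeAvg_zero hf.smooth hx, timeAvg_eq]
  simp only [if_true, one_mul]
  rw [← intervalIntegral.integral_const_mul]
  have hc := continuousOn_comp_timeScale hf.smooth hx
  have hc' := continuousOn_comp_timeScale (hf.smooth.pd 0) hx
  rw [← intervalIntegral.integral_add hc.intervalIntegrable (by
      exact (continuousOn_const.mul (continuousOn_id.mul hc')).intervalIntegrable),
    intervalIntegral.integral_eq_sub_of_hasDerivAt (f := fun s => s * f (timeScale s x))]
  · simp only [one_mul, zero_mul, sub_zero]
    congr 1; ext D; simp [timeScale_apply]
  · rw [uIcc_of_le zero_le_one]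
    intro s hs
    exact ((hasDerivAt_id s).mul (hasDerivAt_comp_timeScale hf.smooth hx hs)).congr_deriv
      (by simp; ring)
  · exact (hc.add (continuousOn_const.mul (continuousOn_id.mul hc'))).intervalIntegrable

theorem pd_time_mul_timeAvg_of_ne {k : ℤ} {f : Scalar} (hf : IsHomog k f) {x : Mink}
    (hx : x ∈ spacelikeRegion) {j : Fin 4} (hj : j ≠ 0) :
    pd (fun y => y 0 * timeAvg f y) j x = x 0 * timeAvg (pd f j) x := by
  rw [pd_mul ((IsHomog.coord 0).diff hx) ((isHomog_timeAvg hf).diff hx), pd_coord,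
    pd_timeAvg hf.smooth hx hj]
  simp [hj.symm]

theorem timeAvg_sub {k : ℤ} {f g : Scalar} (hf : IsHomog k f) (hg : IsHomog k g) {x : Mink}
    (hx : x ∈ spacelikeRegion) :
    timeAvg f x - timeAvg g x = timeAvg (fun y => f y - g y) x := by
  simp only [timeAvg_eq]
  rw [intervalIntegral.integral_sub
    (continuousOn_comp_timeScale hf.smooth hx).intervalIntegrable
    (continuousOn_comp_timeScale hg.smooth hx).intervalIntegrable]

theorem timeAvg_congr {f g : Scalar} (h : ∀ x ∈ spacelikeRegion, f x = g x) {x : Mink}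
    (hx : x ∈ spacelikeRegion) : timeAvg f x = timeAvg g x := by
  simp only [timeAvg_eq]
  refine intervalIntegral.integral_congr fun s hs => ?_
  rw [uIcc_of_le zero_le_one] at hs
  exact h _ (timeScale_mem_region hs hx)

/-- The homotopy formula for the magnetic part `B` of a closed two-form `(E, B)`. -/
theorem curl_time_mul_timeAvg {E F B : Scalar} {k : ℤ} (hE : IsHomog k E) (hF : IsHomog k F)
    (hB : SmoothOn B) {i j : Fin 4} (hi : i ≠ 0) (hj : j ≠ 0)
    (h : ∀ x ∈ spacelikeRegion, pd B 0 x = pd F i x - pd E j x) {x : Mink}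
    (hx : x ∈ spacelikeRegion) :
    pd (fun y => y 0 * timeAvg F y) i x - pd (fun y => y 0 * timeAvg E y) j x =
      B x - B (timeScale 0 x) := by
  rw [pd_time_mul_timeAvg_of_ne hF hx hi, pd_time_mul_timeAvg_of_ne hE hx hj, ← mul_sub,
    timeAvg_sub (hF.pd i) (hE.pd j) hx, ← time_mul_timeAvg_pd hB hx, timeAvg_congr h hx]

theorem IsHomog.comp_timeScale {k : ℤ} {f : Scalar} (hf : IsHomog k f) :
    IsHomog k fun x => f (timeScale 0 x) :=
  ⟨hf.smooth.comp (timeScale 0).contDiff.contDiffOn fun _ hx => timeScale_zero_mem hx,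
    fun x hx c hc => by rw [map_smul, hf.homog _ (timeScale_zero_mem hx) c hc]⟩

/-! ### Potentials of divergence-free currents -/

/-- A static closed two-form of vanishing flux is exact. -/
theorem exists_static_potential {f : Scalar} (hf : IsHomog (-3) f) (h0 : sphereInt f = 0) :
    ∃ a : Fin 4 → Scalar, (∀ C, IsHomog (-1) (a C)) ∧ (∀ x ∈ spacelikeRegion, a 0 x = 0) ∧
      (∀ x ∈ spacelikeRegion, ∑ C, x C * a C x = 0) ∧ ∀ x ∈ spacelikeRegion,
        (∀ C, pd (a C) 0 x = 0) ∧
        pd (a 2) 1 x - pd (a 1) 2 x = x 3 * f (timeScale 0 x) ∧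
        pd (a 3) 2 x - pd (a 2) 3 x = x 1 * f (timeScale 0 x) ∧
        pd (a 1) 3 x - pd (a 3) 1 x = x 2 * f (timeScale 0 x) := by
  -- The cube of the spatial norm raises the degree from -3 to 0 without changing the values on the
  -- unit sphere at time zero, so the mean stays zero.
  have hρ : IsHomog 0 fun x => spaceNorm x * spaceNorm x * spaceNorm x * f (timeScale 0 x) :=
    ((((isHomog_spaceNorm.mul isHomog_spaceNorm).mul isHomog_spaceNorm)).mul
      hf.comp_timeScale).of_eq (by norm_num)
  have hρs : IsStatic fun x => spaceNorm x * spaceNorm x * spaceNorm x * f (timeScale 0 x) := by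
    intro x hx
    simp only [isStatic_spaceNorm x hx]
    congr 2; ext D; simp +contextual [timeScale_apply]
  obtain ⟨σ, τ, ⟨hσ, hσs⟩, ⟨hτ, hτs⟩, hst⟩ := exists_angD_add_angD hρ hρs (by
    refine (sphereInt_congr fun x hx hx0 => ?_).trans h0
    have h1 : spaceNorm x = 1 := by
      have : mink x x = 1 := hx
      rw [mink_eq, hx0] at this
      rw [spaceNorm, Real.sqrt_eq_one]; linarith
    have h2 : timeScale 0 x = x := by
      ext D; rw [timeScale_apply]; split_ifs with h <;> simp [h, hx0]
    rw [h1, h2]; ring)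
  have hdir : ∀ i C, IsHomog (-1) (pd (direction i) C) := fun i C =>
    ((isHomog_direction i).pd C).of_eq (by norm_num)
  have hpd : ∀ x ∈ spacelikeRegion, ∀ C D,
      pd (fun y => σ y * pd (direction 1) C y + τ y * pd (direction 3) C y) D x =
      (pd σ D x * pd (direction 1) C x + σ x * pd (pd (direction 1) C) D x) +
      (pd τ D x * pd (direction 3) C x + τ x * pd (pd (direction 3) C) D x) := by
    intro x hx C D
    rw [pd_add ((hσ.mul (hdir 1 C)).diff hx) ((hτ.mul (hdir 3 C)).diff hx),
      pd_mul (hσ.diff hx) ((hdir 1 C).diff hx), pd_mul (hτ.diff hx) ((hdir 3 C).diff hx)]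
  have hz : ∀ i, i ≠ 0 → ∀ x ∈ spacelikeRegion, pd (direction i) 0 x = 0 := fun i hi x hx => by
    rw [pd_direction hx]; simp [hi]
  -- The potential is `σ dn₁ + τ dn₃`, with `n` the unit direction. On the sphere the coordinate
  -- `n₁` is a Hamiltonian for rotations in the (2,3)-plane and `n₃` for those in the (1,2)-plane,
  -- so the exterior derivative is the area form times the sum of the two angular derivatives, which
  -- is `ρ`.
  refine ⟨fun C y => σ y * pd (direction 1) C y + τ y * pd (direction 3) C y,
    fun C => ((hσ.mul (hdir 1 C)).of_eq (by norm_num)).add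
      ((hτ.mul (hdir 3 C)).of_eq (by norm_num)), fun x hx => ?_, fun x hx => ?_, fun x hx => ?_⟩
  · simp [hz 1 (by decide) x hx, hz 3 (by decide) x hx]
  · have h1 := (isHomog_direction 1).euler hx
    have h3 := (isHomog_direction 3).euler hx
    simp only [Fin.sum_univ_four] at h1 h3 ⊢
    push_cast at h1 h3
    linear_combination σ x * h1 + τ x * h3
  · have eσ := hσ.euler hx
    have eτ := hτ.euler hx
    have hc := fun i C D => pd_comm (isHomog_direction i).smooth hx C D
    have hi := invNorm_pow_mul hx
    have hn : invNorm x ^ 3 * (spaceNorm x * spaceNorm x * spaceNorm x) = 1 := by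
      have := (spaceNorm_pos hx).ne'
      rw [invNorm]; field_simp
    have hf' : f (timeScale 0 x) = invNorm x ^ 3 * (angD 2 3 σ x + angD 1 2 τ x) := by
      rw [← hst x hx, ← mul_assoc, hn, one_mul]
    have hσ0 := hσs.pd_zero hσ.smooth hx
    have hτ0 := hτs.pd_zero hτ.smooth hx
    simp only [Fin.sum_univ_four, hσ0, hτ0] at eσ eτ
    push_cast at eσ eτ
    refine ⟨fun C => ?_, ?_, ?_, ?_⟩
    · have h1 : pd (pd (direction 1) C) 0 x = 0 := by
        rw [hc, pd_congr (hz 1 (by decide)) hx, pd_const]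
      have h3 : pd (pd (direction 3) C) 0 x = 0 := by
        rw [hc, pd_congr (hz 3 (by decide)) hx, pd_const]
      rw [hpd x hx, h1, h3, hσ0, hτ0]; ring
    -- What remains is that `σ` and `τ` are constant along spatial rays (Euler's relation in degree
    -- zero, the time derivative being absent), together with the relation between `invNorm` and the
    -- coordinates.
    all_goals
      rw [hpd x hx, hpd x hx, hf']
      simp only [angD]
    · rw [hc 1 2 1, hc 3 2 1]
      simp only [pd_direction hx]
      simp
      linear_combination -x 2 * invNorm x ^ 3 * eσ + pd σ 2 x * hi
    · rw [hc 1 3 2, hc 3 3 2]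
      simp only [pd_direction hx]
      simp
      linear_combination x 2 * invNorm x ^ 3 * eτ - pd τ 2 x * hi
    · rw [hc 1 1 3, hc 3 1 3]
      simp only [pd_direction hx]
      simp
      linear_combination x 3 * invNorm x ^ 3 * eσ - pd σ 3 x * hi - x 1 * invNorm x ^ 3 * eτ + pd τ 1 x * hi

/-- The two-form dual to a vector field on the hyperboloid. -/
noncomputable def dualForm (J : Fin 4 → Scalar) (x : Mink) (C D : Fin 4) : ℝ :=
  -∑ A, eps x A C D * eta A * J A x

theorem vol_eq (x u v w : Mink) : vol x u v w =
    u 0 * (x 1 * (v 2 * w 3 - v 3 * w 2) - x 2 * (v 1 * w 3 - v 3 * w 1)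
      + x 3 * (v 1 * w 2 - v 2 * w 1))
    - u 1 * (x 0 * (v 2 * w 3 - v 3 * w 2) - x 2 * (v 0 * w 3 - v 3 * w 0)
      + x 3 * (v 0 * w 2 - v 2 * w 0))
    + u 2 * (x 0 * (v 1 * w 3 - v 3 * w 1) - x 1 * (v 0 * w 3 - v 3 * w 0)
      + x 3 * (v 0 * w 1 - v 1 * w 0))
    - u 3 * (x 0 * (v 1 * w 2 - v 2 * w 1) - x 1 * (v 0 * w 2 - v 2 * w 0)
      + x 2 * (v 0 * w 1 - v 1 * w 0)) := by
  simp only [vol, Matrix.det_succ_row_zero, Fin.sum_univ_succ]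
  simp [Fin.succAbove, Fin.lt_def, Matrix.submatrix]
  ring

theorem dualForm_zero (J : Fin 4 → Scalar) (x : Mink) :
    dualForm J x 0 1 = x 2 * J 3 x - x 3 * J 2 x ∧ dualForm J x 0 2 = x 3 * J 1 x - x 1 * J 3 x ∧
      dualForm J x 0 3 = x 1 * J 2 x - x 2 * J 1 x ∧ dualForm J x 1 2 = x 3 * J 0 x + x 0 * J 3 x ∧
      dualForm J x 2 3 = x 1 * J 0 x + x 0 * J 1 x ∧
      dualForm J x 3 1 = x 2 * J 0 x + x 0 * J 2 x := by
  simp only [dualForm, eps, vol_eq, Fin.sum_univ_four, eta, Pi.single_apply]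
  simp
  refine ⟨?_, ?_, ?_, ?_, ?_, ?_⟩ <;> ring

theorem dualForm_antisymm (J : Fin 4 → Scalar) (x : Mink) (C D : Fin 4) :
    dualForm J x D C = - dualForm J x C D := by
  simp only [dualForm, eps, vol_eq, Fin.sum_univ_four]
  ring

theorem dualForm_self (J : Fin 4 → Scalar) (x : Mink) (C : Fin 4) : dualForm J x C C = 0 := by
  have := dualForm_antisymm J x C C
  linarith

theorem isHomog_dualForm {k : ℤ} {J : Fin 4 → Scalar} (hJ : ∀ A, IsHomog k (J A)) (C D : Fin 4) :
    IsHomog (k + 1) fun x => dualForm J x C D := by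
  have h : ∀ A B, IsHomog (k + 1) fun x => x A * J B x := fun A B =>
    ((IsHomog.coord A).mul (hJ B)).of_eq (by ring)
  have h01 : IsHomog (k + 1) fun x => dualForm J x 0 1 :=
    ((h 2 3).sub (h 3 2)).congr fun x _ => (dualForm_zero J x).1
  have h02 : IsHomog (k + 1) fun x => dualForm J x 0 2 :=
    ((h 3 1).sub (h 1 3)).congr fun x _ => (dualForm_zero J x).2.1
  have h03 : IsHomog (k + 1) fun x => dualForm J x 0 3 :=
    ((h 1 2).sub (h 2 1)).congr fun x _ => (dualForm_zero J x).2.2.1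
  have h12 : IsHomog (k + 1) fun x => dualForm J x 1 2 :=
    ((h 3 0).add (h 0 3)).congr fun x _ => (dualForm_zero J x).2.2.2.1
  have h23 : IsHomog (k + 1) fun x => dualForm J x 2 3 :=
    ((h 1 0).add (h 0 1)).congr fun x _ => (dualForm_zero J x).2.2.2.2.1
  have h31 : IsHomog (k + 1) fun x => dualForm J x 3 1 :=
    ((h 2 0).add (h 0 2)).congr fun x _ => (dualForm_zero J x).2.2.2.2.2
  have hs : ∀ {C D}, (IsHomog (k + 1) fun x => dualForm J x C D) →
      IsHomog (k + 1) fun x => dualForm J x D C := fun h =>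
    h.neg.congr fun x _ => dualForm_antisymm J x _ _
  have h0 : ∀ C, IsHomog (k + 1) fun x => dualForm J x C C := fun C =>
    (h01.sub h01).congr fun x _ => by rw [dualForm_self, sub_self]
  fin_cases C <;> fin_cases D
  exacts [h0 0, h01, h02, h03, hs h01, h0 1, h12, hs h31, hs h02, hs h12, h0 2, h23,
    hs h03, h31, hs h23, h0 3]

/-- The position vector would appear twice in the determinant defining `eps`. -/
theorem sum_mul_dualForm (J : Fin 4 → Scalar) (x : Mink) (D : Fin 4) :
    ∑ C, x C * dualForm J x C D = 0 := by
  simp only [dualForm, eps, vol_eq, Fin.sum_univ_four, eta, Pi.single_apply]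
  fin_cases D <;> simp <;> ring

/-- The dual form of a tangential divergence-free field is closed. -/
theorem closed_dualForm {J : Fin 4 → Scalar} (hJ : ∀ A, IsHomog (-3) (J A))
    (hdiv : ∀ x ∈ spacelikeRegion, ∑ A, eta A * pd (J A) A x = 0) {x : Mink}
    (hx : x ∈ spacelikeRegion) :
    pd (fun y => dualForm J y 1 2) 0 x =
        pd (fun y => dualForm J y 0 2) 1 x - pd (fun y => dualForm J y 0 1) 2 x ∧
      pd (fun y => dualForm J y 2 3) 0 x =
        pd (fun y => dualForm J y 0 3) 2 x - pd (fun y => dualForm J y 0 2) 3 x ∧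
      pd (fun y => dualForm J y 3 1) 0 x =
        pd (fun y => dualForm J y 0 1) 3 x - pd (fun y => dualForm J y 0 3) 1 x := by
  have hm : ∀ A B C, pd (fun y => y A * J B y) C x =
      (if A = C then J B x else 0) + x A * pd (J B) C x := fun A B C => by
    rw [pd_mul ((IsHomog.coord A).diff hx) ((hJ B).diff hx), pd_coord]
    split_ifs <;> ring
  have hd : ∀ A B, DifferentiableAt ℝ (fun y => y A * J B y) x := fun A B =>
    ((IsHomog.coord A).diff hx).mul ((hJ B).diff hx)
  have e := fun B => (hJ B).euler hx
  have hdiv := hdiv x hx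
  simp only [Fin.sum_univ_four, eta] at e hdiv
  simp at hdiv
  push_cast at e
  simp only [(dualForm_zero J _).1, (dualForm_zero J _).2.1, (dualForm_zero J _).2.2.1,
    (dualForm_zero J _).2.2.2.1, (dualForm_zero J _).2.2.2.2.1, (dualForm_zero J _).2.2.2.2.2]
  simp only [pd_add (hd _ _) (hd _ _), pd_sub (hd _ _) (hd _ _), hm]
  simp
  -- Degree -3 is what makes this work: Euler's relation then supplies `-3 * J k`, exactly balancing
  -- the terms where a derivative hits an explicit coordinate. The rest is a coordinate times the
  -- flat divergence.
  refine ⟨?_, ?_, ?_⟩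
  · linear_combination e 3 - x 3 * hdiv
  · linear_combination e 1 - x 1 * hdiv
  · linear_combination e 2 - x 2 * hdiv

/-- Divergence-free tangential fields of vanishing flux have potentials. -/
theorem exists_potential {J : Fin 4 → Scalar} (hJ : ∀ A, IsHomog (-3) (J A))
    (hdiv : ∀ x ∈ spacelikeRegion, ∑ A, eta A * pd (J A) A x = 0) (h0 : sphereInt (J 0) = 0) :
    ∃ a : Fin 4 → Scalar, (∀ C, IsHomog (-1) (a C)) ∧
      (∀ x ∈ spacelikeRegion, ∑ C, x C * a C x = 0) ∧ ∀ x ∈ spacelikeRegion, ∀ C D,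
        pd (a D) C x - pd (a C) D x = dualForm J x C D := by
  obtain ⟨b, hb, hb0, hbx, hbd⟩ := exists_static_potential (hJ 0) h0
  have hE : ∀ C D, IsHomog (-2) fun x => dualForm J x C D := fun C D =>
    (isHomog_dualForm hJ C D).of_eq (by norm_num)
  have hβ : ∀ k, IsHomog (-1) fun y => y 0 * timeAvg (fun z => dualForm J z 0 k) y := fun k =>
    ((IsHomog.coord 0).mul (isHomog_timeAvg (hE 0 k))).of_eq (by norm_num)
  have hβ0 : ∀ x ∈ spacelikeRegion, timeAvg (fun z => dualForm J z 0 0) x = 0 := fun x _ => by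
    simp [timeAvg_eq, dualForm_self]
  have hpd : ∀ x ∈ spacelikeRegion, ∀ C D,
      pd (fun y => b D y + y 0 * timeAvg (fun z => dualForm J z 0 D) y) C x =
        pd (b D) C x + pd (fun y => y 0 * timeAvg (fun z => dualForm J z 0 D) y) C x :=
    fun x hx C D => pd_add ((hb D).diff hx) ((hβ D).diff hx) C
  -- Temporal gauge: the time component vanishes, the time derivative of each spatial component is
  -- the corresponding electric component of the form, and the static potential gives the value at
  -- time zero.
  refine ⟨fun D y => b D y + y 0 * timeAvg (fun z => dualForm J z 0 D) y,
    fun D => (hb D).add (hβ D), fun x hx => ?_, fun x hx => ?_⟩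
  · simp only [mul_add, Finset.sum_add_distrib, hbx x hx, zero_add]
    have : ∑ D, x D * timeAvg (fun z => dualForm J z 0 D) x = 0 := by
      have hint : ∀ D, IntervalIntegrable (fun s => x D * dualForm J (timeScale s x) 0 D) volume 0 1 :=
        fun D => (continuousOn_const.mul
          (continuousOn_comp_timeScale (hE 0 D).smooth hx)).intervalIntegrable
      simp only [timeAvg_eq, ← intervalIntegral.integral_const_mul]
      rw [← intervalIntegral.integral_finsetSum fun D _ => hint D]
      refine (intervalIntegral.integral_congr fun s _ => ?_).trans intervalIntegral.integral_zero
      have h := sum_mul_dualForm J (timeScale s x) 0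
      simp only [Fin.sum_univ_four, timeScale_apply, dualForm_self] at h ⊢
      rw [dualForm_antisymm J _ 1 0, dualForm_antisymm J _ 2 0, dualForm_antisymm J _ 3 0]
      simp at h ⊢
      linarith
    calc ∑ D, x D * (x 0 * timeAvg (fun z => dualForm J z 0 D) x)
        = x 0 * ∑ D, x D * timeAvg (fun z => dualForm J z 0 D) x := by
          rw [Finset.mul_sum]; exact Finset.sum_congr rfl fun D _ => by ring
      _ = 0 := by rw [this, mul_zero]
  · obtain ⟨hbz, h12, h23, h31⟩ := hbd x hx
    have hcl := fun y (hy : y ∈ spacelikeRegion) => closed_dualForm hJ hdiv hy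
    -- Closedness makes the spatial curl of the time integral equal to the change of the magnetic
    -- part since time zero; `b` accounts for the initial value.
    have k12 := curl_time_mul_timeAvg (hE 0 1) (hE 0 2) (hE 1 2).smooth (by decide : (1 : Fin 4) ≠ 0)
      (by decide : (2 : Fin 4) ≠ 0) (fun y hy => (hcl y hy).1) hx
    have k23 := curl_time_mul_timeAvg (hE 0 2) (hE 0 3) (hE 2 3).smooth (by decide : (2 : Fin 4) ≠ 0)
      (by decide : (3 : Fin 4) ≠ 0) (fun y hy => (hcl y hy).2.1) hx
    have k31 := curl_time_mul_timeAvg (hE 0 3) (hE 0 1) (hE 3 1).smooth (by decide : (3 : Fin 4) ≠ 0)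
      (by decide : (1 : Fin 4) ≠ 0) (fun y hy => (hcl y hy).2.2) hx
    rw [(dualForm_zero J (timeScale 0 x)).2.2.2.1] at k12
    rw [(dualForm_zero J (timeScale 0 x)).2.2.2.2.1] at k23
    rw [(dualForm_zero J (timeScale 0 x)).2.2.2.2.2] at k31
    simp [timeScale_apply] at k12 k23 k31
    have hz : ∀ C, pd (b 0) C x = 0 := fun C => by rw [pd_congr hb0 hx, pd_const]
    have hz' : ∀ C, pd (fun y => y 0 * timeAvg (fun z => dualForm J z 0 0) y) C x = 0 := fun C => by
      rw [pd_congr (g := fun _ => 0) (fun y hy => by rw [hβ0 y hy, mul_zero]) hx, pd_const]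
    have ht : ∀ k, pd (fun y => y 0 * timeAvg (fun z => dualForm J z 0 k) y) 0 x =
        dualForm J x 0 k := fun k => pd_time_mul_timeAvg (hE 0 k) hx
    have anti := dualForm_antisymm J x
    have q12 : pd (b 2) 1 x + pd (fun y => y 0 * timeAvg (fun z => dualForm J z 0 2) y) 1 x -
        (pd (b 1) 2 x + pd (fun y => y 0 * timeAvg (fun z => dualForm J z 0 1) y) 2 x) =
        dualForm J x 1 2 := by linear_combination h12 + k12
    have q23 : pd (b 3) 2 x + pd (fun y => y 0 * timeAvg (fun z => dualForm J z 0 3) y) 2 x -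
        (pd (b 2) 3 x + pd (fun y => y 0 * timeAvg (fun z => dualForm J z 0 2) y) 3 x) =
        dualForm J x 2 3 := by linear_combination h23 + k23
    have q31 : pd (b 1) 3 x + pd (fun y => y 0 * timeAvg (fun z => dualForm J z 0 1) y) 3 x -
        (pd (b 3) 1 x + pd (fun y => y 0 * timeAvg (fun z => dualForm J z 0 3) y) 1 x) =
        dualForm J x 3 1 := by linear_combination h31 + k31
    intro C D
    simp only [hpd x hx]
    fin_cases C <;> fin_cases D <;> simp only [Fin.zero_eta, Fin.mk_one, Fin.reduceFinMk]
    · rw [dualForm_self]; ring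
    · rw [hbz, hz, hz', ht]; ring
    · rw [hbz, hz, hz', ht]; ring
    · rw [hbz, hz, hz', ht]; ring
    · rw [hbz, hz, hz', ht, anti 0 1]; ring
    · rw [dualForm_self]; ring
    · exact q12
    · rw [anti 3 1]; linear_combination -q31
    · rw [hbz, hz, hz', ht, anti 0 2]; ring
    · rw [anti 1 2]; linear_combination -q12
    · rw [dualForm_self]; ring
    · exact q23
    · rw [hbz, hz, hz', ht, anti 0 3]; ring
    · exact q31
    · rw [anti 2 3]; linear_combination -q23
    · rw [dualForm_self]; ring

/-! ### The retarded solution of the flat wave equation -/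

/-- The past-pointing null vectors of unit time component. -/
noncomputable def nullVec (θ φ : ℝ) : Mink :=
  ![-1, Real.cos θ, Real.sin θ * Real.cos φ, Real.sin θ * Real.sin φ]

/-- The point of the light cone of `x` at the fraction `p 0` of the way to time zero. -/
noncomputable def conePt (p : Fin 3 → ℝ) : Mink →L[ℝ] Mink :=
  ContinuousLinearMap.id ℝ Mink +
    (p 0 • ContinuousLinearMap.proj 0 : Mink →L[ℝ] ℝ).smulRight (nullVec (p 1) (p 2))

theorem conePt_eq (p : Fin 3 → ℝ) (x : Mink) :
    conePt p x = x + (p 0 * x 0) • nullVec (p 1) (p 2) := by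
  simp [conePt]

/-- Moving in a null direction makes the Minkowski norm affine in `p 0`: it interpolates between its
value at `x` and a spatial squared norm at time zero. The latter vanishes only if `x` is itself
null. -/
theorem conePt_mem_region {p : Fin 3 → ℝ} (h0 : 0 ≤ p 0) (h1 : p 0 ≤ 1) {x : Mink}
    (hx : x ∈ spacelikeRegion) : conePt p x ∈ spacelikeRegion := by
  rw [mem_region_iff] at *
  rw [conePt_eq]
  simp only [Pi.add_apply, Pi.smul_apply, smul_eq_mul, nullVec]
  simp
  set a := Real.cos (p 1)
  set b := Real.sin (p 1) * Real.cos (p 2)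
  set c := Real.sin (p 1) * Real.sin (p 2)
  have hn : a ^ 2 + b ^ 2 + c ^ 2 = 1 := by
    simp only [a, b, c]
    linear_combination Real.sin (p 1) ^ 2 * Real.sin_sq_add_cos_sq (p 2)
      + Real.sin_sq_add_cos_sq (p 1)
  have hq : 0 ≤ (x 1 + x 0 * a) ^ 2 + (x 2 + x 0 * b) ^ 2 + (x 3 + x 0 * c) ^ 2 := by positivity
  have key : (x 1 + p 0 * x 0 * a) ^ 2 + (x 2 + p 0 * x 0 * b) ^ 2 + (x 3 + p 0 * x 0 * c) ^ 2
      - (x 0 + -(p 0 * x 0)) ^ 2 = (1 - p 0) * (x 1 ^ 2 + x 2 ^ 2 + x 3 ^ 2 - x 0 ^ 2)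
      + p 0 * ((x 1 + x 0 * a) ^ 2 + (x 2 + x 0 * b) ^ 2 + (x 3 + x 0 * c) ^ 2) := by
    linear_combination (p 0 * (p 0 - 1) * x 0 ^ 2) * hn
  rw [← sub_pos, key]
  rcases h1.lt_or_eq with h | h
  · have : 0 < (1 - p 0) * (x 1 ^ 2 + x 2 ^ 2 + x 3 ^ 2 - x 0 ^ 2) :=
      mul_pos (by linarith) (by linarith)
    have := mul_nonneg h0 hq
    linarith
  · rw [h]
    rcases hq.lt_or_eq with h' | h'
    · linarith
    · exfalso
      have e1 : x 1 = - (x 0 * a) := by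
        nlinarith [sq_nonneg (x 1 + x 0 * a), sq_nonneg (x 2 + x 0 * b), sq_nonneg (x 3 + x 0 * c)]
      have e2 : x 2 = - (x 0 * b) := by
        nlinarith [sq_nonneg (x 1 + x 0 * a), sq_nonneg (x 2 + x 0 * b), sq_nonneg (x 3 + x 0 * c)]
      have e3 : x 3 = - (x 0 * c) := by
        nlinarith [sq_nonneg (x 1 + x 0 * a), sq_nonneg (x 2 + x 0 * b), sq_nonneg (x 3 + x 0 * c)]
      rw [e1, e2, e3] at hx
      nlinarith

theorem contDiff_conePt (x : Mink) : ContDiff ℝ ∞ fun p : Fin 3 → ℝ => conePt p x := by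
  simp only [conePt_eq]
  refine contDiff_pi.2 fun D => ?_
  fin_cases D <;> simp [nullVec] <;> fun_prop

theorem continuous_conePt : Continuous conePt :=
  continuous_clm_apply.2 fun x => (contDiff_conePt x).continuous

/-- The parameter box of the light cone. -/
noncomputable def coneBox : Set (Fin 3 → ℝ) := Icc 0 ![1, Real.pi, 2 * Real.pi]

theorem coneBox_mem {p : Fin 3 → ℝ} (hp : p ∈ coneBox) {x : Mink} (hx : x ∈ spacelikeRegion) :
    conePt p x ∈ spacelikeRegion := conePt_mem_region (hp.1 0) (by simpa using hp.2 0) hx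

theorem entry_conePt (p : Fin 3 → ℝ) (D C : Fin 4) :
    entry conePt D C p =
      (if D = C then 1 else 0) + (if C = 0 then p 0 * nullVec (p 1) (p 2) D else 0) := by
  simp only [entry, conePt_eq, Pi.add_apply, Pi.smul_apply, smul_eq_mul, Pi.single_apply]
  by_cases h : C = 0 <;> simp [h, eq_comm]

/-- The retarded average over the light cone. -/
noncomputable def coneAvg (G : Scalar) : Scalar :=
  linAvg volume coneBox (fun p => p 0 * Real.sin (p 1)) conePt G

/-- The flat wave operator. -/
noncomputable def box (F : Scalar) : Scalar := fun x => ∑ A, eta A * pd (pd F A) A x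

/-- The integrand of the wave operator applied to the retarded average. -/
noncomputable def coneDensity (G : Scalar) (x : Mink) (p : Fin 3 → ℝ) : ℝ :=
  p 0 * Real.sin (p 1) * (-2 * G (conePt p x)
    - 4 * x 0 * ∑ D, entry conePt D 0 p * pd G D (conePt p x)
    - x 0 ^ 2 * (∑ D, ∑ E, entry conePt D 0 p * entry conePt E 0 p * pd (pd G D) E (conePt p x))
    + x 0 ^ 2 * (pd (pd G 1) 1 (conePt p x) + pd (pd G 2) 2 (conePt p x)
      + pd (pd G 3) 3 (conePt p x)))

theorem continuousOn_comp_conePt {G : Scalar} (hG : SmoothOn G) {x : Mink}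
    (hx : x ∈ spacelikeRegion) : ContinuousOn (fun p => G (conePt p x)) coneBox :=
  hG.continuousOn.comp (contDiff_conePt x).continuous.continuousOn fun _ hp => coneBox_mem hp hx

theorem continuous_entry_conePt (D C : Fin 4) : Continuous (entry conePt D C) :=
  (continuous_apply D).comp (continuous_conePt.clm_apply continuous_const)

theorem continuousOn_coneWeight :
    ContinuousOn (fun p : Fin 3 → ℝ => p 0 * Real.sin (p 1)) coneBox := by
  fun_prop

theorem continuousOn_coneDensity {G : Scalar} (hG : SmoothOn G) {x : Mink}
    (hx : x ∈ spacelikeRegion) : ContinuousOn (coneDensity G x) coneBox := by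
  have hv := continuousOn_coneWeight
  have h0 := continuousOn_comp_conePt hG hx
  have h1 := fun D => continuousOn_comp_conePt (hG.pd D) hx
  have h2 := fun D E => continuousOn_comp_conePt ((hG.pd D).pd E) hx
  have he := fun D => (continuous_entry_conePt D 0).continuousOn (s := coneBox)
  unfold coneDensity
  refine hv.mul ?_
  refine (((continuousOn_const.mul h0).sub (continuousOn_const.mul ?_)).sub
    (continuousOn_const.mul ?_)).add (continuousOn_const.mul (((h2 1 1).add (h2 2 2)).add (h2 3 3)))
  · exact continuousOn_finsetSum _ fun D _ => (he D).mul (h1 D)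
  · exact continuousOn_finsetSum _ fun D _ => continuousOn_finsetSum _ fun E _ =>
      ((he D).mul (he E)).mul (h2 D E)

theorem integral_add_const_mul {α : Type*} [MeasurableSpace α] {μ : Measure α} {f g : α → ℝ}
    (hf : Integrable f μ) (hg : Integrable g μ) (a : ℝ) :
    Integrable (fun p => f p + a * g p) μ ∧
      ∫ p, f p ∂μ + a * ∫ p, g p ∂μ = ∫ p, (f p + a * g p) ∂μ := by
  refine ⟨hf.add (hg.const_mul a), ?_⟩
  rw [integral_add hf (hg.const_mul a), integral_const_mul]

/-- The retarded potential integrates `G` over the cone down to time zero against the inverse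
distance. With distance `p 0 * |x 0|`, volume element and inverse distance combine to `x 0 ^ 2`
times the weight of `coneAvg`. Here the product rule for `x 0 ^ 2` is combined with differentiation
under the integral. -/
theorem box_sq_mul_coneAvg {G : Scalar} {k : ℤ} (hG : IsHomog k G) {x : Mink}
    (hx : x ∈ spacelikeRegion) :
    box (fun y => y 0 * y 0 * coneAvg G y) x = ∫ p in coneBox, coneDensity G x p := by
  have hK : IsCompact coneBox := isCompact_Icc
  have hv := continuousOn_coneWeight
  have hL := continuous_conePt.continuousOn (s := coneBox)
  have hLU : ∀ p ∈ coneBox, ∀ x ∈ spacelikeRegion, conePt p x ∈ spacelikeRegion :=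
    fun p hp x hx => coneBox_mem hp hx
  have hI : IsHomog k (coneAvg G) := isHomog_linAvg hK hv hL hLU hG
  have hc := IsHomog.coord 0
  have h1 : ∀ C, ∀ y ∈ spacelikeRegion, pd (fun y => y 0 * y 0 * coneAvg G y) C y =
      2 * (if 0 = C then 1 else 0) * (y 0 * coneAvg G y) + y 0 * y 0 * pd (coneAvg G) C y := by
    intro C y hy
    rw [pd_mul ((hc.mul hc).diff hy) (hI.diff hy), pd_mul (hc.diff hy) (hc.diff hy), pd_coord]
    ring
  have h2 : ∀ C, pd (pd (fun y => y 0 * y 0 * coneAvg G y) C) C x =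
      (if 0 = C then 2 * coneAvg G x + 4 * x 0 * pd (coneAvg G) 0 x else 0)
      + x 0 ^ 2 * pd (pd (coneAvg G) C) C x := by
    intro C
    rw [pd_congr (h1 C) hx, pd_add (((hc.mul hI).const_mul _).diff hx)
      (((hc.mul hc).mul (hI.pd C)).diff hx), pd_const_mul ((hc.mul hI).diff hx),
      pd_mul (hc.diff hx) (hI.diff hx), pd_mul ((hc.mul hc).diff hx) ((hI.pd C).diff hx),
      pd_mul (hc.diff hx) (hc.diff hx), pd_coord]
    split_ifs with h
    · subst h; ring
    · ring
  have e1 : pd (coneAvg G) 0 x = _ := pd_linAvg_eq_integral hK hv hL hLU hG.smooth hx 0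
  have e2 : ∀ C, pd (pd (coneAvg G) C) C x = _ := fun C => pd_pd_linAvg hK hv hL hLU hG.smooth hx C C
  have h0 := continuousOn_comp_conePt hG.smooth hx
  have c1 := fun D => continuousOn_comp_conePt (hG.smooth.pd D) hx
  have c2 := fun D E => continuousOn_comp_conePt ((hG.smooth.pd D).pd E) hx
  have he := fun D C => (continuous_entry_conePt D C).continuousOn (s := coneBox)
  have i0 : IntegrableOn (fun p => p 0 * Real.sin (p 1) * G (conePt p x)) coneBox :=
    (hv.mul h0).integrableOn_compact hK
  have i1 : IntegrableOn (fun p => p 0 * Real.sin (p 1) *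
      ∑ D, entry conePt D 0 p * pd G D (conePt p x)) coneBox :=
    (hv.mul (continuousOn_finsetSum _ fun D _ => (he D 0).mul (c1 D))).integrableOn_compact hK
  have i2 : ∀ C, IntegrableOn (fun p => p 0 * Real.sin (p 1) *
      ∑ D, ∑ E, entry conePt D C p * entry conePt E C p * pd (pd G D) E (conePt p x)) coneBox :=
    fun C => (hv.mul (continuousOn_finsetSum _ fun D _ => continuousOn_finsetSum _ fun E _ =>
      ((he D C).mul (he E C)).mul (c2 D E))).integrableOn_compact hK
  have hsum : box (fun y => y 0 * y 0 * coneAvg G y) x =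
      (((-2 * coneAvg G x + -4 * x 0 * pd (coneAvg G) 0 x)
      + -x 0 ^ 2 * pd (pd (coneAvg G) 0) 0 x) + x 0 ^ 2 * pd (pd (coneAvg G) 1) 1 x
      + x 0 ^ 2 * pd (pd (coneAvg G) 2) 2 x) + x 0 ^ 2 * pd (pd (coneAvg G) 3) 3 x := by
    simp only [box, Fin.sum_univ_four, eta, h2]
    simp
    ring
  rw [hsum, e1, e2, e2, e2, e2, coneAvg, linAvg]
  obtain ⟨j1, r1⟩ := integral_add_const_mul (i0.const_mul (-2)) i1 (-4 * x 0)
  obtain ⟨j2, r2⟩ := integral_add_const_mul j1 (i2 0) (-x 0 ^ 2)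
  obtain ⟨j3, r3⟩ := integral_add_const_mul j2 (i2 1) (x 0 ^ 2)
  obtain ⟨j4, r4⟩ := integral_add_const_mul j3 (i2 2) (x 0 ^ 2)
  obtain ⟨j5, r5⟩ := integral_add_const_mul j4 (i2 3) (x 0 ^ 2)
  rw [← integral_const_mul, r1, r2, r3, r4, r5]
  refine setIntegral_congr_fun hK.measurableSet fun p _ => ?_
  have q : ∀ k : Fin 4, k ≠ 0 → ∑ D, ∑ E, entry conePt D k p * entry conePt E k p *
      pd (pd G D) E (conePt p x) = pd (pd G k) k (conePt p x) := fun k hk => by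
    simp [entry_conePt, hk]
  simp only [coneDensity]
  rw [q 1 (by decide), q 2 (by decide), q 3 (by decide)]
  ring

theorem fderiv_single_eq {f : (Fin 3 → ℝ) → ℝ} {p : Fin 3 → ℝ} (hf : DifferentiableAt ℝ f p)
    {i : Fin 3} {d : ℝ} (h : HasDerivAt (fun t => f (Function.update p i t)) d (p i)) :
    fderiv ℝ f p (Pi.single i 1) = d := by
  have h1 : HasDerivAt (fun t => Function.update p i t) (Pi.single i 1) (p i) :=
    hasDerivAt_update p i (p i)
  have h2 : HasFDerivAt f (fderiv ℝ f p) (Function.update p i (p i)) := by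
    rw [Function.update_eq_self]; exact hf.hasFDerivAt
  exact (h2.comp_hasDerivAt (p i) h1).unique h

theorem hasDerivAt_comp_curve {H : Scalar} (hH : SmoothOn H) {γ : ℝ → Mink} {γ' : Mink} {t : ℝ}
    (hγ : HasDerivAt γ γ' t) (hm : γ t ∈ spacelikeRegion) :
    HasDerivAt (fun s => H (γ s)) (∑ D, γ' D * pd H D (γ t)) t := by
  rw [← fderiv_apply_eq_sum]
  exact (hH.differentiableAt hm).hasFDerivAt.comp_hasDerivAt t hγ

/-- The flux of the retarded average along the light cone. -/
noncomputable def coneFluxRadial (t : ℝ) (g g0 g1 g2 g3 : (Fin 3 → ℝ) → ℝ) (p : Fin 3 → ℝ) : ℝ :=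
  Real.sin (p 1) * ((1 - p 0 ^ 2) * (g p + p 0 * t * (-g0 p + Real.cos (p 1) * g1 p
    + Real.sin (p 1) * Real.cos (p 2) * g2 p + Real.sin (p 1) * Real.sin (p 2) * g3 p))
    + 2 * (1 - p 0) * p 0 * t * g0 p)

/-- The flux of the retarded average along the meridians. -/
noncomputable def coneFluxTheta (t : ℝ) (g1 g2 g3 : (Fin 3 → ℝ) → ℝ) (p : Fin 3 → ℝ) : ℝ :=
  t * Real.sin (p 1) * (-Real.sin (p 1) * g1 p + Real.cos (p 1) * Real.cos (p 2) * g2 p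
    + Real.cos (p 1) * Real.sin (p 2) * g3 p)

/-- The flux of the retarded average along the circles of latitude. -/
noncomputable def coneFluxPhi (t : ℝ) (g2 g3 : (Fin 3 → ℝ) → ℝ) (p : Fin 3 → ℝ) : ℝ :=
  t * (-Real.sin (p 2) * g2 p + Real.cos (p 2) * g3 p)

section

variable {g g0 g1 g2 g3 : (Fin 3 → ℝ) → ℝ} {p : Fin 3 → ℝ} (t : ℝ)

theorem hasDerivAt_update_comp (hg : DifferentiableAt ℝ g p) (i : Fin 3) :
    HasDerivAt (fun s => g (Function.update p i s)) (fderiv ℝ g p (Pi.single i 1)) (p i) := by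
  have h2 : HasFDerivAt g (fderiv ℝ g p) (Function.update p i (p i)) := by
    rw [Function.update_eq_self]; exact hg.hasFDerivAt
  exact h2.comp_hasDerivAt (p i) (hasDerivAt_update p i (p i))

theorem fderiv_coneFluxRadial (hg : DifferentiableAt ℝ g p) (h0 : DifferentiableAt ℝ g0 p)
    (h1 : DifferentiableAt ℝ g1 p) (h2 : DifferentiableAt ℝ g2 p) (h3 : DifferentiableAt ℝ g3 p) :
    DifferentiableAt ℝ (coneFluxRadial t g g0 g1 g2 g3) p ∧
    fderiv ℝ (coneFluxRadial t g g0 g1 g2 g3) p (Pi.single 0 1) =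
      Real.sin (p 1) * (-2 * p 0 * (g p + p 0 * t * (-g0 p + Real.cos (p 1) * g1 p
      + Real.sin (p 1) * Real.cos (p 2) * g2 p + Real.sin (p 1) * Real.sin (p 2) * g3 p))
      + (1 - p 0 ^ 2) * (fderiv ℝ g p (Pi.single 0 1) + t * (-g0 p + Real.cos (p 1) * g1 p
        + Real.sin (p 1) * Real.cos (p 2) * g2 p + Real.sin (p 1) * Real.sin (p 2) * g3 p)
        + p 0 * t * (-fderiv ℝ g0 p (Pi.single 0 1)
        + Real.cos (p 1) * fderiv ℝ g1 p (Pi.single 0 1)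
        + Real.sin (p 1) * Real.cos (p 2) * fderiv ℝ g2 p (Pi.single 0 1)
        + Real.sin (p 1) * Real.sin (p 2) * fderiv ℝ g3 p (Pi.single 0 1)))
      + 2 * (1 - 2 * p 0) * t * g0 p
      + 2 * (1 - p 0) * p 0 * t * fderiv ℝ g0 p (Pi.single 0 1)) := by
  have hd : DifferentiableAt ℝ (coneFluxRadial t g g0 g1 g2 g3) p := by
    unfold coneFluxRadial; fun_prop
  refine ⟨hd, fderiv_single_eq hd ?_⟩
  have k := hasDerivAt_update_comp hg 0
  have k0 := hasDerivAt_update_comp h0 0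
  have k1 := hasDerivAt_update_comp h1 0
  have k2 := hasDerivAt_update_comp h2 0
  have k3 := hasDerivAt_update_comp h3 0
  have hid := hasDerivAt_id (p 0)
  have hN := ((k0.neg.add (k1.const_mul (Real.cos (p 1)))).add
    (k2.const_mul (Real.sin (p 1) * Real.cos (p 2)))).add
    (k3.const_mul (Real.sin (p 1) * Real.sin (p 2)))
  have := (((((hid.pow 2).const_sub 1).mul (k.add ((hid.mul_const t).mul hN))).add
    (((((hid.const_sub 1).const_mul 2).mul hid).mul_const t).mul k0))).const_mul (Real.sin (p 1))
  refine (this.congr_of_eventuallyEq (Filter.Eventually.of_forall fun s => ?_)).congr_deriv ?_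
  · simp [coneFluxRadial]
  · simp [-mul_eq_mul_left_iff]; ring

theorem fderiv_coneFluxTheta (h1 : DifferentiableAt ℝ g1 p) (h2 : DifferentiableAt ℝ g2 p)
    (h3 : DifferentiableAt ℝ g3 p) :
    DifferentiableAt ℝ (coneFluxTheta t g1 g2 g3) p ∧
    fderiv ℝ (coneFluxTheta t g1 g2 g3) p (Pi.single 1 1) =
      t * Real.cos (p 1) * (-Real.sin (p 1) * g1 p + Real.cos (p 1) * Real.cos (p 2) * g2 p
        + Real.cos (p 1) * Real.sin (p 2) * g3 p)
      + t * Real.sin (p 1) * (-Real.cos (p 1) * g1 p - Real.sin (p 1) * Real.cos (p 2) * g2 p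
        - Real.sin (p 1) * Real.sin (p 2) * g3 p
        - Real.sin (p 1) * fderiv ℝ g1 p (Pi.single 1 1)
        + Real.cos (p 1) * Real.cos (p 2) * fderiv ℝ g2 p (Pi.single 1 1)
        + Real.cos (p 1) * Real.sin (p 2) * fderiv ℝ g3 p (Pi.single 1 1)) := by
  have hd : DifferentiableAt ℝ (coneFluxTheta t g1 g2 g3) p := by
    unfold coneFluxTheta; fun_prop
  refine ⟨hd, fderiv_single_eq hd ?_⟩
  have k1 := hasDerivAt_update_comp h1 1
  have k2 := hasDerivAt_update_comp h2 1
  have k3 := hasDerivAt_update_comp h3 1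
  have hs := Real.hasDerivAt_sin (p 1)
  have hc := Real.hasDerivAt_cos (p 1)
  have := (hs.const_mul t).mul (((hs.neg.mul k1).add ((hc.mul_const (Real.cos (p 2))).mul k2)).add
    ((hc.mul_const (Real.sin (p 2))).mul k3))
  refine (this.congr_of_eventuallyEq (Filter.Eventually.of_forall fun s => ?_)).congr_deriv ?_
  · simp [coneFluxTheta]
  · simp [-mul_eq_mul_left_iff]; ring

theorem fderiv_coneFluxPhi (h2 : DifferentiableAt ℝ g2 p) (h3 : DifferentiableAt ℝ g3 p) :
    DifferentiableAt ℝ (coneFluxPhi t g2 g3) p ∧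
    fderiv ℝ (coneFluxPhi t g2 g3) p (Pi.single 2 1) =
      t * (-Real.cos (p 2) * g2 p - Real.sin (p 2) * g3 p
        - Real.sin (p 2) * fderiv ℝ g2 p (Pi.single 2 1)
        + Real.cos (p 2) * fderiv ℝ g3 p (Pi.single 2 1)) := by
  have hd : DifferentiableAt ℝ (coneFluxPhi t g2 g3) p := by
    unfold coneFluxPhi; fun_prop
  refine ⟨hd, fderiv_single_eq hd ?_⟩
  have k2 := hasDerivAt_update_comp h2 2
  have k3 := hasDerivAt_update_comp h3 2
  have hs := Real.hasDerivAt_sin (p 2)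
  have hc := Real.hasDerivAt_cos (p 2)
  have := ((hs.neg.mul k2).add (hc.mul k3)).const_mul t
  refine (this.congr_of_eventuallyEq (Filter.Eventually.of_forall fun s => ?_)).congr_deriv ?_
  · simp [coneFluxPhi]
  · simp [-mul_eq_mul_left_iff]; ring

end

theorem differentiableAt_comp_conePt {H : Scalar} (hH : SmoothOn H) {x : Mink}
    (hx : x ∈ spacelikeRegion) {p : Fin 3 → ℝ} (hp : p ∈ coneBox) :
    DifferentiableAt ℝ (fun p => H (conePt p x)) p :=
  (hH.differentiableAt (coneBox_mem hp hx)).comp p ((contDiff_conePt x).differentiable (by simp) p)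

theorem fderiv_comp_conePt {H : Scalar} (hH : SmoothOn H) {x : Mink}
    (hx : x ∈ spacelikeRegion) {p : Fin 3 → ℝ} (hp : p ∈ coneBox) :
    fderiv ℝ (fun p => H (conePt p x)) p (Pi.single 0 1) =
      x 0 * (-pd H 0 (conePt p x) + Real.cos (p 1) * pd H 1 (conePt p x)
        + Real.sin (p 1) * Real.cos (p 2) * pd H 2 (conePt p x)
        + Real.sin (p 1) * Real.sin (p 2) * pd H 3 (conePt p x)) ∧
    fderiv ℝ (fun p => H (conePt p x)) p (Pi.single 1 1) =
      p 0 * x 0 * (-Real.sin (p 1) * pd H 1 (conePt p x)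
        + Real.cos (p 1) * Real.cos (p 2) * pd H 2 (conePt p x)
        + Real.cos (p 1) * Real.sin (p 2) * pd H 3 (conePt p x)) ∧
    fderiv ℝ (fun p => H (conePt p x)) p (Pi.single 2 1) =
      p 0 * x 0 * Real.sin (p 1) * (-Real.sin (p 2) * pd H 2 (conePt p x)
        + Real.cos (p 2) * pd H 3 (conePt p x)) := by
  have hd := differentiableAt_comp_conePt hH hx hp
  have hm := coneBox_mem hp hx
  have hu : ∀ i, conePt (Function.update p i (p i)) x ∈ spacelikeRegion := fun i => by
    rwa [Function.update_eq_self]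
  refine ⟨fderiv_single_eq hd ?_, fderiv_single_eq hd ?_, fderiv_single_eq hd ?_⟩
  · have hγ : HasDerivAt (fun s => conePt (Function.update p 0 s) x)
        (x 0 • nullVec (p 1) (p 2)) (p 0) := by
      simp only [conePt_eq]
      simpa using (((hasDerivAt_id (p 0)).mul_const (x 0)).smul_const
        (nullVec (p 1) (p 2))).const_add x
    refine (hasDerivAt_comp_curve hH hγ (hu 0)).congr_deriv ?_
    simp [Fin.sum_univ_four, nullVec]; ring
  · have hn : HasDerivAt (fun s => nullVec s (p 2)) (![0, -Real.sin (p 1),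
        Real.cos (p 1) * Real.cos (p 2), Real.cos (p 1) * Real.sin (p 2)] : Mink) (p 1) := by
      refine hasDerivAt_pi.2 fun D => ?_
      fin_cases D <;> simp [nullVec]
      · exact hasDerivAt_const _ _
      · exact Real.hasDerivAt_cos _
      · exact (Real.hasDerivAt_sin _).mul_const _
      · exact (Real.hasDerivAt_sin _).mul_const _
    have hγ : HasDerivAt (fun s => conePt (Function.update p 1 s) x)
        ((p 0 * x 0) • (![0, -Real.sin (p 1),
        Real.cos (p 1) * Real.cos (p 2), Real.cos (p 1) * Real.sin (p 2)] : Mink)) (p 1) := by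
      simp only [conePt_eq]
      simpa using (hn.const_smul (p 0 * x 0)).const_add x
    refine (hasDerivAt_comp_curve hH hγ (hu 1)).congr_deriv ?_
    simp [Fin.sum_univ_four]; ring
  · have hn : HasDerivAt (fun s => nullVec (p 1) s) (![0, 0,
        Real.sin (p 1) * -Real.sin (p 2), Real.sin (p 1) * Real.cos (p 2)] : Mink) (p 2) := by
      refine hasDerivAt_pi.2 fun D => ?_
      fin_cases D <;> simp only [nullVec]
      · exact hasDerivAt_const _ _
      · exact hasDerivAt_const _ _
      · exact (Real.hasDerivAt_cos _).const_mul _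
      · exact (Real.hasDerivAt_sin _).const_mul _
    have hγ : HasDerivAt (fun s => conePt (Function.update p 2 s) x)
        ((p 0 * x 0) • (![0, 0,
        Real.sin (p 1) * -Real.sin (p 2), Real.sin (p 1) * Real.cos (p 2)] : Mink)) (p 2) := by
      simp only [conePt_eq]
      simpa using (hn.const_smul (p 0 * x 0)).const_add x
    refine (hasDerivAt_comp_curve hH hγ (hu 2)).congr_deriv ?_
    simp [Fin.sum_univ_four]; ring

/-- The three flux components of the retarded average. -/
noncomputable def coneFlux (G : Scalar) (x : Mink) : Fin 3 → (Fin 3 → ℝ) → ℝ :=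
  ![coneFluxRadial (x 0) (fun p => G (conePt p x)) (fun p => pd G 0 (conePt p x))
      (fun p => pd G 1 (conePt p x)) (fun p => pd G 2 (conePt p x)) (fun p => pd G 3 (conePt p x)),
    coneFluxTheta (x 0) (fun p => pd G 1 (conePt p x)) (fun p => pd G 2 (conePt p x))
      (fun p => pd G 3 (conePt p x)),
    coneFluxPhi (x 0) (fun p => pd G 2 (conePt p x)) (fun p => pd G 3 (conePt p x))]

theorem differentiableAt_coneFlux {G : Scalar} (hG : SmoothOn G) {x : Mink}
    (hx : x ∈ spacelikeRegion) {p : Fin 3 → ℝ} (hp : p ∈ coneBox) (i : Fin 3) :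
    DifferentiableAt ℝ (coneFlux G x i) p := by
  have hd := differentiableAt_comp_conePt hG hx hp
  have hD := fun D => differentiableAt_comp_conePt (hG.pd D) hx hp
  fin_cases i
  · exact (fderiv_coneFluxRadial (x 0) hd (hD 0) (hD 1) (hD 2) (hD 3)).1
  · exact (fderiv_coneFluxTheta (x 0) (hD 1) (hD 2) (hD 3)).1
  · exact (fderiv_coneFluxPhi (x 0) (hD 2) (hD 3)).1

/-- The integrand becomes an exact divergence in the cone parameters. After the chain rule and the
reordering of mixed second derivatives of `G`, the two sides differ only by multiples of `sin² +
cos² = 1` in the two angles. -/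
theorem divergence_coneFlux {G : Scalar} (hG : SmoothOn G) {x : Mink}
    (hx : x ∈ spacelikeRegion) {p : Fin 3 → ℝ} (hp : p ∈ coneBox) :
    ∑ i, fderiv ℝ (coneFlux G x i) p (Pi.single i 1) = coneDensity G x p := by
  have hd := differentiableAt_comp_conePt hG hx hp
  have hD := fun D => differentiableAt_comp_conePt (hG.pd D) hx hp
  have k := fderiv_comp_conePt hG hx hp
  have kD := fun D => fderiv_comp_conePt (hG.pd D) hx hp
  have hm := coneBox_mem hp hx
  rw [Fin.sum_univ_three]
  simp only [coneFlux, Matrix.cons_val]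
  rw [(fderiv_coneFluxRadial (x 0) hd (hD 0) (hD 1) (hD 2) (hD 3)).2,
    (fderiv_coneFluxTheta (x 0) (hD 1) (hD 2) (hD 3)).2,
    (fderiv_coneFluxPhi (x 0) (hD 2) (hD 3)).2, k.1]
  simp only [(kD _).1, (kD _).2.1, (kD _).2.2]
  simp only [coneDensity, entry_conePt, Fin.sum_univ_four, nullVec]
  rw [pd_comm hG hm 1 0, pd_comm hG hm 2 0, pd_comm hG hm 3 0, pd_comm hG hm 2 1,
    pd_comm hG hm 3 1, pd_comm hG hm 3 2]
  simp
  have h1 := Real.sin_sq_add_cos_sq (p 1)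
  have h2 := Real.sin_sq_add_cos_sq (p 2)
  generalize Real.sin (p 1) = s at *
  generalize Real.cos (p 1) = c at *
  generalize Real.sin (p 2) = S at *
  generalize Real.cos (p 2) = C at *
  generalize p 0 = σ at *
  generalize pd (pd G 1) 1 (conePt p x) = G11 at *
  generalize pd (pd G 2) 2 (conePt p x) = G22 at *
  generalize pd (pd G 3) 3 (conePt p x) = G33 at *
  generalize pd (pd G 2) 3 (conePt p x) = G23 at *
  generalize pd G 2 (conePt p x) = G2 at *
  generalize pd G 3 (conePt p x) = G3 at *
  linear_combination (σ * x 0 ^ 2 * s * (G11 + C ^ 2 * G22 + S ^ 2 * G33 + 2 * S * C * G23)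
    + x 0 * C * G2 + x 0 * S * G3) * h1 + σ * x 0 ^ 2 * s * (G22 + G33) * h2

theorem integral_face : ∫ q in Icc (0 : Fin 2 → ℝ) ![Real.pi, 2 * Real.pi], Real.sin (q 0) =
    4 * Real.pi := by
  have h1 : (Icc (0 : Fin 2 → ℝ) ![Real.pi, 2 * Real.pi]) =
      Set.pi univ fun i => Icc (0 : ℝ) ((![Real.pi, 2 * Real.pi] : Fin 2 → ℝ) i) :=
    (Set.pi_univ_Icc _ _).symm
  rw [h1, volume_pi, Measure.restrict_pi_pi]
  have := integral_fintype_prod_eq_prod (𝕜 := ℝ) (fun i : Fin 2 => ![Real.sin, fun _ => 1] i)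
    (μ := fun i : Fin 2 => volume.restrict (Icc (0 : ℝ) ((![Real.pi, 2 * Real.pi] : Fin 2 → ℝ) i)))
  simp [Fin.prod_univ_two] at this
  rw [this, integral_Icc_eq_integral_Ioc, ← intervalIntegral.integral_of_le Real.pi_nonneg]
  simp [Real.pi_nonneg]
  ring

/-- By the divergence theorem only faces of the box matter. The radial flux vanishes at the base of
the cone and equals `sin θ * G x` at the apex, the meridian flux vanishes at both poles, and the two
azimuthal faces cancel by periodicity. -/
theorem integral_coneDensity {G : Scalar} (hG : SmoothOn G) {x : Mink}
    (hx : x ∈ spacelikeRegion) : ∫ p in coneBox, coneDensity G x p = -(4 * Real.pi) * G x := by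
  have hle : (0 : Fin 3 → ℝ) ≤ ![1, Real.pi, 2 * Real.pi] := by
    intro i; fin_cases i <;> simp [Real.pi_nonneg]
  have hsub : ∀ p ∈ (Set.pi univ fun i => Ioo ((0 : Fin 3 → ℝ) i)
      ((![1, Real.pi, 2 * Real.pi] : Fin 3 → ℝ) i)), p ∈ coneBox := fun p hp =>
    ⟨fun i => (hp i trivial).1.le, fun i => (hp i trivial).2.le⟩
  have key := integral_divergence_of_hasFDerivAt_off_countable' (0 : Fin 3 → ℝ)
    ![1, Real.pi, 2 * Real.pi] hle (coneFlux G x) (fun i => fderiv ℝ (coneFlux G x i)) ∅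
    countable_empty
    (fun i p hp => (differentiableAt_coneFlux hG hx hp i).continuousAt.continuousWithinAt)
    (fun p hp i => (differentiableAt_coneFlux hG hx (hsub p hp.1) i).hasFDerivAt)
    (((continuousOn_coneDensity hG hx).congr fun p hp =>
      divergence_coneFlux hG hx hp).integrableOn_compact isCompact_Icc)
  have hc : ∫ p in coneBox, coneDensity G x p =
      ∫ p in coneBox, ∑ i, fderiv ℝ (coneFlux G x i) p (Pi.single i 1) :=
    setIntegral_congr_fun measurableSet_Icc fun p hp => (divergence_coneFlux hG hx hp).symm
  rw [hc]
  refine key.trans ?_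
  have e0 : ∀ (a : ℝ) (q : Fin 2 → ℝ), (Fin.insertNth (0 : Fin 3) a q : Fin 3 → ℝ) 0 = a ∧
      (Fin.insertNth (0 : Fin 3) a q : Fin 3 → ℝ) 1 = q 0 := fun a q => ⟨rfl, rfl⟩
  have e1 : ∀ (a : ℝ) (q : Fin 2 → ℝ), (Fin.insertNth (1 : Fin 3) a q : Fin 3 → ℝ) 1 = a :=
    fun a q => rfl
  have e2 : ∀ (a : ℝ) (q : Fin 2 → ℝ), (Fin.insertNth (2 : Fin 3) a q : Fin 3 → ℝ) 0 = q 0 ∧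
      (Fin.insertNth (2 : Fin 3) a q : Fin 3 → ℝ) 1 = q 1 ∧
      (Fin.insertNth (2 : Fin 3) a q : Fin 3 → ℝ) 2 = a := fun a q => ⟨rfl, rfl, rfl⟩
  have hper : ∀ q : Fin 2 → ℝ, conePt ((2 : Fin 3).insertNth (2 * Real.pi) q) x =
      conePt ((2 : Fin 3).insertNth 0 q) x := fun q => by
    simp only [conePt_eq, nullVec, (e2 _ _).1, (e2 _ _).2.1, (e2 _ _).2.2]
    simp
  have f2 : ∀ q : Fin 2 → ℝ, coneFlux G x 2 ((2 : Fin 3).insertNth (2 * Real.pi) q) =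
      coneFlux G x 2 ((2 : Fin 3).insertNth 0 q) := fun q => by
    simp only [coneFlux, Matrix.cons_val, coneFluxPhi, hper, (e2 _ _).2.2]
    simp
  have f1 : ∀ a q, Real.sin a = 0 → coneFlux G x 1 ((1 : Fin 3).insertNth a q) = 0 :=
    fun a q ha => by
    simp only [coneFlux, Matrix.cons_val, coneFluxTheta, e1, ha]
    simp
  have f0 : ∀ q, coneFlux G x 0 ((0 : Fin 3).insertNth 1 q) = 0 := fun q => by
    simp only [coneFlux, Matrix.cons_val, coneFluxRadial, (e0 _ _).1, (e0 _ _).2]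
    simp
  have f0' : ∀ q : Fin 2 → ℝ, coneFlux G x 0 ((0 : Fin 3).insertNth 0 q) = Real.sin (q 0) * G x :=
    fun q => by
    have : conePt ((0 : Fin 3).insertNth 0 q) x = x := by
      rw [conePt_eq, (e0 _ _).1]; simp
    simp only [coneFlux, Matrix.cons_val, coneFluxRadial, (e0 _ _).1, (e0 _ _).2, this]
    simp
  have hface : (![1, Real.pi, 2 * Real.pi] : Fin 3 → ℝ) ∘ (0 : Fin 3).succAbove =
      ![Real.pi, 2 * Real.pi] := by
    ext i; fin_cases i <;> rfl
  rw [Fin.sum_univ_three]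
  simp only [Matrix.cons_val, Pi.zero_apply, f2, f1 _ _ Real.sin_zero, f1 _ _ Real.sin_pi, f0, f0',
    sub_self, integral_zero, add_zero, zero_sub, hface]
  have hz : (0 : Fin 3 → ℝ) ∘ (0 : Fin 3).succAbove = (0 : Fin 2 → ℝ) := rfl
  rw [hz, integral_mul_const, integral_face]
  ring

/-- The flat wave equation has a homogeneous solution. -/
theorem exists_box_eq {G : Scalar} (hG : IsHomog (-1) G) :
    ∃ F, IsHomog 1 F ∧ ∀ x ∈ spacelikeRegion, box F x = G x := by
  have hc := IsHomog.coord 0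
  have hI : IsHomog (-1) (coneAvg G) := isHomog_linAvg isCompact_Icc continuousOn_coneWeight
    continuous_conePt.continuousOn (fun p hp x hx => coneBox_mem hp hx) hG
  -- The factor `x 0 ^ 2` raises the degree from -1 to 1.
  have hF : IsHomog 1 fun y => y 0 * y 0 * coneAvg G y := ((hc.mul hc).mul hI).of_eq (by norm_num)
  refine ⟨fun y => -(4 * Real.pi)⁻¹ * (y 0 * y 0 * coneAvg G y), hF.const_mul _, fun x hx => ?_⟩
  have h : box (fun y => -(4 * Real.pi)⁻¹ * (y 0 * y 0 * coneAvg G y)) x =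
      -(4 * Real.pi)⁻¹ * box (fun y => y 0 * y 0 * coneAvg G y) x := by
    simp only [box, Finset.mul_sum]
    refine Finset.sum_congr rfl fun A _ => ?_
    rw [pd_congr (fun y hy => pd_const_mul (hF.diff hy) _ A) hx,
      pd_const_mul ((hF.pd A).diff hx)]
    ring
  rw [h, box_sq_mul_coneAvg hG hx, integral_coneDensity hG.smooth hx]
  have := Real.pi_ne_zero
  field_simp

/-! ### Covariant operators through homogeneous extensions -/

theorem sum_mul_eta (x : Mink) (hx : x ∈ dS3) : ∑ A, x A * (eta A * x A) = 1 := by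
  have : mink x x = 1 := hx
  rw [← this, mink]
  exact Finset.sum_congr rfl fun A _ => by ring

theorem eta_mul_eta (A : Fin 4) : eta A * eta A = 1 := by
  unfold eta; split_ifs <;> norm_num

/-- The Leibniz rule for the contraction with the position vector. -/
theorem sum_mul_pd {a : Fin 4 → Scalar} (ha : ∀ B, SmoothOn (a B))
    (h : ∀ x ∈ spacelikeRegion, ∑ B, x B * a B x = 0) {x : Mink} (hx : x ∈ spacelikeRegion)
    (C : Fin 4) : ∑ B, x B * pd (a B) C x = - a C x := by
  have h1 : pd (fun y => ∑ B, y B * a B y) C x = 0 := by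
    rw [pd_congr (g := fun _ => 0) h hx, pd_const]
  have hd : ∀ B, DifferentiableAt ℝ (fun y : Mink => y B) x := fun B => by fun_prop
  have hm : ∀ B, DifferentiableAt ℝ (fun y : Mink => y B * a B y) x := fun B =>
    (hd B).mul ((ha B).differentiableAt hx)
  rw [pd_sum fun B _ => hm B] at h1
  simp only [pd_mul (hd _) ((ha _).differentiableAt hx), pd_coord, Finset.sum_add_distrib] at h1
  simp at h1
  linarith

/-- A homogeneous extension of a tangential tensor field. -/
structure IsExtension (k : ℤ) (S : Fin 4 → Fin 4 → Scalar) (T : Tensor) : Prop where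
  homog : ∀ A B, IsHomog k (S A B)
  eq : ∀ x ∈ dS3, ∀ A B, T x A B = S A B x
  symm : ∀ x ∈ spacelikeRegion, ∀ A B, S A B x = S B A x
  tangent : ∀ x ∈ spacelikeRegion, ∀ A, ∑ B, x B * S A B x = 0

namespace IsExtension

variable {k : ℤ} {S : Fin 4 → Fin 4 → Scalar} {T : Tensor}

theorem tangent' (h : IsExtension k S T) {x : Mink} (hx : x ∈ spacelikeRegion) (B : Fin 4) :
    ∑ A, x A * S A B x = 0 := by
  rw [← h.tangent x hx B]
  exact Finset.sum_congr rfl fun A _ => by rw [h.symm x hx]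

theorem pd_symm (h : IsExtension k S T) {x : Mink} (hx : x ∈ spacelikeRegion) (A B C : Fin 4) :
    pd (S A B) C x = pd (S B A) C x := pd_congr (fun y hy => h.symm y hy A B) hx C

theorem sum_pd (h : IsExtension k S T) {x : Mink} (hx : x ∈ spacelikeRegion) (A C : Fin 4) :
    ∑ B, x B * pd (S A B) C x = - S A C x :=
  sum_mul_pd (fun B => (h.homog A B).smooth) (fun y hy => h.tangent y hy A) hx C

theorem covDeriv_eq (h : IsExtension k S T) {x : Mink} (hx : x ∈ dS3) (C A B : Fin 4) :
    covDeriv T x C A B = ∑ A', ∑ B', proj x A A' * proj x B B' *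
      (pd (S A' B') C x - k * (eta C * x C) * S A' B' x) := by
  unfold covDeriv
  refine Finset.sum_congr rfl fun A' _ => Finset.sum_congr rfl fun B' _ => ?_
  rw [grad_eq (h.homog A' B') (fun y hy => h.eq y hy A' B') hx]

theorem sum_proj (x : Mink) (A : Fin 4) (v : Fin 4 → ℝ) :
    ∑ B, proj x A B * v B = v A - eta A * x A * ∑ B, x B * v B := by
  simp only [proj, sub_mul, Finset.sum_sub_distrib, Finset.mul_sum]
  simp [mul_assoc]

/-- The degree `k` drops out because its correction is proportional to the position vector, which
contracts to zero with `S`. Projecting the free index removes the radial part of the flat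
divergence, and differentiating tangency shows that this part is minus the trace. -/
theorem divergence_eq (h : IsExtension k S T) {x : Mink} (hx : x ∈ dS3) (A : Fin 4) :
    divergence T x A = ∑ B, eta B * pd (S A B) B x + eta A * x A * ∑ B, eta B * S B B x := by
  have hxU := dS3_subset_region hx
  have hm := sum_mul_eta x hx
  have e1 : ∀ A B, ∑ B', proj x B B' * (pd (S A B') B x - k * (eta B * x B) * S A B' x) =
      pd (S A B) B x - k * (eta B * x B) * S A B x + eta B * x B * S A B x := fun A B => by
    rw [sum_proj]
    have q1 := h.sum_pd hxU A B
    have q2 := h.tangent x hxU A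
    have : ∑ B', x B' * (pd (S A B') B x - k * (eta B * x B) * S A B' x) = - S A B x := by
      calc _ = ∑ B', x B' * pd (S A B') B x - k * (eta B * x B) * ∑ B', x B' * S A B' x := by
            rw [Finset.mul_sum, ← Finset.sum_sub_distrib]
            exact Finset.sum_congr rfl fun _ _ => by ring
        _ = _ := by rw [q1, q2]; ring
    rw [this]; ring
  have e2 : ∀ A', ∑ B, eta B * ∑ B', proj x B B' *
      (pd (S A' B') B x - k * (eta B * x B) * S A' B' x) = ∑ B, eta B * pd (S A' B) B x := by
    intro A'
    have q2 := h.tangent x hxU A'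
    simp only [e1]
    calc _ = ∑ B, eta B * pd (S A' B) B x + (1 - k) * ∑ B, x B * S A' B x := by
          rw [Finset.mul_sum, ← Finset.sum_add_distrib]
          exact Finset.sum_congr rfl fun B _ => by
            linear_combination ((1 - k) * x B * S A' B x) * eta_mul_eta B
      _ = _ := by rw [q2]; ring
  have e3 : divergence T x A = ∑ A', proj x A A' * ∑ B, eta B * pd (S A' B) B x := by
    simp only [← e2, divergence, h.covDeriv_eq hx, Finset.mul_sum]
    rw [Finset.sum_comm]
    exact Finset.sum_congr rfl fun _ _ => Finset.sum_congr rfl fun _ _ =>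
      Finset.sum_congr rfl fun _ _ => by ring
  rw [e3, sum_proj]
  have e4 : ∑ A', x A' * ∑ B, eta B * pd (S A' B) B x = - ∑ B, eta B * S B B x := by
    simp only [Finset.mul_sum]
    rw [Finset.sum_comm, ← Finset.sum_neg_distrib]
    refine Finset.sum_congr rfl fun B _ => ?_
    have := h.sum_pd hxU B B
    rw [← mul_neg, ← this, Finset.mul_sum]
    exact Finset.sum_congr rfl fun A' _ => by rw [h.pd_symm hxU A' B]; ring
  rw [e4]; ring

theorem sum_eps_mul_left (x : Mink) (A D : Fin 4) : ∑ C, eps x A C D * x C = 0 := by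
  simp only [eps, vol_eq, Fin.sum_univ_four, Pi.single_apply]
  fin_cases A <;> fin_cases D <;> simp <;> ring

theorem eps_antisymm (x : Mink) (A C D : Fin 4) : eps x A D C = - eps x A C D := by
  simp only [eps, vol_eq]; ring

theorem sum_eps_mul_right (x : Mink) (A C : Fin 4) : ∑ D, eps x A C D * x D = 0 := by
  simp only [eps_antisymm x A _ C, neg_mul, Finset.sum_neg_distrib, sum_eps_mul_left, neg_zero]

/-- The projections and the degree correction add to the flat derivative two terms along the
position vector in an antisymmetrized index, which `eps` annihilates, and one proportional to `S D
C`, which is symmetric in the antisymmetrized pair. -/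
theorem curl_eq (h : IsExtension k S T) {x : Mink} (hx : x ∈ dS3) (A B : Fin 4) :
    curl T x A B = ∑ C, ∑ D, eps x A C D * eta C * eta D * pd (S D B) C x := by
  have hxU := dS3_subset_region hx
  have e1 : ∀ C D, covDeriv T x C D B = pd (S D B) C x + eta B * x B * S D C x +
      eta C * x C * (-k * S D B x) + eta D * x D * S C B x := by
    intro C D
    rw [h.covDeriv_eq hx]
    have hin : ∀ D', ∑ B', proj x D D' * proj x B B' *
        (pd (S D' B') C x - k * (eta C * x C) * S D' B' x) = proj x D D' *
        (pd (S D' B) C x - k * (eta C * x C) * S D' B x + eta B * x B * S D' C x) := fun D' => by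
      have q1 := h.sum_pd hxU D' C
      have q2 := h.tangent x hxU D'
      have q3 := sum_proj x B (fun B' => pd (S D' B') C x - k * (eta C * x C) * S D' B' x)
      have : ∑ B', x B' * (pd (S D' B') C x - k * (eta C * x C) * S D' B' x) = - S D' C x := by
        calc _ = ∑ B', x B' * pd (S D' B') C x - k * (eta C * x C) * ∑ B', x B' * S D' B' x := by
              rw [Finset.mul_sum, ← Finset.sum_sub_distrib]
              exact Finset.sum_congr rfl fun _ _ => by ring
          _ = _ := by rw [q1, q2]; ring
      rw [this] at q3
      simp only [mul_assoc (proj x D D'), ← Finset.mul_sum, q3]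
      ring
    simp only [hin, sum_proj]
    have q1 : ∑ D', x D' * pd (S D' B) C x = - S C B x := by
      rw [h.symm x hxU C B, ← h.sum_pd hxU B C]
      exact Finset.sum_congr rfl fun D' _ => by rw [h.pd_symm hxU D' B]
    have : ∑ D', x D' * (pd (S D' B) C x - k * (eta C * x C) * S D' B x + eta B * x B * S D' C x)
        = - S C B x := by
      calc _ = ∑ D', x D' * pd (S D' B) C x - k * (eta C * x C) * ∑ D', x D' * S D' B x
            + eta B * x B * ∑ D', x D' * S D' C x := by
            rw [Finset.mul_sum, Finset.mul_sum, ← Finset.sum_sub_distrib, ← Finset.sum_add_distrib]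
            exact Finset.sum_congr rfl fun _ _ => by ring
        _ = _ := by rw [q1, h.tangent' hxU, h.tangent' hxU]; ring
    rw [this]; ring
  have s1 : ∑ C, ∑ D, eps x A C D * eta C * eta D * S D C x = 0 := by
    have : ∑ C, ∑ D, eps x A C D * eta C * eta D * S D C x =
        - ∑ C, ∑ D, eps x A C D * eta C * eta D * S D C x := by
      conv_lhs => rw [Finset.sum_comm]
      simp only [← Finset.sum_neg_distrib]
      refine Finset.sum_congr rfl fun C _ => Finset.sum_congr rfl fun D _ => ?_
      rw [eps_antisymm, h.symm x hxU C D]; ring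
    linarith
  have s2 : ∑ C, ∑ D, eps x A C D * eta C * eta D * (eta C * x C * (-k * S D B x)) = 0 := by
    rw [Finset.sum_comm]
    refine Finset.sum_eq_zero fun D _ => ?_
    calc _ = (eta D * -k * S D B x) * ∑ C, eps x A C D * x C := by
          rw [Finset.mul_sum]
          exact Finset.sum_congr rfl fun C _ => by
            linear_combination (eps x A C D * eta D * x C * (-k * S D B x)) * eta_mul_eta C
      _ = 0 := by rw [sum_eps_mul_left, mul_zero]
  have s3 : ∑ C, ∑ D, eps x A C D * eta C * eta D * (eta D * x D * S C B x) = 0 := by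
    refine Finset.sum_eq_zero fun C _ => ?_
    calc _ = (eta C * S C B x) * ∑ D, eps x A C D * x D := by
          rw [Finset.mul_sum]
          exact Finset.sum_congr rfl fun D _ => by
            linear_combination (eps x A C D * eta C * x D * S C B x) * eta_mul_eta D
      _ = 0 := by rw [sum_eps_mul_right, mul_zero]
  unfold curl
  simp only [e1]
  calc _ = ∑ C, ∑ D, eps x A C D * eta C * eta D * pd (S D B) C x
        + eta B * x B * ∑ C, ∑ D, eps x A C D * eta C * eta D * S D C x
        + ∑ C, ∑ D, eps x A C D * eta C * eta D * (eta C * x C * (-k * S D B x))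
        + ∑ C, ∑ D, eps x A C D * eta C * eta D * (eta D * x D * S C B x) := by
        simp only [Finset.mul_sum, ← Finset.sum_add_distrib]
        exact Finset.sum_congr rfl fun _ _ => Finset.sum_congr rfl fun _ _ => by ring
    _ = _ := by rw [s1, s2, s3]; ring

end IsExtension

/-- On the hyperboloid, `D D f + h f` is the Hessian of the extension of degree one. -/
theorem potentialTensor_eq {f F : Scalar} (hF : IsHomog 1 F) (h : ∀ x ∈ dS3, f x = F x) {x : Mink}
    (hx : x ∈ dS3) (A B : Fin 4) : potentialTensor f x A B = pd (pd F A) B x := by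
  have hxU := dS3_subset_region hx
  have hm := sum_mul_eta x hx
  -- The power of `rad` equals 1 on the hyperboloid and makes this extension of the gradient
  -- homogeneous of degree zero, so that `grad_eq` applies a second time.
  have hw : ∀ A', IsHomog 0 fun y => pd F A' y - eta A' * (y A' * (rad y ^ (-2 : ℤ) * F y)) :=
    fun A' => ((hF.pd A').of_eq (by norm_num)).sub ((((IsHomog.coord A').mul
      ((isHomog_zpow_rad (-2)).mul hF)).of_eq (by norm_num)).const_mul _)
  have hg : ∀ A' C, grad (fun y => grad f y A') x C = pd (pd F A') C x
      - eta A' * ((if A' = C then F x else 0) + x A' * (pd F C x - 2 * (eta C * x C) * F x)) := by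
    intro A' C
    have hr := isHomog_zpow_rad (-2)
    rw [grad_eq (hw A') (fun y hy => by
      rw [grad_eq hF h hy, rad_eq_one hy]; simp; ring) hx]
    rw [pd_sub ((hF.pd A').diff hxU) ((((IsHomog.coord A').mul (hr.mul hF)).const_mul _).diff hxU),
      pd_const_mul (((IsHomog.coord A').mul (hr.mul hF)).diff hxU),
      pd_mul ((IsHomog.coord A').diff hxU) ((hr.mul hF).diff hxU), pd_coord,
      pd_mul (hr.diff hxU) (hF.diff hxU), pd_zpow_rad hxU, rad_eq_one hx]
    split_ifs <;> simp [-mul_eq_mul_left_iff] <;> ring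
  unfold potentialTensor covDerivCovector
  simp only [hg, IsExtension.sum_proj]
  have e : ∑ B', x B' * pd (pd F B') A x = 0 := by
    have := (hF.pd A).euler hxU
    norm_num at this
    rw [← this]
    exact Finset.sum_congr rfl fun B' _ => by rw [pd_comm hF.smooth hxU]
  have e2 : ∑ B', x B' * (eta B' * if B' = A then F x else 0) = x A * eta A * F x := by
    simp [mul_assoc]
  have key : ∑ B', x B' * (pd (pd F B') A x
      - eta B' * ((if B' = A then F x else 0) + x B' * (pd F A x - 2 * (eta A * x A) * F x))) =
      - (x A * eta A * F x) - (pd F A x - 2 * (eta A * x A) * F x) := by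
    calc _ = ∑ B', x B' * pd (pd F B') A x - ∑ B', x B' * (eta B' * if B' = A then F x else 0)
          - (∑ B', x B' * (eta B' * x B')) * (pd F A x - 2 * (eta A * x A) * F x) := by
          rw [Finset.sum_mul, ← Finset.sum_sub_distrib, ← Finset.sum_sub_distrib]
          exact Finset.sum_congr rfl fun _ _ => by ring
      _ = _ := by rw [e, e2, hm]; ring
  rw [key, h x hx, metric, pd_comm hF.smooth hxU A B]
  by_cases hAB : A = B
  · subst hAB; simp; ring
  · simp [hAB, Ne.symm hAB]; ring

/-! ### SDT tensors on the spacelike region and their symmetric potentials -/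

/-- Homogeneous tangential symmetric traceless divergence-free tensor fields on the spacelike
region. -/
structure IsHomSDT (k : ℤ) (S : Fin 4 → Fin 4 → Scalar) : Prop where
  homog : ∀ A B, IsHomog k (S A B)
  symm : ∀ x ∈ spacelikeRegion, ∀ A B, S A B x = S B A x
  tangent : ∀ x ∈ spacelikeRegion, ∀ A, ∑ B, x B * S A B x = 0
  trace : ∀ x ∈ spacelikeRegion, ∑ A, eta A * S A A x = 0
  div : ∀ x ∈ spacelikeRegion, ∀ A, ∑ B, eta B * pd (S A B) B x = 0

namespace IsHomSDT

variable {k : ℤ} {S : Fin 4 → Fin 4 → Scalar}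

theorem isExtension (h : IsHomSDT k S) : IsExtension k S fun x A B => S A B x :=
  ⟨h.homog, fun _ _ _ _ => rfl, h.symm, h.tangent⟩

theorem isSDT (h : IsHomSDT k S) : IsSDT fun x A B => S A B x where
  smooth A B := (h.homog A B).smooth_restrict fun _ _ => rfl
  tangent x hx A := by
    rw [← h.tangent x (dS3_subset_region hx) A]
    exact Finset.sum_congr rfl fun _ _ => mul_comm _ _
  symm x hx := h.symm x (dS3_subset_region hx)
  traceless x hx := h.trace x (dS3_subset_region hx)
  divFree x hx A := by
    rw [h.isExtension.divergence_eq hx, h.div x (dS3_subset_region hx),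
      h.trace x (dS3_subset_region hx)]
    simp

/-- The gradient of a power of `rad` is along the position vector, which `S` annihilates, so the
divergence stays zero. The degree can thus be changed freely. -/
theorem rad_zpow_mul (h : IsHomSDT k S) (m : ℤ) {l : ℤ} (hl : m + k = l) :
    IsHomSDT l fun A B x => rad x ^ m * S A B x where
  homog A B := ((isHomog_zpow_rad m).mul (h.homog A B)).of_eq hl
  symm x hx A B := by rw [h.symm x hx]
  tangent x hx A := by
    rw [← mul_zero (rad x ^ m), ← h.tangent x hx A, Finset.mul_sum]
    exact Finset.sum_congr rfl fun _ _ => by ring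
  trace x hx := by
    rw [← mul_zero (rad x ^ m), ← h.trace x hx, Finset.mul_sum]
    exact Finset.sum_congr rfl fun _ _ => by ring
  div x hx A := by
    have e : ∀ B, pd (fun y => rad y ^ m * S A B y) B x =
        m * (eta B * x B) * rad x ^ (m - 2) * S A B x + rad x ^ m * pd (S A B) B x := fun B => by
      rw [pd_mul ((isHomog_zpow_rad m).diff hx) ((h.homog A B).diff hx), pd_zpow_rad hx]
      ring
    simp only [e]
    calc _ = m * rad x ^ (m - 2) * ∑ B, x B * S A B x
          + rad x ^ m * ∑ B, eta B * pd (S A B) B x := by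
          rw [Finset.mul_sum, Finset.mul_sum, ← Finset.sum_add_distrib]
          exact Finset.sum_congr rfl fun B _ => by
            linear_combination (m * x B * rad x ^ (m - 2) * S A B x) * eta_mul_eta B
      _ = 0 := by rw [h.tangent x hx, h.div x hx]; ring

theorem sub {S' : Fin 4 → Fin 4 → Scalar} (h : IsHomSDT k S) (h' : IsHomSDT k S') :
    IsHomSDT k fun A B x => S A B x - S' A B x where
  homog A B := (h.homog A B).sub (h'.homog A B)
  symm x hx A B := by rw [h.symm x hx, h'.symm x hx]
  tangent x hx A := by
    simp only [mul_sub, Finset.sum_sub_distrib, h.tangent x hx, h'.tangent x hx, sub_zero]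
  trace x hx := by
    simp only [mul_sub, Finset.sum_sub_distrib, h.trace x hx, h'.trace x hx, sub_zero]
  div x hx A := by
    have e : ∀ B, pd (fun y => S A B y - S' A B y) B x = pd (S A B) B x - pd (S' A B) B x :=
      fun B => pd_sub ((h.homog A B).diff hx) ((h'.homog A B).diff hx) _
    simp only [e, mul_sub, Finset.sum_sub_distrib, h.div x hx, h'.div x hx, sub_zero]

end IsHomSDT

/-- The homogeneous extension of a smooth tangential tensor field. -/
theorem IsSDT.isExtension {T : Tensor} (h : IsSDT T) (k : ℤ) :
    IsExtension k (fun A B x => rad x ^ k * T (radial x) A B) T where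
  homog A B := ((isHomog_zpow_rad k).mul (isHomog_comp_radial (h.smooth A B))).of_eq (by ring)
  eq x hx A B := by simp [rad_eq_one hx, radial_of_mem hx]
  symm x hx A B := by rw [h.symm _ (radial_mem_dS3 hx)]
  tangent x hx A := by
    rw [← mul_zero (rad x ^ k * rad x), ← h.tangent _ (radial_mem_dS3 hx) A, Finset.mul_sum]
    refine Finset.sum_congr rfl fun B _ => ?_
    have : x B = rad x * radial x B := by
      conv_lhs => rw [← rad_smul_radial hx]
      rfl
    rw [this]; ring

/-- Without a trace the intrinsic and flat divergences agree on the hyperboloid; homogeneity carries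
the vanishing to the whole region. -/
theorem IsSDT.isHomSDT {T : Tensor} (h : IsSDT T) (k : ℤ) :
    IsHomSDT k fun A B x => rad x ^ k * T (radial x) A B := by
  have ht : ∀ x ∈ spacelikeRegion, ∑ A, eta A * (rad x ^ k * T (radial x) A A) = 0 := by
    intro x hx
    rw [← mul_zero (rad x ^ k), ← h.traceless _ (radial_mem_dS3 hx), Finset.mul_sum]
    exact Finset.sum_congr rfl fun _ _ => by ring
  refine ⟨(h.isExtension k).homog, (h.isExtension k).symm, (h.isExtension k).tangent, ht, ?_⟩
  intro x hx A
  have h1 : IsHomog (k - 1) fun x => ∑ B, eta B * pd (fun y => rad y ^ k * T (radial y) A B) B x :=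
    IsHomog.sum fun B _ => (((h.isExtension k).homog A B).pd B).const_mul _
  have h2 : IsHomog (k - 1) fun _ => 0 := (h1.sub h1).congr fun _ _ => by simp
  refine h1.ext h2 (fun y hy => ?_) hx
  have := (h.isExtension k).divergence_eq hy A
  rw [h.divFree y hy, ht y (dS3_subset_region hy), mul_zero, add_zero] at this
  exact this.symm

theorem sum_eps_mul_eps (x : Mink) (A E : Fin 4) :
    ∑ C, ∑ D, eps x A C D * eps x E C D * eta C * eta D =
      -2 * ((if A = E then eta A else 0) * mink x x - eta A * x A * (eta E * x E)) := by
  simp only [eps, vol_eq, mink, Fin.sum_univ_four, eta, Pi.single_apply]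
  fin_cases A <;> fin_cases E <;> simp <;> ring

/-- A curl-free potential of a divergence-free tensor can be chosen symmetric, traceless and
divergence-free. -/
theorem IsHomSDT.exists_potential {S : Fin 4 → Fin 4 → Scalar} (h : IsHomSDT (-3) S)
    (h0 : ∀ B, sphereInt (S 0 B) = 0) :
    ∃ a : Fin 4 → Fin 4 → Scalar, IsHomSDT (-1) a ∧ ∀ x ∈ spacelikeRegion, ∀ B C D,
      pd (a B D) C x - pd (a B C) D x = dualForm (fun A => S A B) x C D := by
  have hdivS : ∀ B, ∀ x ∈ spacelikeRegion, ∑ A, eta A * pd (S A B) A x = 0 := fun B x hx => by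
    rw [← h.div x hx B]
    exact Finset.sum_congr rfl fun A _ => by rw [h.isExtension.pd_symm hx]
  choose a0 hom0 tan0 curl0 using fun B =>
    DeSitter.exists_potential (fun A => h.homog A B) (hdivS B) (h0 B)
  -- The failure of the index `B` to be tangential. Adding the gradient of `b B` leaves each curl
  -- unchanged. Since `b` itself is tangential, the Leibniz rule makes this gradient contribute `-b`
  -- to the contraction over `B`.
  set b : Fin 4 → Scalar := fun D x => ∑ B, x B * a0 B D x with hb
  have homb : ∀ D, IsHomog 0 (b D) := fun D =>
    IsHomog.sum fun B _ => ((IsHomog.coord B).mul (hom0 B D)).of_eq (by norm_num)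
  have tanb : ∀ x ∈ spacelikeRegion, ∑ B, x B * b B x = 0 := fun x hx => by
    simp only [hb, Finset.mul_sum]
    rw [Finset.sum_comm]
    refine Finset.sum_eq_zero fun B _ => ?_
    rw [← mul_zero (x B), ← tan0 B x hx, Finset.mul_sum]
    exact Finset.sum_congr rfl fun _ _ => by ring
  set a1 : Fin 4 → Fin 4 → Scalar := fun B D x => a0 B D x + pd (b B) D x with ha1
  have hom1 : ∀ B D, IsHomog (-1) (a1 B D) := fun B D =>
    (hom0 B D).add (((homb B).pd D).of_eq (by norm_num))
  have tan1 : ∀ x ∈ spacelikeRegion, ∀ B, ∑ D, x D * a1 B D x = 0 := fun x hx B => by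
    have := (homb B).euler hx
    simp only [ha1, mul_add, Finset.sum_add_distrib, tan0 B x hx, this]
    simp
  have tan1' : ∀ D, ∀ x ∈ spacelikeRegion, ∑ B, x B * a1 B D x = 0 := fun D x hx => by
    simp only [ha1, mul_add, Finset.sum_add_distrib,
      sum_mul_pd (fun B => (homb B).smooth) tanb hx D]
    simp [hb]
  have curl1 : ∀ x ∈ spacelikeRegion, ∀ B C D,
      pd (a1 B D) C x - pd (a1 B C) D x = dualForm (fun A => S A B) x C D := fun x hx B C D => by
    rw [← curl0 B x hx C D]
    simp only [ha1]
    rw [pd_add ((hom0 B D).diff hx) (((homb B).pd D).diff hx),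
      pd_add ((hom0 B C).diff hx) (((homb B).pd C).diff hx),
      pd_comm (homb B).smooth hx C D]
    ring
  -- Contract the curl equation with `x B`: the right side vanishes since `S` is tangential, while
  -- the Leibniz rule turns the left side into the antisymmetric part of `a1`.
  have symm1 : ∀ x ∈ spacelikeRegion, ∀ C D, a1 C D x = a1 D C x := fun x hx C D => by
    have e1 := sum_mul_pd (fun B => (hom1 B D).smooth) (tan1' D) hx C
    have e2 := sum_mul_pd (fun B => (hom1 B C).smooth) (tan1' C) hx D
    have e3 : ∑ B, x B * (pd (a1 B D) C x - pd (a1 B C) D x) = 0 := by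
      simp only [curl1 x hx, dualForm, mul_neg, Finset.mul_sum, Finset.sum_neg_distrib]
      rw [Finset.sum_comm, neg_eq_zero]
      refine Finset.sum_eq_zero fun A _ => ?_
      rw [← mul_zero (eps x A C D * eta A), ← h.tangent x hx A, Finset.mul_sum]
      exact Finset.sum_congr rfl fun _ _ => by ring
    simp only [mul_sub, Finset.sum_sub_distrib, e1, e2] at e3
    linarith
  -- A Hessian is symmetric and has no curl, and that of a degree-one function is tangential, so it
  -- may be used to cancel the trace.
  obtain ⟨F, homF, boxF⟩ := exists_box_eq (G := fun x => -∑ A, eta A * a1 A A x)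
    (IsHomog.sum fun A _ => (hom1 A A).const_mul _).neg
  have homP : ∀ A B, IsHomog (-1) (pd (pd F A) B) := fun A B =>
    ((homF.pd A).pd B).of_eq (by norm_num)
  set a2 : Fin 4 → Fin 4 → Scalar := fun B D x => a1 B D x + pd (pd F B) D x with ha2
  have hom2 : ∀ B D, IsHomog (-1) (a2 B D) := fun B D => (hom1 B D).add (homP B D)
  have symm2 : ∀ x ∈ spacelikeRegion, ∀ C D, a2 C D x = a2 D C x := fun x hx C D => by
    simp only [ha2]
    rw [symm1 x hx, pd_comm homF.smooth hx]
  have trace2 : ∀ x ∈ spacelikeRegion, ∑ A, eta A * a2 A A x = 0 := fun x hx => by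
    have := boxF x hx
    simp only [box] at this
    simp only [ha2, mul_add, Finset.sum_add_distrib, this, add_neg_cancel]
  have curl2 : ∀ x ∈ spacelikeRegion, ∀ B C D,
      pd (a2 B D) C x - pd (a2 B C) D x = dualForm (fun A => S A B) x C D := fun x hx B C D => by
    rw [← curl1 x hx B C D]
    simp only [ha2]
    rw [pd_add ((hom1 B D).diff hx) ((homP B D).diff hx),
      pd_add ((hom1 B C).diff hx) ((homP B C).diff hx),
      pd_comm (homF.pd B).smooth hx C D]
    ring
  refine ⟨a2, ⟨hom2, symm2, fun x hx A => ?_, trace2, fun x hx C => ?_⟩, curl2⟩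
  · have := (homF.pd A).euler hx
    simp only [ha2, mul_add, Finset.sum_add_distrib, tan1 x hx, this]
    simp
  · have e1 : ∑ B, eta B * pd (a2 B B) C x = 0 := by
      have e : pd (fun y => ∑ B, eta B * a2 B B y) C x = 0 := by
        rw [pd_congr (g := fun _ => 0) trace2 hx, pd_const]
      rw [pd_sum fun B _ => ((hom2 B B).const_mul _).diff hx] at e
      simpa only [pd_const_mul ((hom2 _ _).diff hx)] using e
    -- The contracted curl pairs the symmetric `S` with the antisymmetric `eps`. As the trace has
    -- zero gradient, what is left is the divergence.
    have e2 : ∑ B, eta B * (pd (a2 B B) C x - pd (a2 B C) B x) = 0 := by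
      simp only [curl2 x hx, dualForm, mul_neg, Finset.mul_sum, Finset.sum_neg_distrib]
      rw [neg_eq_zero]
      have : ∑ B, ∑ A, eta B * (eps x A C B * eta A * S A B x) =
          -∑ B, ∑ A, eta B * (eps x A C B * eta A * S A B x) := by
        conv_lhs => rw [Finset.sum_comm]
        simp only [← Finset.sum_neg_distrib]
        refine Finset.sum_congr rfl fun A _ => Finset.sum_congr rfl fun B _ => ?_
        have : eps x A C B = - eps x B C A := by simp only [eps, vol_eq]; ring
        rw [this, h.symm x hx A B]; ring
      linarith
    simp only [mul_sub, Finset.sum_sub_distrib, e1] at e2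
    have e3 : ∑ B, eta B * pd (a2 C B) B x = ∑ B, eta B * pd (a2 B C) B x :=
      Finset.sum_congr rfl fun B _ => by rw [pd_congr (fun y hy => symm2 y hy C B) hx]
    rw [e3]; linarith

/-- A tensor without translation charges is a curl. -/
theorem IsHomSDT.exists_curl_eq {S : Fin 4 → Fin 4 → Scalar} (h : IsHomSDT (-3) S)
    (h0 : ∀ B, sphereInt (S 0 B) = 0) :
    ∃ T' : Tensor, IsSDT T' ∧ ∀ x ∈ dS3, ∀ A B, curl T' x A B = S A B x := by
  obtain ⟨a, ha, hcurl⟩ := h.exists_potential h0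
  refine ⟨_, ha.isSDT, fun x hx A B => ?_⟩
  have hxU := dS3_subset_region hx
  rw [ha.isExtension.curl_eq hx]
  have e1 : ∑ C, ∑ D, eps x A C D * eta C * eta D * pd (a D B) C x =
      ∑ C, ∑ D, eps x A C D * eta C * eta D * pd (a B D) C x :=
    Finset.sum_congr rfl fun C _ => Finset.sum_congr rfl fun D _ => by
      rw [ha.isExtension.pd_symm hxU]
  have e2 : ∑ C, ∑ D, eps x A C D * eta C * eta D * pd (a B D) C x =
      -∑ C, ∑ D, eps x A C D * eta C * eta D * pd (a B C) D x := by
    rw [Finset.sum_comm]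
    simp only [← Finset.sum_neg_distrib]
    refine Finset.sum_congr rfl fun C _ => Finset.sum_congr rfl fun D _ => ?_
    rw [IsExtension.eps_antisymm]; ring
  have e3 : 2 * ∑ C, ∑ D, eps x A C D * eta C * eta D * pd (a B D) C x =
      ∑ C, ∑ D, eps x A C D * eta C * eta D * dualForm (fun A => S A B) x C D := by
    simp only [← hcurl x hxU, mul_sub, Finset.sum_sub_distrib]
    linarith
  -- Contracting two volume forms of a Lorentzian metric gives -2 times the projection; the sign in
  -- `dualForm` and the factor 2 in `e3` undo this.
  have e4 : ∑ C, ∑ D, eps x A C D * eta C * eta D * dualForm (fun A => S A B) x C D =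
      -∑ E, (∑ C, ∑ D, eps x A C D * eps x E C D * eta C * eta D) * (eta E * S E B x) := by
    simp only [dualForm, Finset.sum_mul, Finset.mul_sum, mul_neg, Finset.sum_neg_distrib]
    congr 1
    rw [Finset.sum_congr rfl fun C _ => Finset.sum_comm, Finset.sum_comm]
    exact Finset.sum_congr rfl fun _ _ => Finset.sum_congr rfl fun _ _ =>
      Finset.sum_congr rfl fun _ _ => by ring
  have e5 : ∑ E, (∑ C, ∑ D, eps x A C D * eps x E C D * eta C * eta D) * (eta E * S E B x) =
      -2 * S A B x := by
    have hm : mink x x = 1 := hx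
    have ht := h.isExtension.tangent' hxU B
    simp only [sum_eps_mul_eps, hm]
    calc _ = -2 * ∑ E, (if A = E then eta A else 0) * eta E * S E B x
          + 2 * eta A * x A * ∑ E, x E * S E B x := by
          rw [Finset.mul_sum, Finset.mul_sum, ← Finset.sum_add_distrib]
          exact Finset.sum_congr rfl fun E _ => by
            linear_combination (2 * eta A * x A * x E * S E B x) * eta_mul_eta E
      _ = _ := by
          rw [ht]
          simp [eta_mul_eta]
  rw [e1]
  linarith

/-! ### The lowest harmonics and their extensions -/

theorem spaceNorm_eq_cosh_tau {x : Mink} (hx : x ∈ dS3) : spaceNorm x = Real.cosh (tau x) := by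
  have h : mink x x = 1 := hx
  rw [mink_eq] at h
  rw [tau, Real.cosh_arsinh, spaceNorm]
  congr 1; linarith

theorem sinh_tau (x : Mink) : Real.sinh (tau x) = x 0 := Real.sinh_arsinh _

theorem zeta_eq (i : Fin 4) (x : Mink) : zeta i x = x i := by
  refine Fin.cases (sinh_tau x) (fun k => ?_) i
  simp only [zeta, harm, Fin.cases_succ]
  have := (Real.cosh_pos (tau x)).ne'
  field_simp

/-- The monomials in time and in the inverse of the spatial norm. -/
noncomputable def timeMono (a b : ℕ) (x : Mink) : ℝ := x 0 ^ a * invNorm x ^ b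

theorem isHomog_invNorm_pow (b : ℕ) : IsHomog (-b) fun x => invNorm x ^ b := by
  induction b with
  | zero => exact (isHomog_zpow_rad 0).congr fun x _ => by simp
  | succ b ih =>
    exact ((ih.mul isHomog_invNorm).of_eq (by push_cast; ring)).congr fun x _ => pow_succ _ _

theorem isHomog_time_pow (a : ℕ) : IsHomog a fun x => x 0 ^ a := by
  induction a with
  | zero => exact (isHomog_zpow_rad 0).congr fun x _ => by simp
  | succ b ih =>
    exact ((ih.mul (IsHomog.coord 0)).of_eq (by push_cast; ring)).congr fun x _ => pow_succ _ _

theorem isHomog_timeMono (a b : ℕ) : IsHomog (a - b) (timeMono a b) :=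
  ((isHomog_time_pow a).mul (isHomog_invNorm_pow b)).of_eq (by ring)

theorem pd_pow {f : Scalar} {x : Mink} (hf : DifferentiableAt ℝ f x) (n : ℕ) (C : Fin 4) :
    pd (fun y => f y ^ n) C x = n * f x ^ (n - 1) * pd f C x := by
  have := (hf.hasFDerivAt.pow n).fderiv
  simp only [pd]
  erw [this]
  simp

theorem pd_timeMono {x : Mink} (hx : x ∈ spacelikeRegion) (a b : ℕ) (C : Fin 4) :
    pd (timeMono a b) C x = if C = 0 then a * timeMono (a - 1) b x
      else -(b * x C * timeMono a (b + 2) x) := by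
  unfold timeMono
  rw [pd_mul ((isHomog_time_pow a).diff hx) ((isHomog_invNorm_pow b).diff hx),
    pd_pow ((IsHomog.coord 0).diff hx), pd_pow (isHomog_invNorm.diff hx), pd_coord, pd_invNorm hx]
  rcases eq_or_ne C 0 with rfl | h
  · simp; ring
  · rcases b with _ | b
    · simp [h, Ne.symm h]
    · simp [h, Ne.symm h, -mul_eq_mul_left_iff]; ring

/-- The extensions of degree one of the even lowest harmonics. -/
noncomputable def zetaExt : Fin 4 → Scalar :=
  Fin.cases (fun x => spaceNorm x + timeMono 2 1 x)
    (fun k x => (3 * timeMono 1 1 x - timeMono 3 3 x) * x k.succ)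

theorem isHomog_zetaExt (i : Fin 4) : IsHomog 1 (zetaExt i) := by
  refine Fin.cases ?_ (fun k => ?_) i
  · exact isHomog_spaceNorm.add ((isHomog_timeMono 2 1).of_eq (by norm_num))
  · exact ((((isHomog_timeMono 1 1).of_eq (by norm_num : _ = (0 : ℤ))).const_mul 3).sub
      ((isHomog_timeMono 3 3).of_eq (by norm_num))).mul (IsHomog.coord k.succ) |>.of_eq (by norm_num)

/-- On the hyperboloid the spatial norm is `cosh τ` and the time coordinate is `sinh τ`; the
extensions arise by making these expressions homogeneous of degree one. -/
theorem zetaHat_eq {x : Mink} (hx : x ∈ dS3) (i : Fin 4) : zetaHat i x = zetaExt i x := by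
  have hn := spaceNorm_pos (dS3_subset_region hx)
  have h2 : spaceNorm x ^ 2 = 1 + x 0 ^ 2 := by
    have h : mink x x = 1 := hx
    rw [mink_eq] at h
    rw [spaceNorm_sq]; linarith
  refine Fin.cases ?_ (fun k => ?_) i
  · simp only [zetaHat, zetaExt, Fin.cases_zero, Real.cosh_two_mul, sinh_tau,
      ← spaceNorm_eq_cosh_tau hx, timeMono, invNorm]
    field_simp
  · simp only [zetaHat, zetaExt, Fin.cases_succ, Real.tanh_eq_sinh_div_cosh, sinh_tau, harm,
      ← spaceNorm_eq_cosh_tau hx, timeMono, invNorm]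
    field_simp
    rw [h2]; ring

theorem differentiableAt_timeMono_sub {x : Mink} (hx : x ∈ spacelikeRegion) (p q : ℝ)
    (a b a' b' : ℕ) :
    DifferentiableAt ℝ (fun y => p * timeMono a b y - q * timeMono a' b' y) x :=
  (((isHomog_timeMono a b).const_mul p).diff hx).sub
    (((isHomog_timeMono a' b').const_mul q).diff hx)

theorem pd_timeMono_sub {x : Mink} (hx : x ∈ spacelikeRegion) (p q : ℝ) (a b a' b' : ℕ)
    (C : Fin 4) : pd (fun y => p * timeMono a b y - q * timeMono a' b' y) C x =
      if C = 0 then p * (a * timeMono (a - 1) b x) - q * (a' * timeMono (a' - 1) b' x)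
      else (q * (b' * timeMono a' (b' + 2) x) - p * (b * timeMono a (b + 2) x)) * x C := by
  rw [pd_sub (((isHomog_timeMono a b).const_mul p).diff hx)
      (((isHomog_timeMono a' b').const_mul q).diff hx),
    pd_const_mul ((isHomog_timeMono a b).diff hx), pd_const_mul ((isHomog_timeMono a' b').diff hx),
    pd_timeMono hx, pd_timeMono hx]
  split_ifs <;> ring

theorem pd_timeMono_sub_mul {x : Mink} (hx : x ∈ spacelikeRegion) (p q : ℝ) (a b a' b' : ℕ)
    (C j : Fin 4) : pd (fun y => (p * timeMono a b y - q * timeMono a' b' y) * y j) C x =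
      (if C = 0 then p * (a * timeMono (a - 1) b x) - q * (a' * timeMono (a' - 1) b' x)
      else (q * (b' * timeMono a' (b' + 2) x) - p * (b * timeMono a (b + 2) x)) * x C) * x j
      + (p * timeMono a b x - q * timeMono a' b' x) * if j = C then 1 else 0 := by
  rw [pd_mul (f := fun y => p * timeMono a b y - q * timeMono a' b' y)
    (differentiableAt_timeMono_sub hx p q a b a' b') ((IsHomog.coord j).diff hx),
    pd_timeMono_sub hx, pd_coord]

theorem pd_zetaExt_zero {x : Mink} (hx : x ∈ spacelikeRegion) (C : Fin 4) :
    pd (zetaExt 0) C x = if C = 0 then 2 * timeMono 1 1 x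
      else (1 * timeMono 0 1 x - 1 * timeMono 2 3 x) * x C := by
  change pd (fun x => spaceNorm x + timeMono 2 1 x) C x = _
  rw [pd_add (isHomog_spaceNorm.diff hx) ((isHomog_timeMono 2 1).diff hx), pd_spaceNorm hx,
    pd_timeMono hx]
  split_ifs
  · simp
  · simp [timeMono, invNorm]; ring

theorem zetaExt_succ (k : Fin 3) : zetaExt k.succ = fun x =>
    (3 * timeMono 1 1 x - 1 * timeMono 3 3 x) * x k.succ := by
  simp [zetaExt]

theorem pd_zetaExt_succ {x : Mink} (hx : x ∈ spacelikeRegion) (k : Fin 3) (C : Fin 4) :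
    pd (zetaExt k.succ) C x = if C = 0 then (3 * timeMono 0 1 x - 3 * timeMono 2 3 x) * x k.succ
      else (3 * timeMono 3 5 x - 3 * timeMono 1 3 x) * x C * x k.succ
        + (3 * timeMono 1 1 x - 1 * timeMono 3 3 x) * if k.succ = C then 1 else 0 := by
  rw [zetaExt_succ, pd_timeMono_sub_mul hx]
  by_cases h : C = 0
  · subst h; simp [-mul_eq_mul_left_iff, -mul_eq_mul_right_iff]
  · simp [h, -mul_eq_mul_left_iff, -mul_eq_mul_right_iff]

theorem timeMono_mul_sq {x : Mink} (hx : x ∈ spacelikeRegion) (a b : ℕ) :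
    timeMono a (b + 2) x * (x 1 ^ 2 + x 2 ^ 2 + x 3 ^ 2) = timeMono a b x := by
  have hp := (spaceNorm_pos hx).ne'
  have h : invNorm x ^ 2 * spaceNorm x ^ 2 = 1 := by rw [invNorm]; field_simp
  rw [← spaceNorm_sq, timeMono, timeMono]
  linear_combination (x 0 ^ a * invNorm x ^ b) * h

/-- With `r` the spatial norm: the Laplacian of `r` is `2 / r` and `1 / r` is harmonic; the
Laplacian of `x k / r` is `-2 * x k / r ^ 3` and `x k / r ^ 3` is harmonic. The second time
derivatives cancel the remaining terms. -/
theorem box_zetaExt {x : Mink} (hx : x ∈ spacelikeRegion) (i : Fin 4) : box (zetaExt i) x = 0 := by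
  unfold box
  refine Fin.cases ?_ (fun k => ?_) i
  · have h0 : pd (pd (zetaExt 0) 0) 0 x = 2 * timeMono 0 1 x := by
      rw [pd_congr (fun y hy => (pd_zetaExt_zero hy 0).trans (if_pos rfl)) hx,
        pd_const_mul ((isHomog_timeMono 1 1).diff hx), pd_timeMono hx]
      simp
    have hj : ∀ j : Fin 3, pd (pd (zetaExt 0) j.succ) j.succ x =
        (3 * timeMono 2 5 x - timeMono 0 3 x) * x j.succ ^ 2 + (timeMono 0 1 x - timeMono 2 3 x) :=
      fun j => by
        rw [pd_congr (fun y hy => (pd_zetaExt_zero hy _).trans (if_neg (Fin.succ_ne_zero j))) hx,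
          pd_timeMono_sub_mul hx, if_neg (Fin.succ_ne_zero j), if_pos rfl]
        push_cast; ring
    rw [Fin.sum_univ_succ]
    simp only [h0, hj, Fin.sum_univ_three, eta, Fin.succ_ne_zero, if_false, if_true]
    simp only [Fin.succ_zero_eq_one, Fin.succ_one_eq_two, show Fin.succ (2 : Fin 3) = 3 from rfl]
    linear_combination 3 * timeMono_mul_sq hx 2 3 - timeMono_mul_sq hx 0 1
  · have h0 : pd (pd (zetaExt k.succ) 0) 0 x = -6 * timeMono 1 3 x * x k.succ := by
      rw [pd_congr (fun y hy => (pd_zetaExt_succ hy k 0).trans (if_pos rfl)) hx,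
        pd_timeMono_sub_mul hx]
      simp [Fin.succ_ne_zero, -mul_eq_mul_right_iff]; ring
    have hj : ∀ j : Fin 3, pd (pd (zetaExt k.succ) j.succ) j.succ x =
        ((9 * timeMono 1 5 x - 15 * timeMono 3 7 x) * x j.succ ^ 2
          + (3 * timeMono 3 5 x - 3 * timeMono 1 3 x)) * x k.succ
        + 2 * (3 * timeMono 3 5 x - 3 * timeMono 1 3 x) * x j.succ * if k = j then 1 else 0 :=
      fun j => by
        rw [pd_congr (fun y hy => (pd_zetaExt_succ hy k _).trans (if_neg (Fin.succ_ne_zero j))) hx]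
        have d1 : DifferentiableAt ℝ
            (fun y : Mink => (3 * timeMono 3 5 y - 3 * timeMono 1 3 y) * y j.succ) x :=
          (differentiableAt_timeMono_sub hx 3 3 3 5 1 3).mul ((IsHomog.coord _).diff hx)
        have d2 := (IsHomog.coord k.succ).diff hx
        have d3 := differentiableAt_timeMono_sub hx 3 1 1 1 3 3
        have d4 : DifferentiableAt ℝ (fun y : Mink =>
            (3 * timeMono 3 5 y - 3 * timeMono 1 3 y) * y j.succ * y k.succ) x := d1.mul d2
        by_cases hkj : k = j
        · subst hkj
          simp only [if_true, mul_one]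
          rw [pd_add d4 d3, pd_mul d1 d2, pd_timeMono_sub_mul hx, pd_timeMono_sub hx, pd_coord,
            if_neg (Fin.succ_ne_zero k)]
          simp [Fin.succ_ne_zero]; ring
        · have hs : k.succ ≠ j.succ := fun h => hkj (Fin.succ_injective _ h)
          simp only [if_neg hs, if_neg hkj, mul_zero, add_zero]
          rw [pd_mul d1 d2, pd_timeMono_sub_mul hx, pd_coord, if_neg (Fin.succ_ne_zero j),
            if_neg hs]
          simp [-mul_eq_mul_right_iff]; ring
    have hs : ∑ j : Fin 3, 2 * (3 * timeMono 3 5 x - 3 * timeMono 1 3 x) * x j.succ *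
        (if k = j then 1 else 0) = 2 * (3 * timeMono 3 5 x - 3 * timeMono 1 3 x) * x k.succ := by
      simp
    rw [Fin.sum_univ_succ]
    simp only [h0, hj, eta, Fin.succ_ne_zero, if_false, if_true, one_mul,
      Finset.sum_add_distrib, hs]
    simp only [Fin.sum_univ_three, Fin.succ_zero_eq_one, Fin.succ_one_eq_two,
      show Fin.succ (2 : Fin 3) = 3 from rfl]
    linear_combination (9 * timeMono_mul_sq hx 1 3 - 15 * timeMono_mul_sq hx 3 5) * x k.succ

/-- The flux density of the lowest harmonics on the sphere at time zero. -/
theorem pd_pd_zetaExt {x : Mink} (hx : x ∈ dS3) (hx0 : x 0 = 0) (i B : Fin 4) :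
    pd (pd (zetaExt i) 0) B x = if i = 0 then (if B = 0 then 2 else 0)
      else (if B = 0 then 0 else 3 * ((if i = B then 1 else 0) - x i * x B)) := by
  have hxU := dS3_subset_region hx
  have hi : invNorm x = 1 := by
    have h : mink x x = 1 := hx
    rw [mink_eq, hx0] at h
    rw [invNorm, spaceNorm, show x 1 ^ 2 + x 2 ^ 2 + x 3 ^ 2 = 1 by linarith]
    simp
  refine Fin.cases ?_ (fun k => ?_) i
  · rw [pd_congr (fun y hy => (pd_zetaExt_zero hy 0).trans (if_pos rfl)) hxU,
        pd_const_mul ((isHomog_timeMono 1 1).diff hxU), pd_timeMono hxU]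
    simp [timeMono, hi, hx0]
  · rw [pd_congr (fun y hy => (pd_zetaExt_succ hy k 0).trans (if_pos rfl)) hxU,
        pd_timeMono_sub_mul hxU]
    simp only [timeMono, hi, hx0]
    by_cases hB : B = 0
    · subst hB; simp [Fin.succ_ne_zero]
    · simp [hB, Fin.succ_ne_zero]; split_ifs <;> ring

/-! ### Fluxes of the lowest harmonics -/

theorem sphereInt_const_mul (c : ℝ) (f : Scalar) :
    sphereInt (fun x => c * f x) = c * sphereInt f := by
  simp only [sphereInt, ← intervalIntegral.integral_const_mul]
  refine intervalIntegral.integral_congr fun φ _ => intervalIntegral.integral_congr fun θ _ => ?_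
  ring

theorem sphereInt_sub {f g : Scalar} (hf : SmoothOn f) (hg : SmoothOn g) :
    sphereInt (fun x => f x - g x) = sphereInt f - sphereInt g := by
  have h := sphereInt_add hf (contDiffOn_const.mul hg : SmoothOn fun x => (-1) * g x)
  rw [sphereInt_const_mul] at h
  rw [sub_eq_add_neg, ← neg_one_mul, ← h]
  congr 1; ext x; ring

theorem sphereInt_sum {ι : Type*} {s : Finset ι} {f : ι → Scalar} (hf : ∀ i ∈ s, SmoothOn (f i)) :
    sphereInt (fun x => ∑ i ∈ s, f i x) = ∑ i ∈ s, sphereInt (f i) := by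
  classical
  induction s using Finset.induction_on with
  | empty => simp [sphereInt]
  | insert a s ha ih =>
    simp only [Finset.sum_insert ha]
    rw [sphereInt_add (hf a (Finset.mem_insert_self a s))
      (SmoothOn.sum fun i hi => hf i (Finset.mem_insert_of_mem hi)),
      ih fun i hi => hf i (Finset.mem_insert_of_mem hi)]

theorem sphereInt_mul {f : Scalar} {p q : ℝ → ℝ}
    (h : ∀ θ φ, Real.sin θ * f (unitPt θ φ) = p θ * q φ) :
    sphereInt f = (∫ φ in (0 : ℝ)..(2 * Real.pi), q φ) * ∫ θ in (0 : ℝ)..Real.pi, p θ := by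
  simp only [sphereInt, h, intervalIntegral.integral_mul_const, intervalIntegral.integral_const_mul]
  rw [mul_comm]

theorem integral_sin_mul_cos_sq :
    ∫ θ in (0 : ℝ)..Real.pi, Real.sin θ * Real.cos θ ^ 2 = 2 / 3 := by
  have h := integral_sin_pow_odd_mul_cos_pow (a := 0) (b := Real.pi) 0 2
  simp only [Nat.mul_zero, zero_add, pow_one, pow_zero, mul_one, integral_pow, Real.cos_pi,
    Real.cos_zero] at h
  rw [h]
  norm_num

theorem integral_sin_cube' : ∫ θ in (0 : ℝ)..Real.pi, Real.sin θ ^ 3 = 4 / 3 := by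
  rw [integral_sin_pow]; norm_num

theorem sphereInt_one : sphereInt (fun _ => 1) = 4 * Real.pi := by
  rw [sphereInt_mul (p := Real.sin) (q := fun _ => 1) fun θ φ => rfl]
  simp; ring

theorem sphereInt_coord_mul_coord (i B : Fin 3) : sphereInt (fun x => x i.succ * x B.succ) =
    if i = B then 4 * Real.pi / 3 else 0 := by
  have e12 : sphereInt (fun x => x 1 * x 2) = 0 := by
    rw [sphereInt_mul (p := fun θ => Real.sin θ ^ 2 * Real.cos θ) (q := Real.cos) fun θ φ => by
      simp [unitPt, -mul_eq_mul_left_iff]; ring]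
    simp
  have e13 : sphereInt (fun x => x 1 * x 3) = 0 := by
    rw [sphereInt_mul (p := fun θ => Real.sin θ ^ 2 * Real.cos θ) (q := Real.sin) fun θ φ => by
      simp [unitPt, -mul_eq_mul_left_iff]; ring]
    simp
  have e23 : sphereInt (fun x => x 2 * x 3) = 0 := by
    rw [sphereInt_mul (p := fun θ => Real.sin θ ^ 3) (q := fun φ => Real.sin φ * Real.cos φ)
      fun θ φ => by simp [unitPt, -mul_eq_mul_left_iff, -mul_eq_mul_right_iff]; ring]
    simp
  have e11 : sphereInt (fun x => x 1 * x 1) = 4 * Real.pi / 3 := by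
    rw [sphereInt_mul (p := fun θ => Real.sin θ * Real.cos θ ^ 2) (q := fun _ => 1) fun θ φ => by
      simp [unitPt, -mul_eq_mul_left_iff]; ring, integral_sin_mul_cos_sq]
    simp; ring
  have e22 : sphereInt (fun x => x 2 * x 2) = 4 * Real.pi / 3 := by
    rw [sphereInt_mul (p := fun θ => Real.sin θ ^ 3) (q := fun φ => Real.cos φ ^ 2) fun θ φ => by
      simp [unitPt, -mul_eq_mul_left_iff]; ring, integral_sin_cube', integral_cos_sq]
    simp; ring
  have e33 : sphereInt (fun x => x 3 * x 3) = 4 * Real.pi / 3 := by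
    rw [sphereInt_mul (p := fun θ => Real.sin θ ^ 3) (q := fun φ => Real.sin φ ^ 2) fun θ φ => by
      simp [unitPt, -mul_eq_mul_left_iff]; ring, integral_sin_cube', integral_sin_sq]
    simp; ring
  have hc : ∀ i j : Fin 4, sphereInt (fun x => x i * x j) = sphereInt fun x => x j * x i :=
    fun i j => by congr 1; ext x; ring
  fin_cases i <;> fin_cases B
  exacts [e11, e12, e13, (hc 2 1).trans e12, e22, e23, (hc 3 1).trans e13, (hc 3 2).trans e23, e33]

/-- The flux matrix is a nonzero multiple of the identity, the reason the even harmonics can absorb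
every obstruction. The spatial diagonal entries are `3 * (4π - 4π / 3)` and the time entry is `2 *
4π`. -/
theorem sphereInt_hessian_zetaExt (i B : Fin 4) :
    sphereInt (pd (pd (zetaExt i) 0) B) = if i = B then 8 * Real.pi else 0 := by
  rw [sphereInt_congr fun x hx hx0 => pd_pd_zetaExt hx hx0 i B]
  have h1 : SmoothOn fun _ => 1 := contDiffOn_const
  have h2 : ∀ i j : Fin 4, SmoothOn fun x => x i * x j := fun i j =>
    ((IsHomog.coord i).mul (IsHomog.coord j)).smooth
  have h0 : sphereInt (fun _ => 0) = 0 := by simp [sphereInt]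
  refine Fin.cases ?_ (fun i => ?_) i <;> refine Fin.cases ?_ (fun B => ?_) B
  · simp only [if_true]
    have := sphereInt_const_mul 2 fun _ => 1
    rw [sphereInt_one] at this
    rw [← mul_one (2 : ℝ), this]; ring
  · simp only [if_true, Fin.succ_ne_zero, if_false, h0, (Fin.succ_ne_zero _).symm]
  · simp only [if_true, Fin.succ_ne_zero, if_false, h0]
  · simp only [Fin.succ_ne_zero, if_false, Fin.succ_inj]
    rw [sphereInt_const_mul, sphereInt_sub contDiffOn_const (h2 _ _), sphereInt_coord_mul_coord]
    by_cases h : i = B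
    · simp only [h, if_true, sphereInt_one]; ring
    · simp [h, h0]

/-! ### The decomposition -/

/-- The extension of a combination of the even lowest harmonics. -/
noncomputable def zetaExtComb (c : Fin 4 → ℝ) : Scalar := fun x => ∑ i, c i * zetaExt i x

theorem isHomog_zetaExtComb (c : Fin 4 → ℝ) : IsHomog 1 (zetaExtComb c) :=
  IsHomog.sum fun i _ => (isHomog_zetaExt i).const_mul _

theorem zetaHatComb_eq (c : Fin 4 → ℝ) {x : Mink} (hx : x ∈ dS3) :
    zetaHatComb c x = zetaExtComb c x :=
  Finset.sum_congr rfl fun i _ => by rw [zetaHat_eq hx]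

theorem pd_pd_zetaExtComb (c : Fin 4 → ℝ) {x : Mink} (hx : x ∈ spacelikeRegion) (A B : Fin 4) :
    pd (pd (zetaExtComb c) A) B x = ∑ i, c i * pd (pd (zetaExt i) A) B x := by
  have e : ∀ y ∈ spacelikeRegion, pd (zetaExtComb c) A y = ∑ i, c i * pd (zetaExt i) A y := by
    intro y hy
    unfold zetaExtComb
    rw [pd_sum fun i _ => ((isHomog_zetaExt i).const_mul _).diff hy]
    simp only [pd_const_mul ((isHomog_zetaExt _).diff hy)]
  rw [pd_congr e hx, pd_sum fun i _ => (((isHomog_zetaExt i).pd A).const_mul _).diff hx]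
  simp only [pd_const_mul (((isHomog_zetaExt _).pd A).diff hx)]

theorem box_zetaExtComb (c : Fin 4 → ℝ) {x : Mink} (hx : x ∈ spacelikeRegion) :
    box (zetaExtComb c) x = 0 := by
  simp only [box, pd_pd_zetaExtComb c hx, Finset.mul_sum]
  rw [Finset.sum_comm]
  refine Finset.sum_eq_zero fun i _ => ?_
  rw [← mul_zero (c i), ← box_zetaExt hx i, box, Finset.mul_sum]
  exact Finset.sum_congr rfl fun _ _ => by ring

/-- Trace and divergence of a Hessian are the wave operator and its gradient, both zero here;
tangency is Euler's relation for first derivatives, which have degree zero. -/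
theorem isHomSDT_hessian (c : Fin 4 → ℝ) :
    IsHomSDT (-1) fun A B => pd (pd (zetaExtComb c) A) B where
  homog A B := (((isHomog_zetaExtComb c).pd A).pd B).of_eq (by norm_num)
  symm x hx A B := pd_comm (isHomog_zetaExtComb c).smooth hx A B
  tangent x hx A := by
    have := ((isHomog_zetaExtComb c).pd A).euler hx
    rw [this]; simp
  trace x hx := box_zetaExtComb c hx
  div x hx A := by
    have homP : ∀ B, IsHomog (-1) (pd (pd (zetaExtComb c) B) B) := fun B =>
      (((isHomog_zetaExtComb c).pd B).pd B).of_eq (by norm_num)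
    have e : pd (fun y => ∑ B, eta B * pd (pd (zetaExtComb c) B) B y) A x = 0 := by
      rw [pd_congr (g := fun _ => 0) (by exact fun y hy => box_zetaExtComb c hy) hx,
        pd_const]
    rw [pd_sum fun B _ => ((homP B).const_mul _).diff hx] at e
    simp only [pd_const_mul ((homP _).diff hx)] at e
    rw [← e]
    refine Finset.sum_congr rfl fun B _ => ?_
    rw [pd_congr (fun y hy => pd_comm (isHomog_zetaExtComb c).smooth hy A B) hx,
      pd_comm ((isHomog_zetaExtComb c).pd B).smooth hx A B]

theorem exists_decomposition {T : Tensor} (hT : IsSDT T) :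
    ∃ (T' : Tensor) (c : Fin 4 → ℝ), IsSDT T' ∧ Decomposes T T' c := by
  set S := fun A B x => rad x ^ (-3 : ℤ) * T (radial x) A B with hS
  have h1 : IsHomSDT (-3) S := hT.isHomSDT (-3)
  -- Each coefficient is the corresponding flux of `T`, normalized by the flux `8π` of one even
  -- harmonic.
  set c : Fin 4 → ℝ := fun B => sphereInt (S 0 B) / (8 * Real.pi) with hc
  -- The Hessian has degree -1; it is brought to degree -3 to be subtracted from `S`.
  have h2 := (isHomSDT_hessian c).rad_zpow_mul (-2) (l := -3) (by norm_num)
  obtain ⟨T', hT', hcurl⟩ := (h1.sub h2).exists_curl_eq fun B => by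
    rw [sphereInt_sub (h1.homog 0 B).smooth (h2.homog 0 B).smooth]
    have e : sphereInt (fun x => rad x ^ (-2 : ℤ) * pd (pd (zetaExtComb c) 0) B x) =
        sphereInt (S 0 B) := by
      rw [sphereInt_congr (g := fun x => ∑ i, c i * pd (pd (zetaExt i) 0) B x) fun x hx _ => by
          rw [pd_pd_zetaExtComb c (dS3_subset_region hx), rad_eq_one hx]; simp,
        sphereInt_sum fun i _ => ((((isHomog_zetaExt i).pd 0).pd B).const_mul _).smooth]
      simp only [sphereInt_const_mul, sphereInt_hessian_zetaExt]
      have := Real.pi_pos.ne'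
      simp only [mul_ite, mul_zero, Finset.sum_ite_eq', Finset.mem_univ, if_true, hc]
      field_simp
    rw [e, sub_self]
  refine ⟨T', c, hT', fun x hx A B => ?_⟩
  rw [hcurl x hx, potentialTensor_eq (isHomog_zetaExtComb c) (fun y hy => zetaHatComb_eq c hy) hx]
  simp [hS, rad_eq_one hx, radial_of_mem hx]

/-! ### Cuts and Green's theorem -/

theorem point_mem (τ θ φ : ℝ) : point τ θ φ ∈ dS3 := by
  have h : mink (point τ θ φ) (point τ θ φ) = 1 := by
    have e0 : point τ θ φ 0 = Real.sinh τ := rfl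
    have e1 : point τ θ φ 1 = Real.cosh τ * Real.cos θ := rfl
    have e2 : point τ θ φ 2 = Real.cosh τ * (Real.sin θ * Real.cos φ) := rfl
    have e3 : point τ θ φ 3 = Real.cosh τ * (Real.sin θ * Real.sin φ) := rfl
    rw [mink_eq, e0, e1, e2, e3]
    linear_combination Real.cosh_sq τ + (Real.cosh τ * Real.sin θ) ^ 2 * Real.sin_sq_add_cos_sq φ
      + Real.cosh τ ^ 2 * Real.sin_sq_add_cos_sq θ
  exact h

theorem contDiff_sph : ContDiff ℝ ∞ fun z : ℝ × ℝ => sph z.2 z.1 := by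
  refine contDiff_pi.2 fun D => ?_
  fin_cases D <;> simp [sph] <;> fun_prop

theorem contDiff_cutPoint {u : (Fin 3 → ℝ) → ℝ} (hu : ContDiff ℝ ∞ u) :
    ContDiff ℝ ∞ fun z : ℝ × ℝ => cutPoint u z.2 z.1 := by
  have h1 : ContDiff ℝ ∞ fun z : ℝ × ℝ => u (sph z.2 z.1) := hu.comp contDiff_sph
  refine contDiff_pi.2 fun D => ?_
  refine Fin.cases ?_ (fun k => ?_) D
  · exact Real.contDiff_sinh.comp h1
  · exact (Real.contDiff_cosh.comp h1).mul ((contDiff_pi.1 contDiff_sph) k)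

theorem hasDerivAt_snd {E : Type*} [NormedAddCommGroup E] [NormedSpace ℝ E] {h : ℝ × ℝ → E}
    {φ θ : ℝ} (hh : DifferentiableAt ℝ h (φ, θ)) :
    HasDerivAt (fun t => h (φ, t)) (fderiv ℝ h (φ, θ) (0, 1)) θ :=
  hh.hasFDerivAt.comp_hasDerivAt θ ((hasDerivAt_const θ φ).prodMk (hasDerivAt_id θ))

theorem hasDerivAt_fst {E : Type*} [NormedAddCommGroup E] [NormedSpace ℝ E] {h : ℝ × ℝ → E}
    {φ θ : ℝ} (hh : DifferentiableAt ℝ h (φ, θ)) :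
    HasDerivAt (fun t => h (t, θ)) (fderiv ℝ h (φ, θ) (1, 0)) φ :=
  hh.hasFDerivAt.comp_hasDerivAt φ ((hasDerivAt_id φ).prodMk (hasDerivAt_const φ θ))

theorem fderiv_coord {h : ℝ × ℝ → Mink} {z : ℝ × ℝ} (hh : DifferentiableAt ℝ h z) (v : ℝ × ℝ)
    (D : Fin 4) : fderiv ℝ h z v D = fderiv ℝ (fun y => h y D) z v := by
  rw [(hasFDerivAt_pi'.1 hh.hasFDerivAt D).fderiv]
  rfl

theorem fderiv_fderiv_comm {h : ℝ × ℝ → ℝ} (hh : ContDiff ℝ ∞ h) (z v w : ℝ × ℝ) :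
    fderiv ℝ (fun y => fderiv ℝ h y v) z w = fderiv ℝ (fun y => fderiv ℝ h y w) z v := by
  have hd : DifferentiableAt ℝ (fderiv ℝ h) z :=
    (hh.fderiv_right (m := ∞) (by simp)).differentiable (by simp) z
  have e : ∀ a : ℝ × ℝ, fderiv ℝ (fun y => fderiv ℝ h y a) z =
      (fderiv ℝ (fderiv ℝ h) z).flip a := fun a => by
    rw [fderiv_clm_apply hd (differentiableAt_const a)]
    simp
  have hs : IsSymmSndFDerivAt ℝ h z := hh.contDiffAt.isSymmSndFDerivAt (by
    simpa using (WithTop.coe_le_coe.2 le_top : ((2 : ℕ∞) : WithTop ℕ∞) ≤ ((⊤ : ℕ∞) : WithTop ℕ∞)))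
  rw [e, e]
  exact hs w v

/-- Green's theorem for the pull-back of a one-form to a cut. -/
theorem integral_pullback {P : ℝ × ℝ → Mink} (hP : ContDiff ℝ ∞ P) (hmem : ∀ z, P z ∈ spacelikeRegion)
    (hper : ∀ φ θ, P (φ + 2 * Real.pi, θ) = P (φ, θ))
    (h0 : ∀ φ, P (φ, 0) = P (0, 0)) (hpi : ∀ φ, P (φ, Real.pi) = P (0, Real.pi))
    {w : Fin 4 → Scalar} (hw : ∀ D, SmoothOn (w D)) :
    ∫ φ in (0 : ℝ)..(2 * Real.pi), ∫ θ in (0 : ℝ)..Real.pi,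
      ∑ C, ∑ D, (fderiv ℝ P (φ, θ) (0, 1) C * fderiv ℝ P (φ, θ) (1, 0) D
        - fderiv ℝ P (φ, θ) (0, 1) D * fderiv ℝ P (φ, θ) (1, 0) C) * pd (w D) C (P (φ, θ)) = 0 := by
  have hPd : ∀ z, DifferentiableAt ℝ P z := fun z => hP.differentiable (by simp) z
  have hPD : ∀ D, ContDiff ℝ ∞ fun z => P z D := contDiff_pi.1 hP
  have hdP : ∀ D v, ContDiff ℝ ∞ fun z => fderiv ℝ (fun y => P y D) z v := fun D v =>
    ((hPD D).fderiv_right (m := ∞) (by simp)).clm_apply contDiff_const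
  have hwP : ∀ D, ContDiff ℝ ∞ fun z => w D (P z) := fun D => (hw D).comp_contDiff hP hmem
  have hform : ∀ v, ContDiff ℝ ∞ fun z => ∑ D, w D (P z) * fderiv ℝ (fun y => P y D) z v := fun v =>
    ContDiff.sum fun D _ => (hwP D).mul (hdP D v)
  have hdw : ∀ D z v, fderiv ℝ (fun y => w D (P y)) z v =
      ∑ C, pd (w D) C (P z) * fderiv ℝ P z v C := fun D z v => by
    have := (((hw D).differentiableAt (hmem z)).hasFDerivAt.comp z (hPd z).hasFDerivAt).fderiv
    have e : fderiv ℝ (fun y => w D (P y)) z v = fderiv ℝ (w D) (P z) (fderiv ℝ P z v) := by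
      exact congrArg (fun L => L v) this
    rw [e, fderiv_apply_eq_sum]
    exact Finset.sum_congr rfl fun _ _ => by ring
  have hdf : ∀ z v v', fderiv ℝ (fun z => ∑ D, w D (P z) * fderiv ℝ (fun y => P y D) z v) z v' =
      ∑ D, ((∑ C, pd (w D) C (P z) * fderiv ℝ P z v' C) * fderiv ℝ P z v D
        + w D (P z) * fderiv ℝ (fun y => fderiv ℝ (fun y => P y D) y v) z v') := fun z v v' => by
    have hi : ∀ D, DifferentiableAt ℝ (fun z => w D (P z)) z := fun D =>
      (hwP D).differentiable (by simp) z
    have hj : ∀ D, DifferentiableAt ℝ (fun z => fderiv ℝ (fun y => P y D) z v) z := fun D =>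
      (hdP D v).differentiable (by simp) z
    have hm : ∀ D, DifferentiableAt ℝ (fun z => w D (P z) * fderiv ℝ (fun y => P y D) z v) z :=
      fun D => (hi D).mul (hj D)
    rw [fderiv_fun_sum fun D _ => hm D]
    rw [_root_.sum_apply]
    refine Finset.sum_congr rfl fun D _ => ?_
    rw [fderiv_fun_mul (hi D) (hj D), ← hdw, fderiv_coord (hPd z)]
    simp; ring
  -- The exterior derivative of the pulled-back one-form is `∂_θ w_φ - ∂_φ w_θ`. The component `w_φ`
  -- vanishes at the poles because the whole coordinate circle maps to one point there.
  have key := integral_sphere_divergence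
    (f := fun z => -∑ D, w D (P z) * fderiv ℝ (fun y => P y D) z (0, 1))
    (g := fun z => ∑ D, w D (P z) * fderiv ℝ (fun y => P y D) z (1, 0))
    ((hform (0, 1)).neg.of_le (by simp)) ((hform (1, 0)).of_le (by simp))
    (fun φ θ => (hasDerivAt_fst ((hform (0, 1)).differentiable (by simp) (φ, θ))).neg)
    (fun φ θ => hasDerivAt_snd ((hform (1, 0)).differentiable (by simp) (φ, θ)))
    (fun θ => by
      have e : ∀ D, fderiv ℝ (fun y => P y D) (2 * Real.pi, θ) (0, 1) =
          fderiv ℝ (fun y => P y D) (0, θ) (0, 1) := fun D => by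
        refine (hasDerivAt_snd ((hPD D).differentiable (by simp) _)).unique
          ((hasDerivAt_snd ((hPD D).differentiable (by simp) (0, θ))).congr_of_eventuallyEq
            (Filter.Eventually.of_forall fun t => ?_))
        have := hper 0 t
        rw [zero_add] at this
        exact congrFun this D
      have := hper 0 θ
      rw [zero_add] at this
      simp only [e, this])
    (fun φ => Finset.sum_eq_zero fun D _ => by
      have : fderiv ℝ (fun y => P y D) (φ, 0) (1, 0) = 0 :=
        (hasDerivAt_fst ((hPD D).differentiable (by simp) _)).unique
          ((hasDerivAt_const φ (P (0, 0) D)).congr_of_eventuallyEq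
            (Filter.Eventually.of_forall fun t => congrFun (h0 t) D))
      rw [this, mul_zero])
    (fun φ => Finset.sum_eq_zero fun D _ => by
      have : fderiv ℝ (fun y => P y D) (φ, Real.pi) (1, 0) = 0 :=
        (hasDerivAt_fst ((hPD D).differentiable (by simp) _)).unique
          ((hasDerivAt_const φ (P (0, Real.pi) D)).congr_of_eventuallyEq
            (Filter.Eventually.of_forall fun t => congrFun (hpi t) D))
      rw [this, mul_zero])
  refine Eq.trans ?_ key
  refine intervalIntegral.integral_congr fun φ _ => intervalIntegral.integral_congr fun θ _ => ?_
  simp only [hdf]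
  rw [Finset.sum_comm, ← Finset.sum_neg_distrib, ← Finset.sum_add_distrib]
  refine Finset.sum_congr rfl fun D _ => ?_
  rw [fderiv_fderiv_comm (hPD D) (φ, θ) (0, 1) (1, 0), Finset.sum_mul, Finset.sum_mul]
  rw [show ∀ a b c : ℝ, -(a + c) + (b + c) = b - a from fun a b c => by ring,
    ← Finset.sum_sub_distrib]
  exact Finset.sum_congr rfl fun _ _ => by ring

/-- A Gram determinant. For a unit `x` orthogonal to `u` and `v` it identifies the length of
`normal` with the area density. -/
theorem sum_vol_sq (x u v : Mink) : ∑ A, eta A * vol x (Pi.single A 1) u v ^ 2 =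
    -(mink x x * (mink u u * mink v v - mink u v ^ 2) - mink x u * (mink x u * mink v v -
      mink u v * mink x v) + mink x v * (mink x u * mink u v - mink u u * mink x v)) := by
  simp only [vol_eq, mink, Fin.sum_univ_four, eta, Pi.single_apply]
  simp
  ring

/-- Contracting the normal with `eps` returns the tangent bivector of the cut, so the flux of a curl
becomes the pull-back of an exterior derivative. -/
theorem sum_vol_mul_eps {x u v : Mink} (hx : mink x x = 1) (hu : mink x u = 0) (hv : mink x v = 0)
    (C D : Fin 4) : ∑ A, eta A * vol x (Pi.single A 1) u v * (eps x A C D * eta C * eta D) =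
      -(u C * v D - u D * v C) := by
  have key : ∑ A, eta A * vol x (Pi.single A 1) u v * (eps x A C D * eta C * eta D) =
      -(mink x x * (u C * v D - u D * v C) - x C * (mink x u * v D - u D * mink x v)
        + x D * (mink x u * v C - u C * mink x v)) := by
    simp only [eps, vol_eq, mink, Fin.sum_univ_four, eta, Pi.single_apply]
    fin_cases C <;> fin_cases D <;> simp <;> ring
  rw [key, hx, hu, hv]; ring

section Cut

variable {u : (Fin 3 → ℝ) → ℝ}

theorem cutPoint_mem (u : (Fin 3 → ℝ) → ℝ) (θ φ : ℝ) : cutPoint u θ φ ∈ dS3 := point_mem _ _ _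

theorem cutTheta_eq (hu : ContDiff ℝ ∞ u) (θ φ : ℝ) :
    cutTheta u θ φ = fderiv ℝ (fun z : ℝ × ℝ => cutPoint u z.2 z.1) (φ, θ) (0, 1) :=
  (hasDerivAt_snd ((contDiff_cutPoint hu).differentiable (by simp) (φ, θ))).deriv

theorem cutPhi_eq (hu : ContDiff ℝ ∞ u) (θ φ : ℝ) :
    cutPhi u θ φ = fderiv ℝ (fun z : ℝ × ℝ => cutPoint u z.2 z.1) (φ, θ) (1, 0) :=
  (hasDerivAt_fst ((contDiff_cutPoint hu).differentiable (by simp) (φ, θ))).deriv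

theorem cutPoint_of_sin_eq_zero {θ : ℝ} (h : Real.sin θ = 0) (φ φ' : ℝ) :
    cutPoint u θ φ = cutPoint u θ φ' := by
  have : sph θ φ = sph θ φ' := by simp [sph, h]
  simp only [cutPoint, point, this]

theorem cutPhi_of_sin_eq_zero {θ : ℝ} (h : Real.sin θ = 0) (φ : ℝ) : cutPhi u θ φ = 0 := by
  have : (fun s => cutPoint u θ s) = fun _ => cutPoint u θ φ :=
    funext fun s => cutPoint_of_sin_eq_zero h s φ
  rw [cutPhi, this, deriv_const]

theorem mink_fderiv_eq_zero {P : ℝ × ℝ → Mink} (hP : ContDiff ℝ ∞ P) (hmem : ∀ z, P z ∈ dS3)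
    (z v : ℝ × ℝ) : mink (P z) (fderiv ℝ P z v) = 0 := by
  have hd := (hP.differentiable (by simp) z).hasFDerivAt
  have h1 : HasFDerivAt (fun y => ∑ A, eta A * P y A * P y A)
      (∑ A, (2 * eta A * P z A) • (ContinuousLinearMap.proj A).comp (fderiv ℝ P z)) z := by
    refine HasFDerivAt.fun_sum fun A _ => ?_
    have hA := hasFDerivAt_pi'.1 hd A
    refine ((hA.const_mul (eta A)).mul hA).congr_fderiv ?_
    ext <;> simp <;> ring
  have h2 : HasFDerivAt (fun y => ∑ A, eta A * P y A * P y A) (0 : ℝ × ℝ →L[ℝ] ℝ) z := by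
    refine (hasFDerivAt_const (1 : ℝ) z).congr_of_eventuallyEq (Filter.Eventually.of_forall fun y => ?_)
    exact hmem y
  have := congrArg (fun L => L v) (h1.unique h2)
  simp only [_root_.sum_apply, _root_.smul_apply, ContinuousLinearMap.comp_apply,
    ContinuousLinearMap.proj_apply, smul_eq_mul, mul_assoc, ← Finset.mul_sum] at this
  simp only [mink, mul_assoc]
  simpa using this

theorem mink_cutTheta (hu : ContDiff ℝ ∞ u) (θ φ : ℝ) :
    mink (cutPoint u θ φ) (cutTheta u θ φ) = 0 := by
  rw [cutTheta_eq hu]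
  exact mink_fderiv_eq_zero (contDiff_cutPoint hu) (fun z => cutPoint_mem u _ _) (φ, θ) _

theorem mink_cutPhi (hu : ContDiff ℝ ∞ u) (θ φ : ℝ) :
    mink (cutPoint u θ φ) (cutPhi u θ φ) = 0 := by
  rw [cutPhi_eq hu]
  exact mink_fderiv_eq_zero (contDiff_cutPoint hu) (fun z => cutPoint_mem u _ _) (φ, θ) _

theorem mink_normal (hu : ContDiff ℝ ∞ u) (θ φ : ℝ) : -mink (normal u θ φ) (normal u θ φ) =
    mink (cutTheta u θ φ) (cutTheta u θ φ) * mink (cutPhi u θ φ) (cutPhi u θ φ)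
    - mink (cutTheta u θ φ) (cutPhi u θ φ) ^ 2 := by
  have h1 : mink (cutPoint u θ φ) (cutPoint u θ φ) = 1 := cutPoint_mem u θ φ
  have h := sum_vol_sq (cutPoint u θ φ) (cutTheta u θ φ) (cutPhi u θ φ)
  rw [h1, mink_cutTheta hu, mink_cutPhi hu] at h
  have e : mink (normal u θ φ) (normal u θ φ) = ∑ A, eta A *
      vol (cutPoint u θ φ) (Pi.single A 1) (cutTheta u θ φ) (cutPhi u θ φ) ^ 2 := by
    unfold mink normal
    refine Finset.sum_congr rfl fun A _ => ?_
    linear_combination (eta A * vol (cutPoint u θ φ) (Pi.single A 1) (cutTheta u θ φ)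
      (cutPhi u θ φ) ^ 2) * eta_mul_eta A
  rw [e, h]; ring

theorem mink_add_smul (a b : ℝ) (v w : Mink) : mink (a • v + b • w) (a • v + b • w) =
    a ^ 2 * mink v v + 2 * a * b * mink v w + b ^ 2 * mink w w := by
  simp only [mink, Fin.sum_univ_four, Pi.add_apply, Pi.smul_apply, smul_eq_mul]
  ring

/-- The normalization of the unit normal and the area density are the same square root and cancel.
Away from the poles spacelikeness makes it nonzero; at the poles `cutPhi`, hence `normal`, vanishes.
The product extends smoothly where the unit normal does not. -/
theorem unitNormal_mul_areaDensity (hu : IsCut u) {θ : ℝ} (hθ : θ ∈ Icc 0 Real.pi) (φ : ℝ)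
    (B : Fin 4) : unitNormal u θ φ B * areaDensity u θ φ = normal u θ φ B := by
  by_cases hs : Real.sin θ = 0
  · have h0 := cutPhi_of_sin_eq_zero (u := u) hs φ
    have hn : normal u θ φ B = 0 := by
      simp [normal, h0, vol_eq]
    simp [unitNormal, hn]
  · have hθ' : θ ∈ Ioo 0 Real.pi := by
      refine ⟨lt_of_le_of_ne hθ.1 ?_, lt_of_le_of_ne hθ.2 ?_⟩
      · rintro rfl; exact hs Real.sin_zero
      · rintro rfl; exact hs Real.sin_pi
    have hG : 0 < mink (cutTheta u θ φ) (cutTheta u θ φ) * mink (cutPhi u θ φ) (cutPhi u θ φ)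
        - mink (cutTheta u θ φ) (cutPhi u θ φ) ^ 2 := by
      set v := cutTheta u θ φ
      set w := cutPhi u θ φ
      -- Positivity of the Gram determinant: test spacelikeness on `v`, then on `mink v v` times the
      -- part of `w` orthogonal to `v`.
      have h1 := hu.spacelike θ hθ' φ 1 0 (Or.inl one_ne_zero)
      have h2 := hu.spacelike θ hθ' φ (-mink v w) (mink v v)
      change 0 < mink ((1 : ℝ) • v + (0 : ℝ) • w) ((1 : ℝ) • v + (0 : ℝ) • w) at h1
      rw [mink_add_smul] at h1
      have hv : 0 < mink v v := by linarith
      have h3 := h2 (Or.inr hv.ne')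
      change 0 < mink (-mink v w • v + mink v v • w) (-mink v w • v + mink v v • w) at h3
      rw [mink_add_smul] at h3
      have : 0 < mink v v * (mink v v * mink w w - mink v w ^ 2) := by nlinarith
      exact pos_of_mul_pos_right this hv.le
    simp only [unitNormal, areaDensity, mink_normal hu.smooth, Pi.smul_apply, smul_eq_mul]
    have := (Real.sqrt_pos.2 hG).ne'
    field_simp

theorem contDiff_normal (hu : ContDiff ℝ ∞ u) (B : Fin 4) :
    ContDiff ℝ ∞ fun z : ℝ × ℝ => normal u z.2 z.1 B := by
  have h0 := contDiff_pi.1 (contDiff_cutPoint hu)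
  have h1 : ∀ A, ContDiff ℝ ∞ fun z : ℝ × ℝ => cutTheta u z.2 z.1 A := by
    simp only [cutTheta_eq hu]
    exact contDiff_pi.1 (((contDiff_cutPoint hu).fderiv_right (m := ∞) (by simp)).clm_apply
      contDiff_const)
  have h2 : ∀ A, ContDiff ℝ ∞ fun z : ℝ × ℝ => cutPhi u z.2 z.1 A := by
    simp only [cutPhi_eq hu]
    exact contDiff_pi.1 (((contDiff_cutPoint hu).fderiv_right (m := ∞) (by simp)).clm_apply
      contDiff_const)
  simp only [normal, vol_eq]
  have := h0 0; have := h0 1; have := h0 2; have := h0 3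
  have := h1 0; have := h1 1; have := h1 2; have := h1 3
  have := h2 0; have := h2 1; have := h2 2; have := h2 3
  fun_prop

/-- The charge of a tangential symmetric tensor as an integral over the coordinate rectangle. -/
theorem charge_zeta_eq {T : Tensor} (ht : ∀ x ∈ dS3, ∀ A, ∑ B, T x A B * x B = 0)
    (hs : ∀ x ∈ dS3, ∀ A B, T x A B = T x B A) (hu : IsCut u) (i : Fin 4) :
    charge u T (zeta i) = ∫ φ in (0 : ℝ)..(2 * Real.pi), ∫ θ in (0 : ℝ)..Real.pi,
      ∑ B, eta i * T (cutPoint u θ φ) i B * normal u θ φ B := by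
  refine intervalIntegral.integral_congr fun φ _ => intervalIntegral.integral_congr fun θ hθ => ?_
  rw [uIcc_of_le Real.pi_pos.le] at hθ
  set p := cutPoint u θ φ with hp
  have hmem : p ∈ dS3 := cutPoint_mem u θ φ
  have hg : ∀ A, grad (zeta i) p A = (if i = A then 1 else 0) - eta A * p A * p i := fun A => by
    rw [grad_eq (IsHomog.coord i) (fun y _ => zeta_eq i y) hmem, pd_coord]; norm_num
  have hB : ∀ B, ∑ A, T p A B * (eta A * grad (zeta i) p A) = eta i * T p i B := fun B => by
    have h0 : ∑ A, T p A B * p A = 0 := by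
      rw [← ht p hmem B]
      exact Finset.sum_congr rfl fun A _ => by rw [hs p hmem]
    calc _ = ∑ A, (if i = A then eta A * T p A B else 0) - p i * ∑ A, T p A B * p A := by
          rw [Finset.mul_sum, ← Finset.sum_sub_distrib]
          refine Finset.sum_congr rfl fun A _ => ?_
          rw [hg]
          split_ifs
          · linear_combination -(T p A B * p A * p i) * eta_mul_eta A
          · linear_combination -(T p A B * p A * p i) * eta_mul_eta A
      _ = _ := by rw [h0]; simp
  change (∑ A, ∑ B, T p A B * (eta A * grad (zeta i) p A) * unitNormal u θ φ B)
    * areaDensity u θ φ = ∑ B, eta i * T p i B * normal u θ φ B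
  rw [Finset.sum_comm, Finset.sum_mul]
  refine Finset.sum_congr rfl fun B _ => ?_
  rw [← Finset.sum_mul, hB, mul_assoc, unitNormal_mul_areaDensity hu hθ]

/-- Symmetric curls have no translation charges. -/
theorem integral_curl_eq_zero {T' : Tensor} (hT' : IsSDT T')
    (hs : ∀ x ∈ dS3, ∀ A B, curl T' x A B = curl T' x B A) (hu : ContDiff ℝ ∞ u) (i : Fin 4) :
    ∫ φ in (0 : ℝ)..(2 * Real.pi), ∫ θ in (0 : ℝ)..Real.pi,
      ∑ B, curl T' (cutPoint u θ φ) i B * normal u θ φ B = 0 := by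
  have hE := hT'.isExtension 0
  set S : Fin 4 → Fin 4 → Scalar := fun A B x => rad x ^ (0 : ℤ) * T' (radial x) A B
  refine Eq.trans ?_ (integral_pullback (contDiff_cutPoint hu)
    (fun z => dS3_subset_region (cutPoint_mem u _ _)) (fun φ θ => ?_)
    (fun φ => cutPoint_of_sin_eq_zero Real.sin_zero _ _)
    (fun φ => cutPoint_of_sin_eq_zero Real.sin_pi _ _) fun D => (hE.homog D i).smooth)
  swap
  · simp only [cutPoint, point, sph, Real.cos_add_two_pi, Real.sin_add_two_pi]
  refine intervalIntegral.integral_congr fun φ _ => intervalIntegral.integral_congr fun θ _ => ?_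
  simp only [← cutTheta_eq hu, ← cutPhi_eq hu]
  have hmem := cutPoint_mem u θ φ
  have h1 := fun C D => sum_vol_mul_eps hmem (mink_cutTheta hu θ φ) (mink_cutPhi hu θ φ) C D
  -- Symmetry moves the fixed index `i` to the second slot; the curl in the remaining index is that
  -- of the one-form `S · i`.
  simp only [fun B => hs _ hmem i B, hE.curl_eq hmem, normal]
  calc _ = -∑ C, ∑ D, (∑ B, eta B * vol (cutPoint u θ φ) (Pi.single B 1) (cutTheta u θ φ)
        (cutPhi u θ φ) * (eps (cutPoint u θ φ) B C D * eta C * eta D)) *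
        pd (S D i) C (cutPoint u θ φ) := by
        simp only [Finset.sum_mul, mul_neg, Finset.sum_neg_distrib]
        congr 1
        rw [Finset.sum_comm]
        refine Finset.sum_congr rfl fun C _ => ?_
        rw [Finset.sum_comm]
        exact Finset.sum_congr rfl fun _ _ => Finset.sum_congr rfl fun _ _ => by ring
    _ = _ := by
        simp only [h1, neg_mul, Finset.sum_neg_distrib, neg_neg]

theorem integral_integral_sub {f g : ℝ → ℝ → ℝ} (hf : Continuous fun z : ℝ × ℝ => f z.1 z.2)
    (hg : Continuous fun z : ℝ × ℝ => g z.1 z.2) (a b c d : ℝ) :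
    ∫ φ in a..b, ∫ θ in c..d, (f φ θ - g φ θ) =
      (∫ φ in a..b, ∫ θ in c..d, f φ θ) - ∫ φ in a..b, ∫ θ in c..d, g φ θ := by
  have hi : ∀ {f : ℝ → ℝ → ℝ}, (Continuous fun z : ℝ × ℝ => f z.1 z.2) → ∀ φ,
      IntervalIntegrable (f φ) volume c d := fun hf φ =>
    (hf.comp (continuous_const.prodMk continuous_id : Continuous fun θ : ℝ => (φ, θ))
      ).intervalIntegrable _ _
  have ho : ∀ {f : ℝ → ℝ → ℝ}, (Continuous fun z : ℝ × ℝ => f z.1 z.2) →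
      IntervalIntegrable (fun φ => ∫ θ in c..d, f φ θ) volume a b := fun hf =>
    (intervalIntegral.continuous_parametric_intervalIntegral_of_continuous'
      (by exact hf) _ _).intervalIntegrable _ _
  rw [← intervalIntegral.integral_sub (ho (f := f) hf) (ho (f := g) hg)]
  refine intervalIntegral.integral_congr fun φ _ => ?_
  exact intervalIntegral.integral_sub (hi (f := f) hf φ) (hi (f := g) hg φ)

theorem continuous_charge_integrand {T : Tensor} (hT : IsSDT T) (hu : ContDiff ℝ ∞ u) (i : Fin 4) :
    Continuous fun z : ℝ × ℝ =>
      ∑ B, eta i * T (cutPoint u z.2 z.1) i B * normal u z.2 z.1 B := by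
  refine continuous_finsetSum _ fun B _ => ?_
  refine (continuous_const.mul ?_).mul (contDiff_normal hu B).continuous
  have h : ContDiff ℝ ∞ fun z : ℝ × ℝ => T (radial (cutPoint u z.2 z.1)) i B :=
    ContDiffOn.comp_contDiff (hT.smooth i B) (contDiff_cutPoint hu)
      fun z => dS3_subset_region (cutPoint_mem u _ _)
  refine h.continuous.congr fun z => ?_
  rw [radial_of_mem (cutPoint_mem u _ _)]

/-- The translation charges depend only on the coefficients of the even lowest harmonics. -/
theorem charge_eq {T T' : Tensor} {c : Fin 4 → ℝ} (hT : IsSDT T) (hT' : IsSDT T')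
    (hd : Decomposes T T' c) (hu : IsCut u) (i : Fin 4) :
    charge u T (zeta i) = charge u (potentialTensor (zetaHatComb c)) (zeta i) := by
  have hP := (isHomSDT_hessian c).isSDT
  have hPe : ∀ x ∈ dS3, ∀ A B,
      potentialTensor (zetaHatComb c) x A B = pd (pd (zetaExtComb c) A) B x := fun x hx A B =>
    potentialTensor_eq (isHomog_zetaExtComb c) (fun y hy => zetaHatComb_eq c hy) hx A B
  have hsub : ∀ x ∈ dS3, ∀ A B, curl T' x A B = T x A B - pd (pd (zetaExtComb c) A) B x :=
    fun x hx A B => by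
      rw [hd x hx, hPe x hx]; ring
  -- The decomposition itself yields symmetry of the curl, as a difference of symmetric tensors.
  have hcs : ∀ x ∈ dS3, ∀ A B, curl T' x A B = curl T' x B A := fun x hx A B => by
    rw [hsub x hx, hsub x hx, hT.symm x hx, hP.symm x hx]
  rw [charge_zeta_eq hT.tangent hT.symm hu, charge_zeta_eq (T := potentialTensor (zetaHatComb c))
    (fun x hx A => by simpa only [hPe x hx] using hP.tangent x hx A)
    (fun x hx A B => by simpa only [hPe x hx] using hP.symm x hx A B) hu]
  simp only [hPe _ (cutPoint_mem u _ _)]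
  rw [← sub_eq_zero, ← integral_integral_sub (continuous_charge_integrand hT hu.smooth i)
    (continuous_charge_integrand hP hu.smooth i)]
  refine Eq.trans ?_ ((congrArg (eta i * ·) (integral_curl_eq_zero hT' hcs hu.smooth i)).trans
    (mul_zero _))
  simp only [← intervalIntegral.integral_const_mul]
  refine intervalIntegral.integral_congr fun φ _ => intervalIntegral.integral_congr fun θ _ => ?_
  simp only [hsub _ (cutPoint_mem u _ _), Finset.mul_sum, ← Finset.sum_sub_distrib]
  exact Finset.sum_congr rfl fun _ _ => by ring

end Cut

end DeSitter

theorem lemma4 :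
    (∀ T : DeSitter.Tensor, DeSitter.IsSDT T →
      ∃ (T' : DeSitter.Tensor) (c : Fin 4 → ℝ), DeSitter.IsSDT T' ∧ DeSitter.Decomposes T T' c) ∧
    (∀ (T T' : DeSitter.Tensor) (c : Fin 4 → ℝ),
      DeSitter.IsSDT T → DeSitter.IsSDT T' → DeSitter.Decomposes T T' c →
      ∀ u : (Fin 3 → ℝ) → ℝ, DeSitter.IsCut u → ∀ i : Fin 4,
        DeSitter.charge u T (DeSitter.zeta i) =
          DeSitter.charge u (DeSitter.potentialTensor (DeSitter.zetaHatComb c))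
            (DeSitter.zeta i)) := by
  exact ⟨fun T hT => DeSitter.exists_decomposition hT, fun T T' c hT hT' hd u hu i =>
    DeSitter.charge_eq hT hT' hd hu i⟩
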